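/- **Setting.** Let $F$ be a number field and $B$ a central simple $F$-algebra of degree $n\ge 2$ (so $\dim_F B=n^2$), with reduced norm $\mathrm{Nrd}$ and reduced trace $\mathrm{Trd}$. Let $G$ be $\mathrm{SL}_1(B)=\ker(\mathrm{Nrd})$ or $\mathrm{PGL}_1(B)=B^\times/\mathbb G_m$. Fix an $\mathcal O_F$-order $\Omega\subset B$; for a finite place $u$ let $\Omega_u$ be its closure in $B_u=B\otimes_F F_u$ and let $K_u=\mathrm{SL}_1(\Omega_u)$, resp. $K_u=\mathrm{PGL}_1(\Omega_u)$ (the image of $\Omega_u^\times$), a compact open subgroup of $G(F_u)$. The group $G(\mathbb A)$ of adelic points is the restricted product of the $G(F_u)$ with respect to the $K_u$. Let $S$ be a finite set of places of $F$ containing all archimedean ones and $K_S=\prod_{u\notin S}K_u$. Write $|\cdot|_u$ for the normalized absolute value (with $|\varpi|_u=q^{-1}$ at finite places, the usual absolute value at real places, its square at complex places), extended uniquely to $\overline{F_u}$ where needed. A maximal torus of $G$ over a field extension $k$ of $F$ has the form $\mathrm{SL}_1(C)$, resp. $\mathrm{PGL}_1(C)$, for a unique commutative étale subalgebra $C\subset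 B\otimes_F k$ of degree $n$ over $k$. A homogeneous toral set is $Y=G(F)\backslash T(\mathbb A)g$ with $T\subset G$ a maximal torus over $F$, attached to $E\subset B$, and $g=(g_u)_u\in G(\mathbb A)$. Put $C_u=g_u^{-1}(E\otimes_F F_u)g_u$, the algebra of the torus $g_u^{-1}Tg_u$, and $\mathcal R_u=C_u\cap\Omega_u$ for $u$ finite. The set $Y$ is of *maximal type* if $\mathcal R_u$ is a maximal order of $C_u$ for every finite $u$. For $u$ finite the local discriminant is $D_u=|\det(\mathrm{Trd}(f_if_j))|_u^{-1}$ for an $\mathcal O_{F_u}$-basis $(f_i)$ of $\mathcal R_u$. For $u$ archimedean fix a Hermitian inner product $Q_u$ on $B\otimes_F\mathbb C$ (through the embedding $F\to\mathbb C$ of $u$) for which $1$ is orthogonal to $\ker\mathrm{Trd}$, and put $D_u=|\det(Q_u(f_i,f_j))|_u\cdot|\det(\mathrm{Trd}(f_if_j))|_u^{-1}$ for any $F_u$-basis $(f_i)$ of $C_u$ (squares of the usual absolute values at complex places). Let $D=\prod_uD_u$, and let $D_{\mathrm{ram}}$ be the product of the $D_u$ over the finite places $u$ at which $B$ is not split.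 Fix a place $\hat u\in S$ and a maximal torus $\mathbf H$ of $G$ over $F_{\hat u}$, and put $H=\mathbf H(F_{\hat u})$. The set $Y$ is *$H$-invariant* if $g_{\hat u}^{-1}Tg_{\hat u}=\mathbf H$. For $a\in H$ put $$h_{\mathrm{Haar}}(a)=\tfrac12\sum_{\alpha}\bigl|\log|\alpha(a)|_{\hat u}\bigr|,$$ the sum being over the $n(n-1)$ roots $\alpha$ of $\mathbf H$ over $\overline{F_{\hat u}}$. (This is the entropy of $a$ with respect to the Haar probability measure on the $S$-arithmetic quotient of $\prod_{u\in S}G(F_u)$.) Fix pre-compact sets $B_u\subset G(F_u)$ for $u\in S$, such that $B_u\subseteq K_u$ for every finite $u\in S$ with $u\ne\hat u$. For $\tau\in\mathbb Z_{\ge0}$ let $B^{(-\tau,\tau)}=\prod_{u\in S}B_u^{(-\tau,\tau)}$ with $B_u^{(-\tau,\tau)}=a_u^{\tau}B_ua_u^{-\tau}\cap a_u^{-\tau}B_ua_u^{\tau}$, where $a_{\hat u}=a$ and $a_u=1$ for $u\ne\hat u$. **Theorem.** There is a constant $\kappa$, depending only on the data fixed above ($F$, $B$, $G$, $\Omega$,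 $S$, $(Q_u)$, $\hat u$, $\mathbf H$ and the sets $B_u$) and not on $a$, $Y$ and $\tau$, such that the following holds. Let $a\in H$, and let $Y=G(F)\backslash T(\mathbb A)g$ be an $H$-invariant homogeneous toral set of maximal type. Let $L$ be the splitting field of $T$ (equivalently of $E$) over $F$, and assume that $\mathrm{Gal}(L/F)$ is $2$-transitive on the $n$ $F$-algebra homomorphisms $E\to L$ (equivalently, on the primitive idempotents of $E\otimes_FL$). If $\tau\in\mathbb Z_{\ge0}$ satisfies $$\frac{2\,h_{\mathrm{Haar}}(a)}{n-1}\,\tau>\log\bigl(D\,D_{\mathrm{ram}}^{n/2}\bigr)+\kappa,$$ then every $\lambda\in G(F)\cap T(\mathbb A)\,g\,\bigl(B^{(-\tau,\tau)}\times K_S\bigr)\,g^{-1}\,T(\mathbb A)$ belongs to $T(F)$. -/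

import Mathlib

open scoped TensorProduct Pointwise
open NumberField IsDedekindDomain

namespace Toral

noncomputable section

/-! ### Places and completions of a number field -/

/-- The places of a number field. -/
inductive Place (F : Type*) [Field F] [NumberField F] where
  | infinite (w : InfinitePlace F)
  | finite (v : HeightOneSpectrum (𝓞 F))

/-- The completion `F_u` of `F` at the place `u`. -/
def Place.Completion {F : Type*} [Field F] [NumberField F] : Place F → Type _
  | .infinite w => w.Completion
  | .finite v => v.adicCompletion F

/-- At an infinite place the norm is the usual absolute value of `ℝ` or `ℂ`; at a finite place a
uniformizer has norm `q⁻¹`, with `q` the cardinality of the residue field. -/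
instance {F : Type*} [Field F] [NumberField F] : (u : Place F) → NormedField u.Completion
  | .infinite w => inferInstanceAs (NormedField w.Completion)
  | .finite v => inferInstanceAs (NormedField (v.adicCompletion F))

instance {F : Type*} [Field F] [NumberField F] : (u : Place F) → Algebra F u.Completion
  | .infinite w => inferInstanceAs (Algebra F w.Completion)
  | .finite v => inferInstanceAs (Algebra F (v.adicCompletion F))

/-- The absolute value on `F_u`, normalized so that the product formula holds: the square of the
usual one at a complex place (a complex place counts twice), the norm at every other place. -/
def Place.nabs {F : Type*} [Field F] [NumberField F] : (u : Place F) → u.Completion → ℝ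
  | .infinite w, x => ‖x‖ ^ w.mult
  | .finite _, x => ‖x‖

/-- The unique extension of `|·|_u` to the algebraic closure of `F_u`: if `x` has degree `d` over
`F_u`, then `|x| = |N(x)|_u ^ (1 / d)`, with `N` the norm from `F_u(x)` to `F_u`. -/
def Place.closureAbs {F : Type*} [Field F] [NumberField F] (u : Place F)
    (x : AlgebraicClosure u.Completion) : ℝ :=
  u.nabs ((minpoly u.Completion x).coeff 0) ^ (1 / ((minpoly u.Completion x).natDegree : ℝ))

/-- The ring of integers of the completion at a finite place. -/
def localIntegers {F : Type*} [Field F] [NumberField F] (v : HeightOneSpectrum (𝓞 F)) :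
    Subring (Place.finite v).Completion :=
  (v.adicCompletionIntegers F).toSubring

/-- The field `ℂ`, viewed as an extension of `F` through the embedding attached to `w`. -/
def ComplexAt {F : Type*} [Field F] (_w : InfinitePlace F) : Type := ℂ

instance {F : Type*} [Field F] (w : InfinitePlace F) : Field (ComplexAt w) :=
  inferInstanceAs (Field ℂ)

instance {F : Type*} [Field F] (w : InfinitePlace F) : Algebra ℂ (ComplexAt w) :=
  inferInstanceAs (Algebra ℂ ℂ)

instance {F : Type*} [Field F] (w : InfinitePlace F) : Algebra F (ComplexAt w) :=
  RingHom.toAlgebra (S := ComplexAt w) w.embedding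

/-- The embedding of `F_w` into `ℂ` that extends the one attached to `w`. -/
def completionToComplex {F : Type*} [Field F] [NumberField F] (w : InfinitePlace F) :
    (Place.infinite w).Completion →ₐ[F] ComplexAt w :=
  { (InfinitePlace.Completion.extensionEmbedding w :) with
    commutes' := fun x => InfinitePlace.Completion.extensionEmbedding_coe w (WithAbs.toAbs w.1 x) }

/-! ### The groups `SL₁(B)` and `PGL₁(B)` -/

/-- The two forms: `SL₁(B)` and `PGL₁(B)`. -/
inductive Form where
  | simplyConnected
  | adjoint

section Groups

variable {F : Type*} [Field F] {B : Type*} [Ring B] [Algebra F B]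

/-- A splitting of `B` over the algebraic closure of `F`. -/
abbrev Splitting (n : ℕ) (F B : Type*) [Field F] [Ring B] [Algebra F B] :=
  (AlgebraicClosure F ⊗[F] B) ≃ₐ[AlgebraicClosure F] Matrix (Fin n) (Fin n) (AlgebraicClosure F)

/-- The homomorphism `R ⊗ B → Mₙ(R ⊗ F̄)` induced by a splitting of `B` over `F̄`. -/
def splitHom {n : ℕ} (φ : Splitting n F B) (R : Type*) [CommRing R] [Algebra F R] :
    R ⊗[F] B →ₐ[R] Matrix (Fin n) (Fin n) (R ⊗[F] AlgebraicClosure F) :=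
  Algebra.TensorProduct.lift (Algebra.ofId R _)
    (((Algebra.TensorProduct.includeRight :
        AlgebraicClosure F →ₐ[F] R ⊗[F] AlgebraicClosure F).mapMatrix (m := Fin n)).comp
      ((φ.toAlgHom.restrictScalars F).comp Algebra.TensorProduct.includeRight))
    (fun _ _ => Algebra.commutes _ _)

/-- The reduced norm on `R ⊗ B`: the determinant after splitting. It takes values in
`R ⊆ R ⊗ F̄` and does not depend on the splitting. -/
def reducedNorm {n : ℕ} (φ : Splitting n F B) (R : Type*) [CommRing R] [Algebra F R] :
    R ⊗[F] B →* R ⊗[F] AlgebraicClosure F :=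
  (Matrix.detMonoidHom : Matrix (Fin n) (Fin n) (R ⊗[F] AlgebraicClosure F) →* _).comp
    (splitHom φ R : R ⊗[F] B →* Matrix (Fin n) (Fin n) (R ⊗[F] AlgebraicClosure F))

/-- The units of `R ⊗ B` that represent points of the group: those of reduced norm one for `SL₁`,
all of them for `PGL₁`. -/
def Form.units (f : Form) (n : ℕ) (F B : Type*) [Field F] [Ring B] [Algebra F B]
    (R : Type*) [CommRing R] [Algebra F R] : Subgroup (R ⊗[F] B)ˣ :=
  match f with
  | .simplyConnected => ⨅ φ : Splitting n F B, (Units.map (reducedNorm φ R)).ker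
  | .adjoint => ⊤

/-- The scalars divided out: none for `SL₁`, those of `Rˣ` for `PGL₁`. -/
def Form.scalars (f : Form) (F B : Type*) [Field F] [Ring B] [Algebra F B]
    (R : Type*) [CommRing R] [Algebra F R] : Subgroup (R ⊗[F] B)ˣ :=
  match f with
  | .simplyConnected => ⊥
  | .adjoint => (Units.map (algebraMap R (R ⊗[F] B) : R →* R ⊗[F] B)).range

theorem Form.commute_scalars (f : Form) {R : Type*} [CommRing R] [Algebra F R]
    {z : (R ⊗[F] B)ˣ} (hz : z ∈ f.scalars F B R) (x : R ⊗[F] B) : (z : R ⊗[F] B) * x = x * z := by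
  cases f with
  | simplyConnected =>
    have h : z = 1 := hz
    simp [h]
  | adjoint =>
    obtain ⟨r, rfl⟩ := hz
    exact Algebra.commutes (r : R) x

instance (f : Form) (n : ℕ) (R : Type*) [CommRing R] [Algebra F R] :
    ((f.scalars F B R).subgroupOf (f.units n F B R)).Normal where
  conj_mem z hz g := by
    have h : g * z * g⁻¹ = z := by
      ext
      have := f.commute_scalars (Subgroup.mem_subgroupOf.1 hz)
        ((g⁻¹ : f.units n F B R) : (R ⊗[F] B)ˣ)
      simp only [Subgroup.coe_mul, Units.val_mul, mul_assoc, this]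
      simp [← mul_assoc]
    rwa [h]

/-- The group `G(R)` of `R`-points, for a field extension `R` of `F`, where `G` is `SL₁(B)` or
`PGL₁(B)`. -/
abbrev GPts (f : Form) (n : ℕ) (F B : Type*) [Field F] [Ring B] [Algebra F B]
    (R : Type*) [CommRing R] [Algebra F R] :=
  f.units n F B R ⧸ (f.scalars F B R).subgroupOf (f.units n F B R)

/-- The subgroup of `G(R)` of the classes of units of a submonoid `M` of `R ⊗ B`. For `M` a
subalgebra `C` it is `SL₁(C)` or `PGL₁(C)`, and similarly for an order. -/
def subPts (f : Form) (n : ℕ) {R : Type*} [CommRing R] [Algebra F R]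
    (M : Submonoid (R ⊗[F] B)) : Subgroup (GPts f n F B R) :=
  ((M.units).subgroupOf (f.units n F B R)).map (QuotientGroup.mk' _)

theorem splitHom_tmul {n : ℕ} (φ : Splitting n F B) {R : Type*} [CommRing R] [Algebra F R]
    (r : R) (b : B) (i j : Fin n) :
    splitHom φ R (r ⊗ₜ b) i j = r ⊗ₜ φ (1 ⊗ₜ b) i j := by
  have h : splitHom φ R (r ⊗ₜ b) =
      r • (φ (1 ⊗ₜ b)).map (fun x => (1 : R) ⊗ₜ[F] x) :=
    (Algebra.TensorProduct.lift_tmul ..).trans (Algebra.smul_def ..).symm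
  simp [h, TensorProduct.smul_tmul']

theorem splitHom_map {n : ℕ} (φ : Splitting n F B) {R R' : Type*} [CommRing R] [Algebra F R]
    [CommRing R'] [Algebra F R'] (h : R →ₐ[F] R') (x : R ⊗[F] B) :
    splitHom φ R' (Algebra.TensorProduct.map h (AlgHom.id F B) x) =
      (Algebra.TensorProduct.map h (AlgHom.id F (AlgebraicClosure F))).mapMatrix
        (splitHom φ R x) := by
  induction x with
  | zero => simp
  | add x y hx hy => simp only [map_add, hx, hy]
  | tmul r b =>
    ext i j
    simp [splitHom_tmul]

theorem Form.map_units_mem (f : Form) (n : ℕ) {R R' : Type*} [CommRing R] [Algebra F R]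
    [CommRing R'] [Algebra F R'] (h : R →ₐ[F] R') {x : (R ⊗[F] B)ˣ} (hx : x ∈ f.units n F B R) :
    Units.map (Algebra.TensorProduct.map h (AlgHom.id F B) : R ⊗[F] B →* R' ⊗[F] B) x ∈
      f.units n F B R' := by
  cases f with
  | adjoint => exact Subgroup.mem_top _
  | simplyConnected =>
    simp only [Form.units, Subgroup.mem_iInf, MonoidHom.mem_ker, Units.ext_iff] at hx ⊢
    intro φ
    have := congrArg (Algebra.TensorProduct.map h (AlgHom.id F (AlgebraicClosure F))) (hx φ)
    simpa [reducedNorm, splitHom_map, AlgHom.map_det] using this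

theorem Form.map_scalars_mem (f : Form) {R R' : Type*} [CommRing R] [Algebra F R]
    [CommRing R'] [Algebra F R'] (h : R →ₐ[F] R') {x : (R ⊗[F] B)ˣ} (hx : x ∈ f.scalars F B R) :
    Units.map (Algebra.TensorProduct.map h (AlgHom.id F B) : R ⊗[F] B →* R' ⊗[F] B) x ∈
      f.scalars F B R' := by
  cases f with
  | simplyConnected =>
    have hx : x = 1 := hx
    subst hx
    exact Subgroup.mem_bot.2 (map_one _)
  | adjoint =>
    obtain ⟨r, rfl⟩ := hx
    refine ⟨Units.map (h : R →* R') r, ?_⟩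
    ext
    simp [Algebra.TensorProduct.algebraMap_apply]

/-- The map `G(R) → G(R')` induced by `R → R'`. -/
def GPts.map (f : Form) (n : ℕ) {R R' : Type*} [CommRing R] [Algebra F R]
    [CommRing R'] [Algebra F R'] (h : R →ₐ[F] R') : GPts f n F B R →* GPts f n F B R' :=
  QuotientGroup.map _ _
    (((Units.map (Algebra.TensorProduct.map h (AlgHom.id F B) : R ⊗[F] B →* R' ⊗[F] B)).comp
      (f.units n F B R).subtype).codRestrict (f.units n F B R')
        (fun x => f.map_units_mem n h x.2))
    (fun _ hx => Subgroup.mem_subgroupOf.2 (f.map_scalars_mem h (Subgroup.mem_subgroupOf.1 hx)))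

/-- Conjugation by a unit of an algebra. -/
def unitConj (R A : Type*) [CommRing R] [Ring A] [Algebra R A] : Aˣ →* (A ≃ₐ[R] A) where
  toFun x := AlgEquiv.ofAlgHom
    { toFun := fun y => x * y * (x⁻¹ : Aˣ)
      map_one' := by simp
      map_mul' := fun y z => by simp [mul_assoc]
      map_zero' := by simp
      map_add' := fun y z => by simp [mul_add, add_mul]
      commutes' := fun r => by simp [← Algebra.commutes] }
    { toFun := fun y => (x⁻¹ : Aˣ) * y * x
      map_one' := by simp
      map_mul' := fun y z => by simp [mul_assoc]
      map_zero' := by simp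
      map_add' := fun y z => by simp [mul_add, add_mul]
      commutes' := fun r => by simp [← Algebra.commutes] }
    (by ext; simp [mul_assoc]) (by ext; simp [mul_assoc])
  map_one' := by ext; simp
  map_mul' x y := by ext; simp [mul_assoc]

/-- The adjoint action of `G(R)` on `R ⊗ B`, induced by conjugation. -/
def GPts.Ad {f : Form} {n : ℕ} {R : Type*} [CommRing R] [Algebra F R] :
    GPts f n F B R →* ((R ⊗[F] B) ≃ₐ[R] (R ⊗[F] B)) :=
  QuotientGroup.lift _ ((unitConj R (R ⊗[F] B)).comp (f.units n F B R).subtype) (fun z hz => by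
    ext y
    have := f.commute_scalars (Subgroup.mem_subgroupOf.1 hz) y
    simp [unitConj, this])

/-- Pre-compact subsets of `G(K)`, for the topology induced by that of the field `K`: `K ⊗ B` has
its topology as a finite-dimensional `K`-vector space, its unit group the topology of a group of
units, and `G(K)` the resulting subquotient topology. -/
def IsPrecompact {f : Form} {n : ℕ} {K : Type*} [NormedField K] [Algebra F K]
    (X : Set (GPts f n F B K)) : Prop :=
  letI : TopologicalSpace (K ⊗[F] B) := moduleTopology K (K ⊗[F] B)
  IsCompact (closure X)

end Groups

/-! ### Maximal tori, orders and discriminants -/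

/-- `C` is a commutative étale `K`-algebra of degree `n` (over a field of characteristic zero a
finite-dimensional commutative algebra is étale if and only if it is reduced). In a central simple
algebra of degree `n` these `C` correspond to the maximal tori `SL₁(C)` of `SL₁` and `PGL₁(C)` of
`PGL₁`. -/
structure IsTorusAlgebra (n : ℕ) {K A : Type*} [Field K] [Ring A] [Algebra K A]
    (C : Subalgebra K A) : Prop where
  comm : ∀ x ∈ C, ∀ y ∈ C, x * y = y * x
  reduced : IsReduced C
  degree : Module.finrank K C = n

/-- `R` is an `O`-order in the `K`-algebra `C`. -/
structure IsOrderIn {O K A : Type*} [CommRing O] [Field K] [Ring A] [Algebra O K] [Algebra K A]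
    [Algebra O A] [IsScalarTower O K A] (C : Subalgebra K A) (R : Subalgebra O A) : Prop where
  le : R ≤ C.restrictScalars O
  fg : (Subalgebra.toSubmodule R).FG
  span : Submodule.span K (R : Set A) = Subalgebra.toSubmodule C

/-- The reduced trace of a central simple algebra `A` of degree `n` over a field `K` of
characteristic zero, characterized by `Tr_{A/K} = n • Trd`. -/
def reducedTrace (n : ℕ) (K : Type*) {A : Type*} [Field K] [Ring A] [Algebra K A] (x : A) : K :=
  (n : K)⁻¹ * LinearMap.trace K A (LinearMap.mulLeft K x)

/-- The matrix `(Trd (f i * f j))`. -/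
def traceMatrix {n : ℕ} (K : Type*) {A : Type*} [Field K] [Ring A] [Algebra K A]
    (f : Fin n → A) : Matrix (Fin n) (Fin n) K :=
  Matrix.of fun i j => reducedTrace n K (f i * f j)

section Arithmetic

variable {F : Type*} [Field F] [NumberField F] {B : Type*} [Ring B] [Algebra F B]

/-- The completion `Ω_v` of the order `Ω`: the closure of `Ω` in `B_v`, that is, the subalgebra
over the integers of `F_v` which `Ω` generates (spans). -/
def localOrder (Ω : Subalgebra (𝓞 F) B) (v : HeightOneSpectrum (𝓞 F)) :
    Subalgebra (localIntegers v) ((Place.finite v).Completion ⊗[F] B) :=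
  Algebra.adjoin (localIntegers v) ((fun b : B => (1 : (Place.finite v).Completion) ⊗ₜ[F] b) '' Ω)

/-- The compact open subgroup `K_v`, equal to `SL₁(Ω_v)` or `PGL₁(Ω_v)`. -/
def compactOpen (f : Form) (n : ℕ) (Ω : Subalgebra (𝓞 F) B) (v : HeightOneSpectrum (𝓞 F)) :
    Subgroup (GPts f n F B (Place.finite v).Completion) :=
  subPts f n (localOrder Ω v).toSubmonoid

/-- The group `G(𝔸)` of adelic points: the restricted product of the groups `G(F_u)` with respect
to the subgroups `K_v`. -/
def adelicPts (f : Form) (n : ℕ) (Ω : Subalgebra (𝓞 F) B) :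
    Subgroup (∀ u : Place F, GPts f n F B u.Completion) where
  carrier := {g | ∀ᶠ v in Filter.cofinite, g (.finite v) ∈ compactOpen f n Ω v}
  one_mem' := by
    rw [Set.mem_ofPred_eq]
    exact Filter.Eventually.of_forall fun _ => one_mem _
  mul_mem' hx hy := by
    rw [Set.mem_ofPred_eq] at *
    filter_upwards [hx, hy] with v h1 h2 using mul_mem h1 h2
  inv_mem' hx := by
    rw [Set.mem_ofPred_eq] at *
    filter_upwards [hx] with v h1 using inv_mem h1

/-- The group `T(𝔸)`, where `T` is `SL₁(E)` or `PGL₁(E)`. -/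
def torusAdelicPts (f : Form) (n : ℕ) (Ω : Subalgebra (𝓞 F) B) (E : Subalgebra F B) :
    Subgroup (∀ u : Place F, GPts f n F B u.Completion) :=
  adelicPts f n Ω ⊓ Subgroup.pi Set.univ
    fun u => subPts f n (E.baseChange u.Completion).toSubmonoid

/-- The diagonal embedding of `G(F)`. -/
def diagonal (f : Form) (n : ℕ) :
    GPts f n F B F →* ∀ u : Place F, GPts f n F B u.Completion :=
  MonoidHom.pi fun u => GPts.map f n (Algebra.ofId F u.Completion)

/-- The subalgebra `C_u = g_u⁻¹ E_u g_u` of `B_u`. The local torus `H_u = g_u⁻¹ T g_u` is `SL₁(C_u)`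
or `PGL₁(C_u)`. -/
def localAlgebra {f : Form} {n : ℕ} (E : Subalgebra F B)
    (g : ∀ u : Place F, GPts f n F B u.Completion) (u : Place F) :
    Subalgebra u.Completion (u.Completion ⊗[F] B) :=
  (E.baseChange u.Completion).map (GPts.Ad (g u)⁻¹ : _ ≃ₐ[u.Completion] _).toAlgHom

/-- The local order `R_v = C_v ∩ Ω_v`. -/
def toralOrder {f : Form} {n : ℕ} (Ω : Subalgebra (𝓞 F) B) (E : Subalgebra F B)
    (g : ∀ u : Place F, GPts f n F B u.Completion) (v : HeightOneSpectrum (𝓞 F)) :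
    Subalgebra (localIntegers v) ((Place.finite v).Completion ⊗[F] B) :=
  (localAlgebra E g (.finite v)).restrictScalars (localIntegers v) ⊓ localOrder Ω v

/-- The homogeneous toral set of `E` and `g` is of maximal type: at every finite place `R_v` is a
maximal order in `C_v`. -/
def IsMaximalType {f : Form} {n : ℕ} (Ω : Subalgebra (𝓞 F) B) (E : Subalgebra F B)
    (g : ∀ u : Place F, GPts f n F B u.Completion) : Prop :=
  ∀ v : HeightOneSpectrum (𝓞 F),
    Maximal (IsOrderIn (localAlgebra E g (.finite v))) (toralOrder Ω E g v)

open Classical in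
/-- The local discriminant at a finite place: `|det (Trd (f_i f_j))|⁻¹` for a basis `f` of `R_v` over
the integers of `F_v`. -/
def finiteDisc {f : Form} {n : ℕ} (Ω : Subalgebra (𝓞 F) B) (E : Subalgebra F B)
    (g : ∀ u : Place F, GPts f n F B u.Completion) (v : HeightOneSpectrum (𝓞 F)) : ℝ :=
  if h : Nonempty (Module.Basis (Fin n) (localIntegers v) (toralOrder Ω E g v)) then
    ((Place.finite v).nabs
      (traceMatrix (Place.finite v).Completion
        fun i => (h.some i : (Place.finite v).Completion ⊗[F] B)).det)⁻¹
  else 1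

/-- The Hermitian inner products on the complexified algebras `B_w(ℂ)` that enter the archimedean
discriminants. -/
abbrev HermitianData (F B : Type*) [Field F] [Ring B] [Algebra F B] :=
  ∀ w : InfinitePlace F, InnerProductSpace.Core ℂ (ComplexAt w ⊗[F] B)

/-- The Gram matrix, in `B_w(ℂ)`, of a family in `B_w`. -/
def gramMatrix {n : ℕ} (Q : HermitianData F B) (w : InfinitePlace F)
    (f : Fin n → (Place.infinite w).Completion ⊗[F] B) : Matrix (Fin n) (Fin n) ℂ :=
  Matrix.of fun i j =>
    (Q w).inner (Algebra.TensorProduct.map (completionToComplex w) (AlgHom.id F B) (f i))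
      (Algebra.TensorProduct.map (completionToComplex w) (AlgHom.id F B) (f j))

open Classical in
/-- The local discriminant at an infinite place: `det (Q (f_i, f_j)) / |det (Trd (f_i f_j))|` for a
basis `f` of `C_w` over `F_w`. A complex place counts twice, that is, the quantity is squared. -/
def infiniteDisc {f : Form} {n : ℕ} (Q : HermitianData F B) (E : Subalgebra F B)
    (g : ∀ u : Place F, GPts f n F B u.Completion) (w : InfinitePlace F) : ℝ :=
  if h : Nonempty (Module.Basis (Fin n) (Place.infinite w).Completion
      (localAlgebra E g (.infinite w))) then
    ‖(gramMatrix Q w fun i => (h.some i : (Place.infinite w).Completion ⊗[F] B)).det‖ ^ w.mult *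
      ((Place.infinite w).nabs
        (traceMatrix (Place.infinite w).Completion
          fun i => (h.some i : (Place.infinite w).Completion ⊗[F] B)).det)⁻¹
  else 1

/-- The global discriminant `D`. -/
def globalDisc {f : Form} {n : ℕ} (Ω : Subalgebra (𝓞 F) B) (Q : HermitianData F B)
    (E : Subalgebra F B) (g : ∀ u : Place F, GPts f n F B u.Completion) : ℝ :=
  (∏ w : InfinitePlace F, infiniteDisc Q E g w) *
    ∏ᶠ v : HeightOneSpectrum (𝓞 F), finiteDisc Ω E g v

/-- `B`, of degree `n`, is ramified at the finite place `v`: it is not split there. -/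
def IsRamifiedAt (n : ℕ) (F B : Type*) [Field F] [NumberField F] [Ring B] [Algebra F B]
    (v : HeightOneSpectrum (𝓞 F)) : Prop :=
  IsEmpty (((Place.finite v).Completion ⊗[F] B) ≃ₐ[(Place.finite v).Completion]
    Matrix (Fin n) (Fin n) (Place.finite v).Completion)

/-- The ramified discriminant: the product of the local discriminants over the finite places at
which `B` is ramified. -/
def ramifiedDisc {f : Form} {n : ℕ} (Ω : Subalgebra (𝓞 F) B) (E : Subalgebra F B)
    (g : ∀ u : Place F, GPts f n F B u.Completion) : ℝ :=
  ∏ᶠ (v : HeightOneSpectrum (𝓞 F)) (_ : IsRamifiedAt n F B v), finiteDisc Ω E g v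

/-! ### The Galois condition -/

/-- The splitting field of `E`, equivalently of the torus, inside the algebraic closure of `F`. -/
def splittingField (E : Subalgebra F B) : IntermediateField F (AlgebraicClosure F) :=
  IntermediateField.adjoin F (⋃ φ : E →ₐ[F] AlgebraicClosure F, Set.range φ)

/-- `Gal(L/F)`, with `L` the splitting field of `E`, is 2-transitive on the `n` homomorphisms
`E → L`, equivalently on the primitive idempotents of `E ⊗ L`. -/
def HasTwoTransitiveGalois (E : Subalgebra F B) : Prop :=
  ∀ φ₁ φ₂ ψ₁ ψ₂ : E →ₐ[F] splittingField E, φ₁ ≠ φ₂ → ψ₁ ≠ ψ₂ →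
    ∃ s : splittingField E ≃ₐ[F] splittingField E,
      s.toAlgHom.comp φ₁ = ψ₁ ∧ s.toAlgHom.comp φ₂ = ψ₂

/-! ### Entropy and Bowen balls -/

/-- The entropy `h_Haar(a) = ½ ∑_α |log |α(a)|_u|`. The `α(a)`, for `α` a root of the torus that
contains `a`, are the eigenvalues in the algebraic closure of the adjoint action of `a`, counted with
multiplicity (and up to eigenvalues equal to `1`, which contribute nothing). -/
def entropyHaar [FiniteDimensional F B] {f : Form} {n : ℕ} (u : Place F) (a : GPts f n F B u.Completion) : ℝ :=
  1 / 2 * (((GPts.Ad a : _ ≃ₐ[u.Completion] _).toLinearMap.charpoly.aroots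
    (AlgebraicClosure u.Completion)).map fun x => |Real.log (u.closureAbs x)|).sum

/-- The Bowen ball `X^(s,t) = a⁻ˢ X aˢ ∩ a⁻ᵗ X aᵗ`. -/
def bowenBall {G : Type*} [Group G] (a : G) (X : Set G) (s t : ℤ) : Set G :=
  ((fun x => a ^ (-s) * x * a ^ s) '' X) ∩ ((fun x => a ^ (-t) * x * a ^ t) '' X)

open Classical in
/-- The set `X^(-τ,τ) × K_S` for a box `X = ∏_{u ∈ S} X_u` (only the `X_u` with `u ∈ S` are used) and
`a ∈ G(F_{u₀})`, viewed as the element of `G_S` which is trivial at the places other than `u₀`. -/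
def bowenTube {f : Form} {n : ℕ} (Ω : Subalgebra (𝓞 F) B) (S : Finset (Place F)) (u₀ : Place F)
    (a : GPts f n F B u₀.Completion) (X : ∀ u : Place F, Set (GPts f n F B u.Completion)) (τ : ℤ) :
    Set (∀ u : Place F, GPts f n F B u.Completion) :=
  {b | (∀ u ∈ S, b u ∈ bowenBall (Pi.mulSingle
      (M := fun u : Place F => GPts f n F B u.Completion) u₀ a u) (X u) (-τ) τ) ∧
    ∀ v, Place.finite v ∉ S → b (.finite v) ∈ compactOpen f n Ω v}

end Arithmetic

end

end Toral

open Toral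

/-! Diagonalize `E` over the algebraic closure and write a point `x` of `G(F)` in the eigenbasis.
The products `ψ_ij = x_ji (x⁻¹)_ij` (`TorusDiag.pairing`) do not change when `x` is multiplied by
the torus on either side or by a scalar, and the Galois group permutes them as it permutes the pairs
`(i, j)`. So the product `N` of the `ψ_ij` over `i ≠ j` lies in `F`. If one off-diagonal coordinate
of `x` vanishes, 2-transitivity makes all of them vanish, and `x` is in the torus. Hence a point
outside the torus has `N ≠ 0` (`TorusDiag.exists_invariant`), and the product formula applies to
`N`.

At a place `u`, invariance under the torus lets `N` be computed from a point `b` of the Bowen ball,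
in the eigenbasis of `C_u`. Let `s_i` be the norm of the `i`-th idempotent of `C_u`
(`TorusDiag.size`). For bounded `b` one has `|ψ_ij| ≪ s_i s_j`. In the Bowen ball, `b` is up to a
scalar both `a^τ x a^(-τ)` and `a^(-τ) y a^τ` with bounded `x` and `y`; using one expression for `b`
and the other for `b⁻¹` gains the factor `exp(-2τ |log |α(a)||)` for the root `α` of the pair
(`norm_pairing_le`). Multiplied over ordered pairs this gives `|N|_u ≪ (∏ s_i)^(2(n-1)) exp(-4τ
h(a))`, where the exponential is present only at the place of `a`.

The discriminant controls the idempotents: `∏ s_i ≪ D_u`. If `P` is the matrix of eigenvalues of a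
basis of `C_u`, the trace form has determinant `(det P)²`, and for a bounded basis `|det P|² ∏ s_i`
is bounded by linear algebra (`norm_det_sq_mul_prod_le`). The bounded basis is an integral one at a
finite place and an orthonormal one at an infinite place (`finiteDisc_bounds`, `exists_gram_bound`).
All constants are `1` at almost all places, since the ultrametric inequality costs nothing.

Multiplying over the places gives `1 ≤ A D^(2(n-1)) exp(-4τ h(a))`; the logarithm divided by
`2(n-1)` contradicts the assumption on `τ`. The ramified discriminant enters only through a lower
bound independent of the torus (`finprod_inv_le_ramifiedDisc`). -/

noncomputable section

namespace Toral

/-! ### Matrices over normed fields -/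

section NormedMatrix

open Classical in
/-- A bound for the norm of a sum of `m` terms of norm at most `1`: the number of terms in
general, `1` over a nonarchimedean field. -/
def sumBound (K : Type*) [NormedField K] (m : ℕ) : ℝ :=
  -- The maximum matters only for `m = 0`; it keeps every constant built from this one at least `1`.
  if IsNonarchimedean (norm : K → ℝ) then 1 else max 1 m

variable {K : Type*} [NormedField K]

theorem one_le_sumBound (m : ℕ) : 1 ≤ sumBound K m := by
  unfold sumBound
  split_ifs <;> simp

theorem sumBound_nonneg (m : ℕ) : 0 ≤ sumBound K m := zero_le_one.trans (one_le_sumBound m)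

theorem sumBound_eq_one (h : IsNonarchimedean (norm : K → ℝ)) (m : ℕ) : sumBound K m = 1 :=
  if_pos h

theorem norm_sum_le_sumBound {ι : Type*} (s : Finset ι) (x : ι → K) {r : ℝ} (hr : 0 ≤ r)
    (h : ∀ i ∈ s, ‖x i‖ ≤ r) : ‖∑ i ∈ s, x i‖ ≤ sumBound K s.card * r := by
  unfold sumBound
  split_ifs with hK
  · rw [one_mul]
    have : IsUltrametricDist K := IsUltrametricDist.isUltrametricDist_of_isNonarchimedean_norm hK
    exact IsUltrametricDist.norm_sum_le_of_forall_le_of_nonneg hr h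
  · refine (norm_sum_le_of_le s h).trans ?_
    rw [Finset.sum_const, nsmul_eq_mul]
    gcongr
    exact le_max_right _ _

variable {n : ℕ}

theorem norm_mul_apply_le {A B : Matrix (Fin n) (Fin n) K} {i j : Fin n} {r s : ℝ} (hr : 0 ≤ r)
    (hs : 0 ≤ s) (hA : ∀ k, ‖A i k‖ ≤ r) (hB : ∀ k, ‖B k j‖ ≤ s) :
    ‖(A * B) i j‖ ≤ sumBound K n * (r * s) := by
  rw [Matrix.mul_apply]
  refine (norm_sum_le_sumBound (r := r * s) _ _ (by positivity) fun k _ => ?_).trans_eq (by simp)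
  rw [norm_mul]
  exact mul_le_mul (hA k) (hB k) (norm_nonneg _) hr

theorem norm_det_le {A : Matrix (Fin n) (Fin n) K} {r : ℝ} (hr : 0 ≤ r)
    (hA : ∀ i j, ‖A i j‖ ≤ r) : ‖A.det‖ ≤ sumBound K n.factorial * r ^ n := by
  rw [Matrix.det_apply]
  refine (norm_sum_le_sumBound (r := r ^ n) _ _ (by positivity) fun σ _ => ?_).trans_eq
    (by simp [Fintype.card_perm])
  have h1 : ‖Equiv.Perm.sign σ • ∏ i, A (σ i) i‖ = ‖∏ i, A (σ i) i‖ := by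
    rcases Int.units_eq_one_or (Equiv.Perm.sign σ) with h | h <;> simp [h]
  rw [h1, norm_prod]
  refine (Finset.prod_le_prod (fun _ _ => norm_nonneg _) fun i _ => hA (σ i) i).trans_eq (by simp)

theorem exists_norm_apply_eq (hn : 0 < n) (x : Fin n → K) : ∃ i, ‖x i‖ = ‖x‖ := by
  have : Nonempty (Fin n) := ⟨⟨0, hn⟩⟩
  obtain ⟨i, hi⟩ := Finite.exists_max fun i => ‖x i‖
  exact ⟨i, le_antisymm (norm_le_pi_norm x i) ((pi_norm_le_iff_of_nonneg (norm_nonneg _)).2 hi)⟩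

/-- The bound for the entries of the matrices that bring a matrix of size `n` into triangular form. -/
def triBound (K : Type*) [NormedField K] : ℕ → ℝ
  | 0 => 1
  | n + 1 => sumBound K 2 * (sumBound K n * triBound K n)

theorem one_le_triBound : ∀ n : ℕ, 1 ≤ triBound K n
  | 0 => le_rfl
  | n + 1 => one_le_mul_of_one_le_of_one_le (one_le_sumBound _)
      (one_le_mul_of_one_le_of_one_le (one_le_sumBound _) (one_le_triBound n))

theorem triBound_eq_one (h : IsNonarchimedean (norm : K → ℝ)) : ∀ n : ℕ, triBound K n = 1
  | 0 => rfl
  | n + 1 => by simp [triBound, sumBound_eq_one h, triBound_eq_one h n]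

/-- Gaussian elimination with pivoting: a matrix becomes upper triangular after multiplication by a
matrix with bounded entries. -/
theorem exists_triangularize : ∀ (n : ℕ) (V : Matrix (Fin n) (Fin n) K),
    ∃ U : Matrix (Fin n) (Fin n) K, ‖U.det‖ = 1 ∧ (∀ i j, ‖U i j‖ ≤ triBound K n) ∧
      ∀ i j, j < i → (U * V) i j = 0
  | 0, V => ⟨1, by simp, fun i => i.elim0, fun i => i.elim0⟩
  | n + 1, V => by
    -- The pivot is the largest entry of the first column, so that all multipliers `m i` have norm
    -- at most `1`.
    obtain ⟨p, hp⟩ := exists_norm_apply_eq n.succ_pos fun i => V i 0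
    set V₁ : Matrix (Fin (n + 1)) (Fin (n + 1)) K := V.submatrix (Equiv.swap 0 p) id with hV₁
    set m : Fin n → K := fun i => V₁ i.succ 0 / V₁ 0 0 with hm
    have hp0 : ∀ i, ‖V₁ i 0‖ ≤ ‖V₁ 0 0‖ := fun i => by
      simp only [hV₁, Matrix.submatrix_apply, id, Equiv.swap_apply_left, hp]
      exact norm_le_pi_norm (fun i => V i 0) _
    have hm1 : ∀ i, ‖m i‖ ≤ 1 := fun i => by
      rw [hm, norm_div]
      exact div_le_one_of_le₀ (hp0 _) (norm_nonneg _)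
    have hm2 : ∀ i : Fin n, V₁ i.succ 0 = m i * V₁ 0 0 := fun i => by
      -- If the pivot is zero, so is the whole first column, and the multipliers are zero by the
      -- convention for division.
      by_cases h : V₁ 0 0 = 0
      · have := hp0 i.succ
        rw [h, norm_zero, norm_le_zero_iff] at this
        rw [h, this, mul_zero]
      · rw [hm, div_mul_cancel₀ _ h]
    obtain ⟨U', hU'1, hU'2, hU'3⟩ := exists_triangularize n
      (Matrix.of fun i j : Fin n => V₁ i.succ j.succ - m i * V₁ 0 j.succ)
    -- The first column of `U₁` performs the elimination: the lower rows of `U₁ * V₁` are those of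
    -- `U'` times the eliminated matrix, with zeros in the first column.
    set U₁ : Matrix (Fin (n + 1)) (Fin (n + 1)) K := Matrix.of fun i j =>
      Fin.cases (Fin.cases 1 (fun _ => 0) j)
        (fun i' => Fin.cases (-∑ k, U' i' k * m k) (fun j' => U' i' j') j) i with hU₁
    have hU0 : ∀ j : Fin n, U₁ 0 j.succ = 0 := fun j => rfl
    have hU00 : U₁ 0 0 = 1 := rfl
    have hUs : ∀ i j : Fin n, U₁ i.succ j.succ = U' i j := fun i j => rfl
    have hUs0 : ∀ i : Fin n, U₁ i.succ 0 = -∑ k, U' i k * m k := fun i => rfl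
    have hdet : U₁.det = U'.det := by
      rw [Matrix.det_succ_row_zero, Fin.sum_univ_succ]
      simp only [hU0, hU00]
      simp
      rfl
    have hC : ∀ i j, ‖U₁ i j‖ ≤ triBound K (n + 1) := by
      have h1 : triBound K n ≤ sumBound K n * triBound K n :=
        le_mul_of_one_le_left (zero_le_one.trans (one_le_triBound n)) (one_le_sumBound n)
      have h2 : sumBound K n * triBound K n ≤ triBound K (n + 1) :=
        le_mul_of_one_le_left (by linarith [one_le_triBound (K := K) n]) (one_le_sumBound 2)
      intro i j
      refine Fin.cases ?_ (fun i => ?_) i <;> refine Fin.cases ?_ (fun j => ?_) j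
      · simp [hU00, one_le_triBound]
      · simp [hU0, zero_le_one.trans (one_le_triBound (K := K) (n + 1))]
      · rw [hUs0, norm_neg]
        refine le_trans ?_ h2
        refine (norm_sum_le_sumBound (r := triBound K n) _ _
          (zero_le_one.trans (one_le_triBound n)) fun k _ => ?_).trans_eq (by simp)
        rw [norm_mul]
        exact (mul_le_of_le_one_right (norm_nonneg _) (hm1 k)).trans (hU'2 i k)
      · rw [hUs]
        exact (hU'2 i j).trans (h1.trans h2)
    have hkey : ∀ i j, (U₁ * V₁) (Fin.succ i) j = ∑ k, U' i k * (V₁ k.succ j - m k * V₁ 0 j) := by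
      intro i j
      rw [Matrix.mul_apply, Fin.sum_univ_succ, hUs0]
      simp only [hUs, mul_sub, Finset.sum_sub_distrib, neg_mul, Finset.sum_mul, mul_assoc]
      ring
    have hV : U₁.submatrix id (Equiv.swap 0 p) * V = U₁ * V₁ := by
      ext i j
      rw [Matrix.mul_apply, Matrix.mul_apply]
      refine Fintype.sum_equiv (Equiv.swap 0 p) _ _ fun k => ?_
      simp [hV₁]
    refine ⟨U₁.submatrix id (Equiv.swap 0 p), ?_, fun i j => hC _ _, fun i j hij => ?_⟩
    · rw [Matrix.det_permute', norm_mul, hdet, hU'1, mul_one]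
      rcases Int.units_eq_one_or (Equiv.Perm.sign (Equiv.swap 0 p)) with h | h <;> simp [h]
    · rw [hV]
      revert hij
      refine Fin.cases (fun h => absurd h (by simp)) (fun i => ?_) i
      refine Fin.cases (fun _ => ?_) (fun j hij => ?_) j
      · rw [hkey]
        exact Finset.sum_eq_zero fun k _ => by rw [hm2, sub_self, mul_zero]
      · have := hU'3 i j (by simpa using hij)
        rw [Matrix.mul_apply] at this
        rw [hkey]
        exact this

/-- The constant in `norm_det_mul_prod_le`. -/
def volBound (K : Type*) [NormedField K] (n : ℕ) : ℝ :=
  sumBound K n.factorial * (sumBound K n * triBound K n) ^ n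

theorem volBound_eq_one (h : IsNonarchimedean (norm : K → ℝ)) (n : ℕ) : volBound K n = 1 := by
  simp [volBound, sumBound_eq_one h, triBound_eq_one h]

/-- The point is to realize a product of row norms as a determinant. With `U * V` upper triangular
and `W i (q i)` a largest entry of the row `W i`, the matrix `Z` is lower triangular and its
determinant has exactly the norm `‖V.det‖ * ∏ i, ‖W i‖`. The entries of `P * Z` are combinations,
with coefficients from `U`, of entries of the bounded matrices `V diag(P k) W`, so `det (P * Z)` is
bounded. -/
theorem norm_det_mul_norm_det_mul_prod_le (V W P : Matrix (Fin n) (Fin n) K) {c : ℝ} (hc : 0 ≤ c)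
    (h : ∀ k p q, ‖∑ i, P k i * (V p i * W i q)‖ ≤ c) :
    ‖P.det‖ * (‖V.det‖ * ∏ i, ‖W i‖) ≤ volBound K n * c ^ n := by
  obtain ⟨U, hU1, hU2, hU3⟩ := exists_triangularize n V
  choose q hq using fun i : Fin n => exists_norm_apply_eq (Fin.pos i) (W i)
  set Z : Matrix (Fin n) (Fin n) K := Matrix.of fun i j => (U * V) j i * W i (q j) with hZ
  have hZdet : ‖Z.det‖ = ‖V.det‖ * ∏ i, ‖W i‖ := by
    have htri : Z.BlockTriangular OrderDual.toDual := fun i j hij => by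
      simp only [hZ, Matrix.of_apply]
      rw [hU3 j i (by simpa using hij), zero_mul]
    have htri' : (U * V).BlockTriangular id := fun i j hij => hU3 i j hij
    have hUV : ‖(U * V).det‖ = ‖V.det‖ := by rw [Matrix.det_mul, norm_mul, hU1, one_mul]
    rw [Matrix.det_of_isLowerTriangular _ htri, ← hUV, Matrix.det_of_isUpperTriangular htri',
      norm_prod, norm_prod, ← Finset.prod_mul_distrib]
    exact Finset.prod_congr rfl fun i _ => by simp [hZ, hq]
  rw [← hZdet, ← norm_mul, ← Matrix.det_mul]
  refine (norm_det_le (r := sumBound K n * triBound K n * c) (mul_nonneg (mul_nonneg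
    (sumBound_nonneg n) (zero_le_one.trans (one_le_triBound n))) hc) fun k j => ?_).trans_eq ?_
  · have : (P * Z) k j = ∑ p, U j p * ∑ i, P k i * (V p i * W i (q j)) := by
      simp only [Matrix.mul_apply, hZ, Matrix.of_apply, Finset.mul_sum, Finset.sum_mul]
      rw [Finset.sum_comm]
      exact Finset.sum_congr rfl fun i _ => Finset.sum_congr rfl fun p _ => by ring
    rw [this]
    refine (norm_sum_le_sumBound (r := triBound K n * c) _ _
      (mul_nonneg (zero_le_one.trans (one_le_triBound n)) hc) fun p _ => ?_).trans_eq
        (by simp [mul_assoc])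
    rw [norm_mul]
    exact mul_le_mul (hU2 j p) (h k p _) (norm_nonneg _) (zero_le_one.trans (one_le_triBound n))
  · rw [volBound, mul_pow, mul_assoc]

/-- If `Pₖ ↦ V diag(Pₖ) V⁻¹` are bounded matrices, then the sizes of the idempotents of the torus
algebra of `V` are controlled by the determinant of `P`. -/
theorem norm_det_sq_mul_prod_le {V W : Matrix (Fin n) (Fin n) K} (hVW : V * W = 1)
    (P : Matrix (Fin n) (Fin n) K) {c : ℝ} (hc : 0 ≤ c)
    (h : ∀ k p q, ‖(V * Matrix.diagonal (P k) * W) p q‖ ≤ c) :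
    ‖P.det‖ ^ 2 * ∏ i, (‖fun p => V p i‖ * ‖W i‖) ≤ (volBound K n * c ^ n) ^ 2 := by
  have hent : ∀ k p q, (V * Matrix.diagonal (P k) * W) p q = ∑ i, P k i * (V p i * W i q) := by
    intro k p q
    rw [Matrix.mul_apply]
    exact Finset.sum_congr rfl fun i _ => by rw [Matrix.mul_diagonal]; ring
  have h1 := norm_det_mul_norm_det_mul_prod_le V W P hc fun k p q => hent k p q ▸ h k p q
  -- Transposition exchanges `V` and `W`. In the product of the two bounds the determinants of `V`
  -- and `W` cancel.
  have h2 := norm_det_mul_norm_det_mul_prod_le W.transpose V.transpose P hc fun k p q => by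
    have := hent k q p ▸ h k q p
    simpa only [Matrix.transpose_apply, mul_comm (W _ _)] using this
  have h3 : ‖V.det‖ * ‖W.transpose.det‖ = 1 := by
    rw [Matrix.det_transpose, ← norm_mul, ← Matrix.det_mul, hVW, Matrix.det_one, norm_one]
  have h4 : ‖P.det‖ ^ 2 * ∏ i, (‖fun p => V p i‖ * ‖W i‖) =
      (‖P.det‖ * (‖V.det‖ * ∏ i, ‖W i‖)) *
        (‖P.det‖ * (‖W.transpose.det‖ * ∏ i, ‖V.transpose i‖)) := by
    rw [Finset.prod_mul_distrib]
    have : ∀ i, V.transpose i = fun p => V p i := fun i => rfl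
    simp only [this]
    linear_combination -(‖P.det‖ ^ 2 * (∏ i, ‖fun p => V p i‖) * ∏ i, ‖W i‖) * h3
  rw [h4, pow_two]
  exact mul_le_mul h1 h2 (by positivity) (h1.trans' (by positivity))

end NormedMatrix

/-! ### Split algebras -/

section Split

open Module

/-- A homomorphism to a matrix algebra over an extension `K` of `k` which becomes an isomorphism
after extension of scalars to `K`. -/
def IsSplit {k A K : Type*} [Field k] [Ring A] [Algebra k A] [Field K] [Algebra k K] {n : ℕ}
    (Φ : A →ₐ[k] Matrix (Fin n) (Fin n) K) : Prop :=
  ∃ (β : Basis (Fin (n ^ 2)) k A) (β' : Basis (Fin (n ^ 2)) K (Matrix (Fin n) (Fin n) K)),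
    ∀ i, Φ (β i) = β' i

/-- The matrix algebra is the sum of its `n` columns, and `M` acts on each of them in the same way.
This turns `reducedTrace` into the matrix trace after splitting. -/
theorem trace_mulLeft_matrix {K : Type*} [Field K] {n : ℕ} (M : Matrix (Fin n) (Fin n) K) :
    LinearMap.trace K (Matrix (Fin n) (Fin n) K) (LinearMap.mulLeft K M) = n * M.trace := by
  rw [LinearMap.trace_eq_matrix_trace K (Matrix.stdBasis K (Fin n) (Fin n)), Matrix.trace]
  have h : ∀ p : Fin n × Fin n, (LinearMap.toMatrix (Matrix.stdBasis K (Fin n) (Fin n))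
      (Matrix.stdBasis K (Fin n) (Fin n)) (LinearMap.mulLeft K M)).diag p = M p.1 p.1 := by
    rintro ⟨i, j⟩
    rw [Matrix.diag_apply, LinearMap.toMatrix_apply]
    change (M * Matrix.stdBasis K (Fin n) (Fin n) (i, j)) i j = M i i
    simp [Matrix.stdBasis_eq_single]
  simp only [h]
  rw [Fintype.sum_prod_type]
  simp [Matrix.trace, Finset.mul_sum]

/-- After the change of basis `Y ↦ V Y W` the map multiplies on both sides by diagonal matrices, and
the matrix units are eigenvectors. For `β = α⁻¹` it is the adjoint action. -/
theorem charpoly_conj_diagonal {K : Type*} [Field K] {n : ℕ} {V W : Matrix (Fin n) (Fin n) K}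
    (hVW : V * W = 1) (hWV : W * V = 1) (α β : Fin n → K)
    (T : Matrix (Fin n) (Fin n) K →ₗ[K] Matrix (Fin n) (Fin n) K)
    (hT : ∀ Y, T Y = (V * Matrix.diagonal α * W) * Y * (V * Matrix.diagonal β * W)) :
    T.charpoly = ∏ p : Fin n × Fin n, (Polynomial.X - Polynomial.C (α p.1 * β p.2)) := by
  let e : Matrix (Fin n) (Fin n) K ≃ₗ[K] Matrix (Fin n) (Fin n) K := LinearEquiv.ofLinearMap
    ((LinearMap.mulLeft K V).comp (LinearMap.mulRight K W))
    ((LinearMap.mulLeft K W).comp (LinearMap.mulRight K V))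
    (LinearMap.ext fun Y => by
      simp only [LinearMap.comp_apply, LinearMap.mulLeft_apply, LinearMap.mulRight_apply,
        LinearMap.id_apply]
      rw [show V * (W * (Y * V) * W) = (V * W) * Y * (V * W) by simp only [mul_assoc], hVW]
      simp)
    (LinearMap.ext fun Y => by
      simp only [LinearMap.comp_apply, LinearMap.mulLeft_apply, LinearMap.mulRight_apply,
        LinearMap.id_apply]
      rw [show W * (V * (Y * W) * V) = (W * V) * Y * (W * V) by simp only [mul_assoc], hWV]
      simp)
  let T₀ : Matrix (Fin n) (Fin n) K →ₗ[K] Matrix (Fin n) (Fin n) K :=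
    (LinearMap.mulLeft K (Matrix.diagonal α)).comp (LinearMap.mulRight K (Matrix.diagonal β))
  have hT' : T = e.conj T₀ := by
    ext1 Y
    rw [hT, LinearEquiv.conj_apply_apply]
    change _ = V * ((Matrix.diagonal α * ((W * (Y * V)) * Matrix.diagonal β)) * W)
    simp only [mul_assoc]
  rw [hT', LinearEquiv.charpoly_conj,
    ← LinearMap.charpoly_toMatrix T₀ (Matrix.stdBasis K (Fin n) (Fin n)),
    ← Matrix.charpoly_diagonal]
  congr 1
  ext ⟨i, j⟩ ⟨i', j'⟩
  rw [LinearMap.toMatrix_apply]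
  change ((Matrix.stdBasis K (Fin n) (Fin n)).repr (Matrix.diagonal α *
    (Matrix.stdBasis K (Fin n) (Fin n) (i', j') * Matrix.diagonal β))) (i, j) = _
  change (Matrix.diagonal α *
    (Matrix.stdBasis K (Fin n) (Fin n) (i', j') * Matrix.diagonal β)) i j = _
  rw [Matrix.diagonal_mul, Matrix.mul_diagonal, Matrix.stdBasis_eq_single, Matrix.diagonal_apply,
    Matrix.single_apply]
  by_cases h : i' = i ∧ j' = j
  · obtain ⟨rfl, rfl⟩ := h
    simp
  · rw [if_neg h, if_neg fun h' => h ⟨(Prod.ext_iff.1 h').1.symm, (Prod.ext_iff.1 h').2.symm⟩]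
    simp

namespace IsSplit

variable {k A K : Type*} [Field k] [Ring A] [Algebra k A] [Field K] [Algebra k K] {n : ℕ}
  {Φ : A →ₐ[k] Matrix (Fin n) (Fin n) K}

/-- `Φ` carries a `k`-basis to a `K`-basis, so linear forms extend by their values on it. The
descent arguments from `K` to `k` rest on this. -/
theorem exists_extend (h : IsSplit Φ) (r : A →ₗ[k] k) :
    ∃ R : Matrix (Fin n) (Fin n) K →ₗ[K] K, ∀ x, R (Φ x) = algebraMap k K (r x) := by
  obtain ⟨β, β', hβ⟩ := h
  refine ⟨β'.constr K fun i => algebraMap k K (r (β i)), fun x => ?_⟩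
  have h1 : ((β'.constr K fun i => algebraMap k K (r (β i))).restrictScalars k).comp Φ.toLinearMap =
      (Algebra.linearMap k K).comp r := β.ext fun i => by
    simp [hβ]
  exact LinearMap.congr_fun h1 x

theorem span_range (h : IsSplit Φ) : Submodule.span K (Set.range Φ) = ⊤ := by
  obtain ⟨β, β', hβ⟩ := h
  rw [eq_top_iff, ← β'.span_eq]
  exact Submodule.span_mono (Set.range_subset_iff.2 fun i => ⟨β i, hβ i⟩)

/-- In corresponding bases an endomorphism and its extension have the same matrix, so that traces
and characteristic polynomials can be read off after splitting. -/
theorem toMatrix_map (h : IsSplit Φ) : ∃ (β : Basis (Fin (n ^ 2)) k A)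
    (β' : Basis (Fin (n ^ 2)) K (Matrix (Fin n) (Fin n) K)), ∀ (T : A →ₗ[k] A)
      (T' : Matrix (Fin n) (Fin n) K →ₗ[K] Matrix (Fin n) (Fin n) K),
      (∀ x, T' (Φ x) = Φ (T x)) →
      LinearMap.toMatrix β' β' T' = (algebraMap k K).mapMatrix (LinearMap.toMatrix β β T) := by
  obtain ⟨β, β', hβ⟩ := h
  refine ⟨β, β', fun T T' hT => ?_⟩
  ext i j
  rw [LinearMap.toMatrix_apply, ← hβ, hT, RingHom.mapMatrix_apply, Matrix.map_apply,
    LinearMap.toMatrix_apply]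
  conv_lhs => rw [← β.sum_repr (T (β j)), map_sum, map_sum]
  simp only [map_smul, hβ]
  rw [Finsupp.finsetSum_apply, Finset.sum_eq_single i]
  · rw [← algebraMap_smul K, map_smul]
    simp [Algebra.smul_def]
  · intro l _ hl
    rw [← algebraMap_smul K, map_smul]
    simp [hl]
  · simp

theorem trace_eq (h : IsSplit Φ) (T : A →ₗ[k] A)
    (T' : Matrix (Fin n) (Fin n) K →ₗ[K] Matrix (Fin n) (Fin n) K)
    (hT : ∀ x, T' (Φ x) = Φ (T x)) :
    LinearMap.trace K _ T' = algebraMap k K (LinearMap.trace k A T) := by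
  obtain ⟨β, β', hβ⟩ := h.toMatrix_map
  rw [LinearMap.trace_eq_matrix_trace K β', LinearMap.trace_eq_matrix_trace k β, hβ T T' hT]
  exact (AddMonoidHom.map_trace (algebraMap k K).toAddMonoidHom _).symm

theorem charpoly_eq [Module.Finite k A] (h : IsSplit Φ) (T : A →ₗ[k] A)
    (T' : Matrix (Fin n) (Fin n) K →ₗ[K] Matrix (Fin n) (Fin n) K)
    (hT : ∀ x, T' (Φ x) = Φ (T x)) : T'.charpoly = T.charpoly.map (algebraMap k K) := by
  obtain ⟨β, β', hβ⟩ := h.toMatrix_map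
  rw [← LinearMap.charpoly_toMatrix T' β', ← LinearMap.charpoly_toMatrix T β, hβ T T' hT,
    RingHom.mapMatrix_apply, Matrix.charpoly_map]

theorem algebraMap_reducedTrace [CharZero K] (hn : n ≠ 0) (h : IsSplit Φ) (x : A) :
    algebraMap k K (reducedTrace n k x) = (Φ x).trace := by
  have h1 := h.trace_eq (LinearMap.mulLeft k x) (LinearMap.mulLeft K (Φ x)) fun y => by simp
  rw [trace_mulLeft_matrix] at h1
  rw [reducedTrace, map_mul, map_inv₀, map_natCast, ← h1,
    inv_mul_cancel_left₀ (by exact_mod_cast hn)]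

theorem linearIndependent (h : IsSplit Φ) {ι : Type*} {x : ι → A} (hx : LinearIndependent k x) :
    LinearIndependent K fun i => Φ (x i) := by
  classical
  rw [linearIndependent_iff']
  intro s c hc i hi
  obtain ⟨r, hr⟩ : ∃ r : A →ₗ[k] k, ∀ j, r (x j) = if j = i then 1 else 0 := by
    obtain ⟨g, hg⟩ := (Basis.span hx).constr k (fun j => if j = i then (1 : k) else 0)
      |>.exists_extend
    refine ⟨g, fun j => ?_⟩
    have h2 := LinearMap.congr_fun hg (Basis.span hx j)
    rw [Basis.constr_basis, LinearMap.comp_apply] at h2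
    rw [← h2, Submodule.subtype_apply, Basis.span_apply]
  obtain ⟨R, hR⟩ := h.exists_extend r
  have := congrArg R hc
  simpa [hR, hr, hi] using this

/-- Descent: membership in a subspace may be tested after extension of scalars. -/
theorem mem_of_mem_span (h : IsSplit Φ) (U : Submodule k A) {x : A}
    (hx : Φ x ∈ Submodule.span K (Φ '' U)) : x ∈ U := by
  by_contra hxU
  obtain ⟨r, hr, hU⟩ := U.exists_le_ker_of_notMem hxU
  obtain ⟨R, hR⟩ := h.exists_extend r
  have h1 : Submodule.span K (Φ '' U) ≤ LinearMap.ker R := by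
    rw [Submodule.span_le]
    rintro _ ⟨u, hu, rfl⟩
    have : r u = 0 := hU hu
    simp [hR, this]
  have h2 : R (Φ x) = 0 := h1 hx
  rw [hR, map_eq_zero] at h2
  exact hr h2

end IsSplit

end Split

/-! ### Splittings of central simple algebras -/

section Splittings

open Module

/-- Minimal support argument. Expand elements in an `F`-basis of `K` and take a nonzero `x ∈ J` of
smallest support. By simplicity of `B`, some `y ∈ J` supported inside the support of `x` has
coefficient `1` at a chosen index. Its commutators with `1 ⊗ c` have smaller support, hence vanish;
so the coefficients of `y` are central, `y = κ ⊗ 1` with `κ ≠ 0`, and `J` contains a unit. -/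
theorem isSimpleRing_tensorProduct (F K B : Type*) [Field F] [Field K] [Algebra F K] [Ring B]
    [Algebra F B] [Algebra.IsCentral F B] [IsSimpleRing B] : IsSimpleRing (K ⊗[F] B) := by
  classical
  let b := Basis.ofVectorSpace F K
  let e := TensorProduct.equivFinsuppOfBasisLeft (N := B) b
  have hl : ∀ (c : B) (x : K ⊗[F] B) i, e ((1 ⊗ₜ c) * x) i = c * e x i := by
    intro c x i
    induction x with
    | zero => simp
    | add x y hx hy => rw [mul_add, map_add, map_add, Finsupp.add_apply, Finsupp.add_apply, hx, hy,
        mul_add]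
    | tmul r d => simp [e]
  have hr : ∀ (c : B) (x : K ⊗[F] B) i, e (x * (1 ⊗ₜ c)) i = e x i * c := by
    intro c x i
    induction x with
    | zero => simp
    | add x y hx hy => rw [add_mul, map_add, map_add, Finsupp.add_apply, Finsupp.add_apply, hx, hy,
        add_mul]
    | tmul r d => simp [e]
  have hnt : Nontrivial (K ⊗[F] B) := by
    refine ⟨1, 0, fun h => ?_⟩
    exact one_ne_zero (FaithfulSMul.algebraMap_injective K (K ⊗[F] B)
      (by rw [map_one, map_zero, h] : algebraMap K (K ⊗[F] B) 1 = algebraMap K (K ⊗[F] B) 0))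
  refine ⟨⟨fun J => ?_⟩⟩
  rw [or_iff_not_imp_left]
  intro hJ
  refine J.eq_top ?_
  obtain ⟨x₀, hx₀, hx₀'⟩ : ∃ x ∈ J, x ≠ 0 := by
    by_contra! hcon
    exact hJ (le_bot_iff.1 fun x hx => (TwoSidedIdeal.mem_bot _).2 (hcon x hx))
  have hex : ∃ m, ∃ x ∈ J, x ≠ 0 ∧ (e x).support.card = m := ⟨_, x₀, hx₀, hx₀', rfl⟩
  obtain ⟨x, hxJ, hx0, hxm⟩ := Nat.find_spec hex
  have hmin : ∀ z ∈ J, (e z).support.card < (e x).support.card → z = 0 := by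
    intro z hz hlt
    by_contra hz0
    exact Nat.find_min hex (hxm ▸ hlt) ⟨z, hz, hz0, rfl⟩
  obtain ⟨i₀, hi₀⟩ : ∃ i, e x i ≠ 0 := by
    by_contra! hcon
    exact hx0 (e.injective (by rw [map_zero]; exact Finsupp.ext hcon))
  -- The coefficients at `i₀` of the elements of `J` supported where `x` is form a two-sided ideal
  -- of `B`, nonzero because of `x` itself.
  let I : TwoSidedIdeal B := TwoSidedIdeal.mk'
    {c | ∃ y ∈ J, (∀ i, e x i = 0 → e y i = 0) ∧ e y i₀ = c}
    ⟨0, J.zero_mem, by simp, by simp⟩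
    (by
      rintro _ _ ⟨y, hy, hy', rfl⟩ ⟨z, hz, hz', rfl⟩
      exact ⟨y + z, J.add_mem hy hz, fun i hi => by simp [hy' i hi, hz' i hi], by simp⟩)
    (by
      rintro _ ⟨y, hy, hy', rfl⟩
      exact ⟨-y, J.neg_mem hy, fun i hi => by simp [hy' i hi], by simp⟩)
    (by
      rintro c _ ⟨y, hy, hy', rfl⟩
      exact ⟨(1 ⊗ₜ c) * y, J.mul_mem_left _ _ hy, fun i hi => by simp [hl, hy' i hi], hl _ _ _⟩)
    (by
      rintro _ c ⟨y, hy, hy', rfl⟩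
      exact ⟨y * (1 ⊗ₜ c), J.mul_mem_right _ _ hy, fun i hi => by simp [hr, hy' i hi], hr _ _ _⟩)
  have hI : I ≠ ⊥ := by
    intro h
    have : e x i₀ ∈ I := (TwoSidedIdeal.mem_mk' ..).2 ⟨x, hxJ, fun _ h => h, rfl⟩
    rw [h] at this
    exact hi₀ ((TwoSidedIdeal.mem_bot _).1 this)
  obtain ⟨y, hyJ, hy, hy1⟩ := (TwoSidedIdeal.mem_mk' ..).1 (IsSimpleRing.one_mem_of_ne_bot I hI)
  have hcomm : ∀ (c : B) i, c * e y i = e y i * c := by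
    intro c i
    have hz := hmin ((1 ⊗ₜ c) * y - y * (1 ⊗ₜ c))
      (J.sub_mem (J.mul_mem_left _ _ hyJ) (J.mul_mem_right _ _ hyJ)) (by
        refine Finset.card_lt_card (Finset.ssubset_iff.2 ⟨i₀, ?_, ?_⟩)
        · simp [hl, hr, hy1]
        · intro j hj
          rw [Finset.mem_insert] at hj
          rcases hj with rfl | hj
          · simpa using hi₀
          · rw [Finsupp.mem_support_iff] at hj ⊢
            intro hj'
            exact hj (by simp [hl, hr, hy j hj']))
    have := DFunLike.congr_fun (congrArg e hz) i
    simpa [hl, hr, sub_eq_zero] using this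
  have hcen : ∀ i, ∃ c : F, algebraMap F B c = e y i := fun i =>
    Algebra.mem_bot.1 (Algebra.IsCentral.out (K := F)
      (Subalgebra.mem_center_iff.2 fun c => hcomm c i))
  choose c hc using hcen
  have hyeq : y = (∑ i ∈ (e y).support, c i • b i) ⊗ₜ 1 := by
    conv_lhs => rw [← e.symm_apply_apply y, TensorProduct.equivFinsuppOfBasisLeft_symm_apply,
      Finsupp.sum]
    rw [TensorProduct.sum_tmul]
    refine Finset.sum_congr rfl fun i _ => ?_
    rw [← hc, Algebra.algebraMap_eq_smul_one, TensorProduct.tmul_smul, TensorProduct.smul_tmul']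
  have hκ : (∑ i ∈ (e y).support, c i • b i) ≠ 0 := by
    intro h
    rw [h, TensorProduct.zero_tmul] at hyeq
    rw [hyeq] at hy1
    simp at hy1
  generalize (∑ i ∈ (e y).support, c i • b i) = κ at hyeq hκ
  have h1 := J.mul_mem_left (κ⁻¹ ⊗ₜ 1) y hyJ
  rw [hyeq, Algebra.TensorProduct.tmul_mul_tmul, inv_mul_cancel₀ hκ, mul_one] at h1
  exact h1

theorem nonempty_splitting {n : ℕ} {F B : Type*} [Field F] [Ring B] [Algebra F B]
    [Algebra.IsCentral F B] [IsSimpleRing B] [FiniteDimensional F B]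
    (hB : Module.finrank F B = n ^ 2) : Nonempty (Splitting n F B) := by
  have := isSimpleRing_tensorProduct F (AlgebraicClosure F) B
  obtain ⟨m, _, ⟨φ⟩⟩ := IsSimpleRing.exists_algEquiv_matrix_of_isAlgClosed (AlgebraicClosure F)
    (AlgebraicClosure F ⊗[F] B)
  have h := φ.toLinearEquiv.finrank_eq
  rw [Module.finrank_baseChange, hB, Module.finrank_matrix] at h
  simp only [Fintype.card_fin, finrank_self, mul_one, ← pow_two] at h
  obtain rfl : n = m := Nat.pow_left_injective two_ne_zero h
  exact ⟨φ⟩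

variable {n : ℕ} {F B : Type*} [Field F] [Ring B] [Algebra F B]

/-- The homomorphism `k ⊗ B → Mₙ(K)` induced by a splitting of `B` over the algebraic closure and an
embedding of the algebraic closure into `K`. -/
def localSplit (φ : Splitting n F B) (k : Type*) {K : Type*} [Field k] [Algebra F k] [Field K]
    [Algebra F K] [Algebra k K] [IsScalarTower F k K] (ι : AlgebraicClosure F →ₐ[F] K) :
    k ⊗[F] B →ₐ[k] Matrix (Fin n) (Fin n) K :=
  Algebra.TensorProduct.lift (Algebra.ofId k _)
    ((ι.mapMatrix (m := Fin n)).comp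
      ((φ.toAlgHom.restrictScalars F).comp Algebra.TensorProduct.includeRight))
    (fun _ _ => Algebra.commutes _ _)

variable (φ : Splitting n F B) {k K : Type*} [Field k] [Algebra F k] [Field K]
    [Algebra F K] [Algebra k K] [IsScalarTower F k K] (ι : AlgebraicClosure F →ₐ[F] K)

theorem localSplit_tmul (c : k) (b : B) :
    localSplit φ k ι (c ⊗ₜ b) = c • (φ (1 ⊗ₜ b)).map ι :=
  (Algebra.TensorProduct.lift_tmul ..).trans (Algebra.smul_def ..).symm

/-- The matrix units over `K` are images of those over the algebraic closure of `F`, hence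
combinations of the images of a basis of `B`. A family of `n ^ 2` spanning elements is a basis. -/
theorem isSplit_localSplit [FiniteDimensional F B] (hB : Module.finrank F B = n ^ 2) (hn : n ≠ 0) :
    IsSplit (localSplit φ k ι) := by
  let b := finBasisOfFinrankEq F B hB
  let b' := (b.baseChange (AlgebraicClosure F)).map φ.toLinearEquiv
  have hb' : ∀ i, b' i = φ (1 ⊗ₜ b i) := fun i => by simp [b']
  have hΦ : ∀ i, localSplit φ k ι (b.baseChange k i) = (b' i).map ι := fun i => by
    rw [Basis.baseChange_apply, localSplit_tmul, one_smul, hb']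
  have : Nonempty (Fin (n ^ 2)) := ⟨⟨0, by positivity⟩⟩
  have hspan : ⊤ ≤ Submodule.span K (Set.range fun i => (b' i).map ι) := by
    rw [← (Matrix.stdBasis K (Fin n) (Fin n)).span_eq, Submodule.span_le]
    rintro _ ⟨⟨p, q⟩, rfl⟩
    have h1 : Matrix.stdBasis K (Fin n) (Fin n) (p, q) =
        (ι.mapMatrix (m := Fin n)) (Matrix.single p q 1) := by
      rw [Matrix.stdBasis_eq_single, AlgHom.mapMatrix_apply]
      ext r s
      simp [Matrix.single_apply, apply_ite ι]
    rw [h1, ← b'.sum_repr (Matrix.single p q 1), map_sum]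
    refine Submodule.sum_mem _ fun i _ => ?_
    have h2 : ι.mapMatrix (b'.repr (Matrix.single p q 1) i • b' i) =
        ι (b'.repr (Matrix.single p q 1) i) • (b' i).map ι := by
      ext r s
      simp
    rw [h2]
    exact Submodule.smul_mem _ _ (Submodule.subset_span ⟨i, rfl⟩)
  refine ⟨b.baseChange k, basisOfTopLeSpanOfCardEqFinrank (fun i => (b' i).map ι) hspan ?_,
    fun i => ?_⟩
  · rw [Module.finrank_matrix]
    simp [pow_two]
  · rw [hΦ, coe_basisOfTopLeSpanOfCardEqFinrank]

theorem localSplit_map (x : F ⊗[F] B) :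
    localSplit φ k ι (Algebra.TensorProduct.map (Algebra.ofId F k) (AlgHom.id F B) x) =
      (localSplit φ F (AlgHom.id F (AlgebraicClosure F)) x).map ι := by
  induction x with
  | zero => simp
  | add x y hx hy => rw [map_add, map_add, hx, hy, map_add, Matrix.map_add _ (map_add ι)]
  | tmul c b =>
    rw [Algebra.TensorProduct.map_tmul, localSplit_tmul, localSplit_tmul]
    ext i j
    rw [Matrix.map_apply, Matrix.smul_apply, Matrix.smul_apply, Algebra.smul_def, Algebra.smul_def,
      map_mul, AlgHom.commutes, Algebra.ofId_apply, ← IsScalarTower.algebraMap_apply]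
    rfl

end Splittings

/-! ### Simultaneous diagonalization of torus algebras -/

section Diagonalization

open Module

/-- If the minimal polynomial is `q * q * r`, then `q * r` takes a value of square zero at `x`,
which is zero as `C` is reduced; so the minimal polynomial divides `q * r` and `q` is a unit. -/
theorem squarefree_minpoly {k C : Type*} [Field k] [Ring C] [Algebra k C] [FiniteDimensional k C]
    [IsReduced C] (x : C) : Squarefree (minpoly k x) := by
  have hp0 : minpoly k x ≠ 0 := minpoly.ne_zero (Algebra.IsIntegral.isIntegral x)
  rintro q ⟨r, hr⟩
  have h1 : Polynomial.aeval x (q * r) = 0 := by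
    refine IsReduced.eq_zero _ ⟨2, ?_⟩
    rw [← map_pow, show (q * r) ^ 2 = q * q * r * r by ring, ← hr, map_mul, minpoly.aeval, zero_mul]
  have h2 := minpoly.dvd k x h1
  have hqr : q * r ≠ 0 := fun h => hp0 (by rw [hr, mul_assoc, h, mul_zero])
  obtain ⟨s, hs⟩ := h2
  refine IsUnit.of_mul_eq_one s ?_
  refine mul_left_cancel₀ hqr ?_
  rw [mul_one]
  conv_rhs => rw [hs, hr]
  ring

/-- A commutative reduced algebra of matrices is diagonalizable over an algebraically closed
field. -/
theorem exists_diagonalize {k C K : Type*} [Field k] [CharZero k] [Ring C] [Algebra k C]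
    [FiniteDimensional k C] [IsReduced C] (hcomm : ∀ x y : C, x * y = y * x) [Field K]
    [IsAlgClosed K] [Algebra k K] {n : ℕ} (Ψ : C →ₐ[k] Matrix (Fin n) (Fin n) K) :
    ∃ (V W : Matrix (Fin n) (Fin n) K) (χ : Fin n → C →ₐ[k] K), V * W = 1 ∧ W * V = 1 ∧
      ∀ x, Ψ x = V * Matrix.diagonal (fun i => χ i x) * W := by
  let T : C → End K (Fin n → K) := fun x => Matrix.toLin' (Ψ x)
  have hTcomm : Pairwise fun x y => Commute (T x) (T y) := fun x y _ => by
    change T x * T y = T y * T x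
    simp only [T, Module.End.mul_eq_comp, ← Matrix.toLin'_mul, ← map_mul, hcomm x y]
  have hss : ∀ x, (T x).IsSemisimple := fun x => by
    -- In characteristic zero a squarefree polynomial is separable, and separability survives the
    -- passage to `K`.
    have hsq := PerfectField.separable_iff_squarefree.2 (squarefree_minpoly (k := k) x)
    refine Module.End.isSemisimple_of_squarefree_aeval_eq_zero
      (p := (minpoly k x).map (algebraMap k K)) (hsq.map).squarefree ?_
    have h1 : Polynomial.aeval (Matrix.toLinAlgEquiv' (Ψ x)) ((minpoly k x).map (algebraMap k K)) =
        0 := by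
      rw [Polynomial.aeval_algHom_apply, Polynomial.aeval_map_algebraMap,
        Polynomial.aeval_algHom_apply, minpoly.aeval, map_zero, map_zero]
    exact h1
  -- Commuting operators over an algebraically closed field have joint generalized eigenspaces that
  -- span; for semisimple operators these are joint eigenspaces.
  have htop : ⨆ χ : C → K, ⨅ x, (T x).eigenspace (χ x) = ⊤ := by
    have := Module.End.iSup_iInf_maxGenEigenspace_eq_top_of_iSup_maxGenEigenspace_eq_top_of_commute
      T hTcomm fun x => Module.End.iSup_maxGenEigenspace_eq_top _
    simpa only [fun x => (Module.End.isFinitelySemisimple_iff_isSemisimple.2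
      (hss x)).maxGenEigenspace_eq_eigenspace] using this
  have hspan : ⊤ ≤ Submodule.span K {v : Fin n → K | ∃ χ : C → K, ∀ x, T x v = χ x • v} := by
    rw [← htop, iSup_le_iff]
    intro χ v hv
    refine Submodule.subset_span ⟨χ, fun x => ?_⟩
    exact Module.End.mem_eigenspace_iff.1 ((Submodule.mem_iInf _).1 hv x)
  let b := (Basis.ofSpan hspan).reindex ((Basis.ofSpan hspan).indexEquiv (Pi.basisFun K (Fin n)))
  have hb : ∀ i, ∃ χ : C → K, ∀ x, T x (b i) = χ x • b i := fun i => by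
    apply Basis.ofSpan_subset hspan
    rw [Basis.reindex_apply]
    exact Set.mem_range_self _
  choose χ hχ using hb
  let V := (Pi.basisFun K (Fin n)).toMatrix b
  let W := b.toMatrix (Pi.basisFun K (Fin n))
  have hVW : V * W = 1 := Basis.toMatrix_mul_toMatrix_flip _ _
  have hWV : W * V = 1 := Basis.toMatrix_mul_toMatrix_flip _ _
  have hΨV : ∀ x, Ψ x * V = V * Matrix.diagonal fun i => χ i x := fun x => by
    ext p i
    rw [Matrix.mul_diagonal]
    have := congrFun (hχ i x) p
    simp only [T, Matrix.toLin'_apply, Pi.smul_apply, smul_eq_mul] at this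
    rw [mul_comm]
    exact this
  have hdiag : ∀ x, W * Ψ x * V = Matrix.diagonal fun i => χ i x := fun x => by
    rw [mul_assoc, hΨV, ← mul_assoc, hWV, one_mul]
  -- An eigenvalue, being a diagonal entry in the eigenbasis, depends on `x` as an algebra
  -- homomorphism.
  have hent : ∀ i x, χ i x = (W * Ψ x * V) i i := fun i x => by
    rw [hdiag, Matrix.diagonal_apply_eq]
  let χ' : Fin n → C →ₐ[k] K := fun i =>
    { toFun := χ i
      map_one' := by rw [hent, map_one, mul_one, hWV, Matrix.one_apply_eq]
      map_mul' := fun x y => by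
        have h1 : W * Ψ (x * y) * V = (W * Ψ x * V) * (W * Ψ y * V) := by
          rw [map_mul, show W * Ψ x * V * (W * Ψ y * V) = W * Ψ x * (V * W) * Ψ y * V by
            simp only [mul_assoc], hVW, mul_one]
          simp only [mul_assoc]
        rw [hent, h1, hdiag, hdiag, Matrix.diagonal_mul_diagonal, Matrix.diagonal_apply_eq]
      map_zero' := by rw [hent, map_zero, mul_zero, zero_mul, Matrix.zero_apply]
      map_add' := fun x y => by
        rw [hent, hent, hent, map_add, mul_add, add_mul, Matrix.add_apply]
      commutes' := fun r => by
        rw [hent, AlgHom.commutes, ← Algebra.commutes, mul_assoc, hWV, mul_one,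
          Matrix.algebraMap_matrix_apply, if_pos rfl] }
  refine ⟨V, W, χ', hVW, hWV, fun x => ?_⟩
  change Ψ x = V * Matrix.diagonal (fun i => χ i x) * W
  rw [← hΨV, mul_assoc, hVW, mul_one]

theorem det_ne_zero_of_linearIndependent {K : Type*} [Field K] {n : ℕ}
    {V W P : Matrix (Fin n) (Fin n) K}
    (h : LinearIndependent K fun k => V * Matrix.diagonal (P k) * W) : P.det ≠ 0 := by
  rw [← isUnit_iff_ne_zero, ← Matrix.isUnit_iff_isUnit_det,
    ← Matrix.linearIndependent_rows_iff_isUnit]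
  let L : (Fin n → K) →ₗ[K] Matrix (Fin n) (Fin n) K :=
    (LinearMap.mulLeft K V).comp
      ((LinearMap.mulRight K W).comp (Matrix.diagonalLinearMap (Fin n) K K))
  refine LinearIndependent.of_comp L ?_
  convert h using 1
  ext1 k
  rw [mul_assoc]
  rfl

end Diagonalization

/-! ### The Galois action on the coordinates of a point -/

section Galois

open Module

variable {F : Type*} [Field F] {B : Type*} [Ring B] [Algebra F B] {n : ℕ}

/-- A diagonalization of the torus algebra `E` over the algebraic closure. -/
structure TorusDiag (φ : Splitting n F B) (E : Subalgebra F B) where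
  V : Matrix (Fin n) (Fin n) (AlgebraicClosure F)
  W : Matrix (Fin n) (Fin n) (AlgebraicClosure F)
  χ : Fin n → E →ₐ[F] AlgebraicClosure F
  mul_eq_one : V * W = 1
  mul_eq_one' : W * V = 1
  apply_eq : ∀ x : E, localSplit φ F (AlgHom.id F (AlgebraicClosure F)) (1 ⊗ₜ (x : B)) =
    V * Matrix.diagonal (fun i => χ i x) * W

theorem nonempty_torusDiag [CharZero F] [FiniteDimensional F B] (φ : Splitting n F B) {E : Subalgebra F B}
    (hE : IsTorusAlgebra n E) : Nonempty (TorusDiag φ E) := by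
  have := hE.reduced
  obtain ⟨V, W, χ, h1, h2, h3⟩ := exists_diagonalize (k := F) (C := E)
    (fun x y => Subtype.ext (hE.comm x x.2 y y.2))
    (((localSplit φ F (AlgHom.id F (AlgebraicClosure F))).comp
      (Algebra.TensorProduct.includeRight : B →ₐ[F] F ⊗[F] B)).comp E.val)
  exact ⟨⟨V, W, χ, h1, h2, h3⟩⟩

namespace TorusDiag

variable {φ : Splitting n F B} {E : Subalgebra F B} (d : TorusDiag φ E)

/-- The splitting over `F`. -/
abbrev split (_d : TorusDiag φ E) :
    F ⊗[F] B →ₐ[F] Matrix (Fin n) (Fin n) (AlgebraicClosure F) :=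
  localSplit φ F (AlgHom.id F (AlgebraicClosure F))

/-- The matrix of an element of `F ⊗ B` in the coordinates of the diagonalization. -/
def coord (x : F ⊗[F] B) : Matrix (Fin n) (Fin n) (AlgebraicClosure F) := d.W * d.split x * d.V

/-- The products of coordinates which are invariant under the torus. -/
def pairing (x y : F ⊗[F] B) (i j : Fin n) : AlgebraicClosure F := d.coord x j i * d.coord y i j

section

variable [FiniteDimensional F B] (hB : Module.finrank F B = n ^ 2) (hn : n ≠ 0)
include hB hn

theorem det_ne_zero (b : Basis (Fin n) F E) :
    (Matrix.of fun k i => d.χ i (b k)).det ≠ 0 := by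
  have hli : LinearIndependent F fun k => (1 : F) ⊗ₜ[F] (b k : B) := by
    have := (b.linearIndependent.map' E.val.toLinearMap
      (LinearMap.ker_eq_bot.2 Subtype.val_injective)).map'
      (TensorProduct.lid F B).symm.toLinearMap (LinearEquiv.ker _)
    exact this
  refine det_ne_zero_of_linearIndependent (V := d.V) (W := d.W) ?_
  have := (isSplit_localSplit φ (k := F) (AlgHom.id F (AlgebraicClosure F)) hB
    hn).linearIndependent hli
  simp only [d.apply_eq] at this
  exact this

theorem exists_coeff (b : Basis (Fin n) F E) : ∃ c : Matrix (Fin n) (Fin n) (AlgebraicClosure F),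
    c * (Matrix.of fun k i => d.χ i (b k)) = 1 :=
  ⟨_, Matrix.nonsing_inv_mul _ (isUnit_iff_ne_zero.2 (d.det_ne_zero hB hn b))⟩

variable (hE : IsTorusAlgebra n E)
include hE

theorem χ_injective : Function.Injective d.χ := by
  intro i j hij
  by_contra hne
  have b := finBasisOfFinrankEq F E hE.degree
  refine d.det_ne_zero hB hn b (Matrix.det_zero_of_column_eq hne fun k => ?_)
  simp [hij]

/-- There are at most `n` homomorphisms, and the `n` eigenvalue characters are distinct. -/
theorem exists_χ_eq (ψ : E →ₐ[F] AlgebraicClosure F) : ∃ i, d.χ i = ψ := by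
  have hle : Nat.card (E →ₐ[F] AlgebraicClosure F) ≤ Nat.card (Fin n) := by
    rw [Nat.card_eq_fintype_card (α := Fin n), Fintype.card_fin]
    exact (card_algHom_le_finrank F E (AlgebraicClosure F)).trans_eq hE.degree
  exact ((d.χ_injective hB hn hE).bijective_of_nat_card_le hle).2 ψ

end

/-- The rows of `c`, the inverse of the matrix of eigenvalues, are the coordinates of the primitive
idempotents in the basis `b`. -/
theorem sum_coeff_smul {b : Basis (Fin n) F E} {c : Matrix (Fin n) (Fin n) (AlgebraicClosure F)}
    (hc : c * (Matrix.of fun k i => d.χ i (b k)) = 1) (i : Fin n) :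
    ∑ k, c i k • d.split (1 ⊗ₜ (b k : B)) = d.V * Matrix.diagonal (Pi.single i 1) * d.W := by
  have h1 : (Matrix.diagonal (Pi.single i 1) : Matrix (Fin n) (Fin n) (AlgebraicClosure F)) =
      ∑ k, c i k • Matrix.diagonal (fun j => d.χ j (b k)) := by
    ext p q
    rw [Matrix.sum_apply]
    have h2 := congrFun (congrFun hc i) p
    rw [Matrix.mul_apply, Matrix.one_apply] at h2
    by_cases hpq : p = q
    · subst hpq
      simp only [Matrix.smul_apply, Matrix.diagonal_apply_eq, smul_eq_mul]
      simp only [Matrix.of_apply] at h2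
      rw [h2, Pi.single_apply]
      simp [eq_comm]
    · simp [hpq]
  rw [h1, Matrix.mul_sum, Matrix.sum_mul]
  refine Finset.sum_congr rfl fun k _ => ?_
  rw [d.apply_eq, Matrix.mul_smul, Matrix.smul_mul]

/-- With the idempotents `e_i` of the torus algebra, the pairing is the trace of `e_j x e_i y`.
Expanding the idempotents in a basis of `E` leaves traces of elements of `F ⊗ B`, so that Galois
acts only on the coefficients `c`. -/
theorem pairing_eq {b : Basis (Fin n) F E} {c : Matrix (Fin n) (Fin n) (AlgebraicClosure F)}
    (hc : c * (Matrix.of fun k i => d.χ i (b k)) = 1) (x y : F ⊗[F] B) (i j : Fin n) :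
    d.pairing x y i j = ∑ l, ∑ k, c j l * c i k *
      (d.split ((1 ⊗ₜ (b l : B)) * x * (1 ⊗ₜ (b k : B)) * y)).trace := by
  have h1 : ∑ l, ∑ k, c j l * c i k *
      (d.split ((1 ⊗ₜ (b l : B)) * x * (1 ⊗ₜ (b k : B)) * y)).trace =
      ((∑ l, c j l • d.split (1 ⊗ₜ (b l : B))) * d.split x *
        (∑ k, c i k • d.split (1 ⊗ₜ (b k : B))) * d.split y).trace := by
    simp only [Matrix.sum_mul, Matrix.mul_sum, Matrix.trace_sum]
    rw [Finset.sum_comm]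
    refine Finset.sum_congr rfl fun k _ => Finset.sum_congr rfl fun l _ => ?_
    simp only [map_mul, Matrix.smul_mul, Matrix.mul_smul, Matrix.trace_smul, smul_eq_mul]
    ring
  rw [h1, d.sum_coeff_smul hc, d.sum_coeff_smul hc]
  have h2 : (d.V * Matrix.diagonal (Pi.single j 1) * d.W * d.split x *
      (d.V * Matrix.diagonal (Pi.single i 1) * d.W) * d.split y).trace =
      (Matrix.diagonal (Pi.single j 1) * d.coord x *
        (Matrix.diagonal (Pi.single i 1) * d.coord y)).trace := by
    rw [show d.V * Matrix.diagonal (Pi.single j 1) * d.W * d.split x *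
      (d.V * Matrix.diagonal (Pi.single i 1) * d.W) * d.split y = d.V *
        (Matrix.diagonal (Pi.single j 1) * d.W * d.split x *
      (d.V * Matrix.diagonal (Pi.single i 1) * d.W) * d.split y) by simp only [mul_assoc],
      Matrix.trace_mul_comm]
    simp only [coord, mul_assoc]
  rw [h2, Matrix.trace]
  simp only [Matrix.diag_apply]
  rw [Finset.sum_eq_single j, Matrix.mul_apply, Finset.sum_eq_single i]
  · simp [pairing]
  · intro p _ hp
    rw [Matrix.diagonal_mul _ (d.coord y), Pi.single_eq_of_ne hp]
    simp
  · simp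
  · intro p _ hp
    rw [mul_assoc, Matrix.diagonal_mul, Pi.single_eq_of_ne hp, zero_mul]
  · simp

section

variable [FiniteDimensional F B] (hB : Module.finrank F B = n ^ 2) (hn : n ≠ 0)
  (hE : IsTorusAlgebra n E)
include hB hn hE

/-- The traces in `pairing_eq` are reduced traces, hence fixed by `s`, and `s` permutes the rows of
`c` by uniqueness of the inverse matrix. -/
theorem map_pairing [CharZero F] (s : AlgebraicClosure F ≃ₐ[F] AlgebraicClosure F) {σ : Equiv.Perm (Fin n)}
    (hσ : ∀ i, s.toAlgHom.comp (d.χ i) = d.χ (σ i)) (x y : F ⊗[F] B) (i j : Fin n) :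
    s (d.pairing x y i j) = d.pairing x y (σ i) (σ j) := by
  have b := finBasisOfFinrankEq F E hE.degree
  obtain ⟨c, hc⟩ := d.exists_coeff hB hn b
  have hsχ : ∀ i k, s (d.χ i (b k)) = d.χ (σ i) (b k) := fun i k => by rw [← hσ i]; rfl
  have hsc : ∀ i k, s (c i k) = c (σ i) k := by
    let c' : Matrix (Fin n) (Fin n) (AlgebraicClosure F) := Matrix.of fun i k => s (c (σ.symm i) k)
    have hc' : c' * (Matrix.of fun k i => d.χ i (b k)) = 1 := by
      ext p q
      have h2 := congrArg s (congrFun (congrFun hc (σ.symm p)) (σ.symm q))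
      rw [Matrix.mul_apply, map_sum] at h2
      simp only [Matrix.of_apply, map_mul, hsχ, Equiv.apply_symm_apply] at h2
      rw [Matrix.mul_apply]
      simp only [c', Matrix.of_apply]
      rw [h2, Matrix.one_apply, Matrix.one_apply]
      simp [apply_ite s]
    have : c' = c := by
      have h1 := mul_eq_one_comm.1 hc
      calc c' = c' * ((Matrix.of fun k i => d.χ i (b k)) * c) := by rw [h1, mul_one]
        _ = c := by rw [← mul_assoc, hc', one_mul]
    intro i k
    have h2 := congrFun (congrFun this (σ i)) k
    simpa [c'] using h2
  have htr : ∀ z : F ⊗[F] B, s (d.split z).trace = (d.split z).trace := fun z => by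
    rw [← (isSplit_localSplit φ (k := F) (AlgHom.id F (AlgebraicClosure F)) hB
      hn).algebraMap_reducedTrace hn, AlgEquiv.commutes]
  rw [d.pairing_eq hc, d.pairing_eq hc]
  simp only [map_sum, map_mul s, hsc, htr]

theorem exists_perm (s : AlgebraicClosure F ≃ₐ[F] AlgebraicClosure F) :
    ∃ σ : Equiv.Perm (Fin n), ∀ i, s.toAlgHom.comp (d.χ i) = d.χ (σ i) := by
  choose σ hσ using fun i => d.exists_χ_eq hB hn hE (s.toAlgHom.comp (d.χ i))
  have hinj : Function.Injective σ := fun i j hij => by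
    refine d.χ_injective hB hn hE (AlgHom.ext fun x => s.injective ?_)
    have h1 := DFunLike.congr_fun (hσ i) x
    have h2 := DFunLike.congr_fun (hσ j) x
    rw [hij] at h1
    exact h1.symm.trans h2
  exact ⟨Equiv.ofBijective σ (Finite.injective_iff_bijective.1 hinj), fun i => (hσ i).symm⟩

theorem exists_perm_of_twoTransitive (hG : HasTwoTransitiveGalois E) {i j i' j' : Fin n}
    (hij : i ≠ j) (hij' : i' ≠ j') :
    ∃ (s : AlgebraicClosure F ≃ₐ[F] AlgebraicClosure F) (σ : Equiv.Perm (Fin n)),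
      (∀ i, s.toAlgHom.comp (d.χ i) = d.χ (σ i)) ∧ σ i = i' ∧ σ j = j' := by
  have hmem : ∀ i x, d.χ i x ∈ splittingField E := fun i x =>
    IntermediateField.subset_adjoin F _ (Set.mem_iUnion.2 ⟨d.χ i, x, rfl⟩)
  let ψ : Fin n → E →ₐ[F] splittingField E := fun i =>
    (d.χ i).codRestrict (splittingField E).toSubalgebra (hmem i)
  have hψ : ∀ i x, (ψ i x : AlgebraicClosure F) = d.χ i x := fun i x => rfl
  have hinj := d.χ_injective hB hn hE
  have hψinj : ∀ {i j}, i ≠ j → ψ i ≠ ψ j := fun {i j} h h' => h (hinj (AlgHom.ext fun x => by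
    rw [← hψ, ← hψ, h']))
  obtain ⟨s, hs1, hs2⟩ := hG (ψ i) (ψ j) (ψ i') (ψ j') (hψinj hij) (hψinj hij')
  -- The 2-transitivity concerns automorphisms of the splitting field; they extend to the algebraic
  -- closure, which is normal.
  have hlift : ∀ x : splittingField E, s.liftNormal (AlgebraicClosure F) x = s x := fun x =>
    s.liftNormal_commutes (AlgebraicClosure F) x
  obtain ⟨σ, hσ⟩ := d.exists_perm hB hn hE (s.liftNormal (AlgebraicClosure F))
  have hkey : ∀ {i i'}, s.toAlgHom.comp (ψ i) = ψ i' → σ i = i' := fun {i i'} h => by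
    refine hinj (AlgHom.ext fun x => ?_)
    rw [← hσ, ← hψ i', ← h]
    exact hlift (ψ i x)
  exact ⟨_, σ, hσ, hkey hs1, hkey hs2⟩

/-- Single coordinates depend on the choice of eigenvectors, and only pairings are equivariant. So
the vanishing is transported through the pairings with every `y`; the coordinate of `y` at the given
position cannot vanish for all `y`, since the image of `F ⊗ B` spans the matrix algebra. -/
theorem coord_eq_zero_of_twoTransitive [CharZero F] (hG : HasTwoTransitiveGalois E)
    {x : F ⊗[F] B} {i j : Fin n} (hij : i ≠ j) (hx : d.coord x j i = 0) {i' j' : Fin n}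
    (hij' : i' ≠ j') : d.coord x j' i' = 0 := by
  obtain ⟨s, σ, hσ, rfl, rfl⟩ := d.exists_perm_of_twoTransitive hB hn hE hG hij hij'
  have h1 : ∀ y, d.pairing x y (σ i) (σ j) = 0 := fun y => by
    rw [← d.map_pairing hB hn hE s hσ, pairing, hx, zero_mul, map_zero]
  by_contra hne
  have h2 : ∀ y, d.coord y (σ i) (σ j) = 0 := fun y =>
    (mul_eq_zero.1 (h1 y)).resolve_left hne
  let R : Matrix (Fin n) (Fin n) (AlgebraicClosure F) →ₗ[AlgebraicClosure F] AlgebraicClosure F :=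
    (Matrix.entryLinearMap (AlgebraicClosure F) (AlgebraicClosure F) (σ i) (σ j)).comp
      ((LinearMap.mulLeft (AlgebraicClosure F) d.W).comp
        (LinearMap.mulRight (AlgebraicClosure F) d.V))
  have h3 : ⊤ ≤ LinearMap.ker R := by
    rw [← (isSplit_localSplit φ (k := F) (AlgHom.id F (AlgebraicClosure F)) hB hn).span_range,
      Submodule.span_le]
    rintro _ ⟨y, rfl⟩
    have := h2 y
    rw [coord, mul_assoc] at this
    exact this
  have h4 : R (d.V * Matrix.single (σ i) (σ j) 1 * d.W) = 0 := h3 Submodule.mem_top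
  change (d.W * (d.V * Matrix.single (σ i) (σ j) (1 : AlgebraicClosure F) * d.W * d.V) :
    Matrix (Fin n) (Fin n) (AlgebraicClosure F)) (σ i) (σ j) = 0 at h4
  rw [mul_assoc, d.mul_eq_one', mul_one, ← mul_assoc, d.mul_eq_one', one_mul,
    Matrix.single_apply_same] at h4
  exact one_ne_zero h4

/-- A point which is diagonal in the eigenbasis is a combination of idempotents, hence lies in the
span of `E` over the algebraic closure; `IsSplit.mem_of_mem_span` descends this to `F`. -/
theorem mem_baseChange {x : F ⊗[F] B} (hx : ∀ i j, i ≠ j → d.coord x j i = 0) :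
    x ∈ E.baseChange F := by
  have b := finBasisOfFinrankEq F E hE.degree
  obtain ⟨c, hc⟩ := d.exists_coeff hB hn b
  have hΦ := isSplit_localSplit φ (k := F) (AlgHom.id F (AlgebraicClosure F)) hB hn
  refine hΦ.mem_of_mem_span (Subalgebra.toSubmodule (E.baseChange F)) ?_
  have h1 : d.split x = ∑ i, d.coord x i i • (d.V * Matrix.diagonal (Pi.single i 1) * d.W) := by
    have h2 : d.coord x = Matrix.diagonal fun i => d.coord x i i := by
      ext i j
      rw [Matrix.diagonal_apply]
      split_ifs with h
      · rw [h]
      · exact hx j i (Ne.symm h)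
    have h3 : (Matrix.diagonal fun i => d.coord x i i) =
        ∑ i, d.coord x i i • Matrix.diagonal (Pi.single i 1) := by
      ext p q
      rw [Matrix.sum_apply, Matrix.diagonal_apply]
      split_ifs with h
      · subst h
        simp [Pi.single_apply]
      · simp [h]
    have h4 : d.split x = d.V * d.coord x * d.W := by
      rw [coord, show d.V * (d.W * d.split x * d.V) * d.W =
        (d.V * d.W) * d.split x * (d.V * d.W) by simp only [mul_assoc], d.mul_eq_one, one_mul,
        mul_one]
    rw [h4, h2, h3, Matrix.mul_sum, Matrix.sum_mul]
    refine Finset.sum_congr rfl fun i _ => ?_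
    rw [← h3, Matrix.mul_smul, Matrix.smul_mul, Matrix.diagonal_apply_eq]
  change d.split x ∈ _
  rw [h1]
  refine Submodule.sum_mem _ fun i _ => Submodule.smul_mem _ _ ?_
  rw [← d.sum_coeff_smul hc]
  exact Submodule.sum_mem _ fun k _ => Submodule.smul_mem _ _
    (Submodule.subset_span ⟨_, ⟨1 ⊗ₜ b k, by simp⟩, rfl⟩)

/-- The invariant of a point outside of the torus: a nonzero element of `F`. -/
theorem exists_invariant [CharZero F] (hG : HasTwoTransitiveGalois E) (x : (F ⊗[F] B)ˣ)
    (hx : ¬((x : F ⊗[F] B) ∈ E.baseChange F ∧ ((x⁻¹ : (F ⊗[F] B)ˣ) : F ⊗[F] B) ∈ E.baseChange F)) :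
    ∃ N : F, N ≠ 0 ∧ algebraMap F (AlgebraicClosure F) N =
      ∏ p : Fin n × Fin n with p.1 ≠ p.2,
        d.pairing x ((x⁻¹ : (F ⊗[F] B)ˣ) : F ⊗[F] B) p.1 p.2 := by
  have hinv : ∀ x y : F ⊗[F] B, x * y = 1 → d.coord x * d.coord y = 1 := fun x y hxy => by
    rw [coord, coord, show d.W * d.split x * d.V * (d.W * d.split y * d.V) =
      d.W * d.split x * (d.V * d.W) * d.split y * d.V by simp only [mul_assoc], d.mul_eq_one,
      mul_one, mul_assoc d.W, ← map_mul, hxy, map_one, mul_one, d.mul_eq_one']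
  have hdiag : ∀ x y : F ⊗[F] B, x * y = 1 → (∀ i j, i ≠ j → d.coord x j i = 0) →
      ∀ i j, i ≠ j → d.coord y j i = 0 := fun x y hxy h i j hij => by
    have h1 : d.coord x = Matrix.diagonal fun i => d.coord x i i := by
      ext i j
      rw [Matrix.diagonal_apply]
      split_ifs with h'
      · rw [h']
      · exact h j i (Ne.symm h')
    have h2 := hinv x y hxy
    have h3 : ∀ p q, d.coord x p p * d.coord y p q = if p = q then 1 else 0 := fun p q => by
      have := congrFun (congrFun h2 p) q
      rwa [h1, Matrix.diagonal_mul, Matrix.one_apply] at this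
    have h4 := h3 j j
    rw [if_pos rfl] at h4
    have h5 := h3 j i
    rw [if_neg hij.symm] at h5
    exact (mul_eq_zero.1 h5).resolve_left (left_ne_zero_of_mul (h4 ▸ one_ne_zero))
  have hne : ∀ z y : F ⊗[F] B, z * y = 1 →
      ¬(z ∈ E.baseChange F ∧ y ∈ E.baseChange F) → ∀ i j, i ≠ j → d.coord z j i ≠ 0 := by
    intro z y hzy hnot i j hij h0
    have h1 : ∀ i j, i ≠ j → d.coord z j i = 0 := fun i' j' hij' =>
      d.coord_eq_zero_of_twoTransitive hB hn hE hG hij h0 hij'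
    exact hnot ⟨d.mem_baseChange hB hn hE h1, d.mem_baseChange hB hn hE (hdiag z y hzy h1)⟩
  set y : F ⊗[F] B := ((x⁻¹ : (F ⊗[F] B)ˣ) : F ⊗[F] B) with hy
  have hN : ∏ p : Fin n × Fin n with p.1 ≠ p.2, d.pairing x y p.1 p.2 ∈
      Set.range (algebraMap F (AlgebraicClosure F)) := by
    -- Galois permutes the off-diagonal pairs, hence the factors of the product.
    rw [InfiniteGalois.mem_range_algebraMap_iff_fixed]
    intro s
    obtain ⟨σ, hσ⟩ := d.exists_perm hB hn hE s
    rw [map_prod]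
    simp only [d.map_pairing hB hn hE s hσ]
    refine Finset.prod_equiv (Equiv.prodCongr σ σ) ?_ ?_
    · simp
    · simp
  obtain ⟨N, hN⟩ := hN
  refine ⟨N, ?_, hN⟩
  rintro rfl
  rw [map_zero, eq_comm, Finset.prod_eq_zero_iff] at hN
  obtain ⟨⟨i, j⟩, hij, h0⟩ := hN
  have hij : i ≠ j := by simpa using hij
  -- A vanishing factor kills an off-diagonal coordinate of `x` or, with the indices exchanged, of
  -- its inverse.
  rcases mul_eq_zero.1 h0 with h | h
  · exact hne x y x.mul_inv hx i j hij h
  · exact hne y x x.inv_mul (fun h => hx h.symm) j i hij.symm h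

end

end TorusDiag

end Galois

/-! ### Bounds for the coordinates of a point of a Bowen ball -/

section CoordinateBounds

variable {K : Type*} [NormedField K] {n : ℕ}

/-- The largest norm of an entry. -/
def entryNorm (M : Matrix (Fin n) (Fin n) K) : ℝ := ‖fun p : Fin n × Fin n => M p.1 p.2‖

theorem entryNorm_nonneg (M : Matrix (Fin n) (Fin n) K) : 0 ≤ entryNorm M := norm_nonneg _

theorem norm_apply_le_entryNorm (M : Matrix (Fin n) (Fin n) K) (p q : Fin n) :
    ‖M p q‖ ≤ entryNorm M :=
  norm_le_pi_norm (fun p : Fin n × Fin n => M p.1 p.2) (p, q)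

theorem entryNorm_mul_le {M M' : Matrix (Fin n) (Fin n) K} {R : ℝ} (hR : 0 ≤ R)
    (h : ∀ p q r s, ‖M p q‖ * ‖M' r s‖ ≤ R) : entryNorm M * entryNorm M' ≤ R := by
  rcases Nat.eq_zero_or_pos n with rfl | hn
  · rw [entryNorm, Subsingleton.elim (fun p : Fin 0 × Fin 0 => M p.1 p.2) 0, norm_zero, zero_mul]
    exact hR
  · have : Nonempty (Fin n × Fin n) := ⟨(⟨0, hn⟩, ⟨0, hn⟩)⟩
    obtain ⟨p, hp⟩ := Finite.exists_max fun p : Fin n × Fin n => ‖M p.1 p.2‖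
    obtain ⟨q, hq⟩ := Finite.exists_max fun p : Fin n × Fin n => ‖M' p.1 p.2‖
    have h1 : entryNorm M ≤ ‖M p.1 p.2‖ := (pi_norm_le_iff_of_nonneg (norm_nonneg _)).2 hp
    have h2 : entryNorm M' ≤ ‖M' q.1 q.2‖ := (pi_norm_le_iff_of_nonneg (norm_nonneg _)).2 hq
    exact (mul_le_mul h1 h2 (entryNorm_nonneg _) (norm_nonneg _)).trans (h _ _ _ _)

theorem norm_coord_le (V W M : Matrix (Fin n) (Fin n) K) (i j : Fin n) :
    ‖(W * M * V) j i‖ ≤ sumBound K n ^ 2 * (‖W j‖ * entryNorm M * ‖fun p => V p i‖) := by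
  refine (norm_mul_apply_le (r := sumBound K n * (‖W j‖ * entryNorm M)) (s := ‖fun p => V p i‖)
    (mul_nonneg (sumBound_nonneg n) (mul_nonneg (norm_nonneg _) (entryNorm_nonneg _)))
    (norm_nonneg _) (fun q => ?_) fun q => norm_le_pi_norm (fun p => V p i) q).trans_eq (by ring)
  exact norm_mul_apply_le (norm_nonneg _) (entryNorm_nonneg _) (norm_le_pi_norm (W j))
    fun p => norm_apply_le_entryNorm M p q

/-- Here `z` is a scalar relating two representatives of a class of `PGL₁`; determinants see its
`n`-th power. -/
theorem norm_le_of_pow_det {X Yi : Matrix (Fin n) (Fin n) K} {z : K} (hn : n ≠ 0)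
    (h : z ^ n = X.det * Yi.det) :
    ‖z‖ ≤ sumBound K n.factorial ^ 2 * (entryNorm X * entryNorm Yi) := by
  have hs := one_le_sumBound (K := K) n.factorial
  have hX := entryNorm_nonneg X
  have hY := entryNorm_nonneg Yi
  refine le_of_pow_le_pow_left₀ hn (by positivity) ?_
  rw [← norm_pow, h, norm_mul]
  refine (mul_le_mul (norm_det_le hX (norm_apply_le_entryNorm X))
    (norm_det_le hY (norm_apply_le_entryNorm Yi)) (norm_nonneg _) (by positivity)).trans ?_
  rw [mul_pow, mul_pow, ← pow_mul, mul_mul_mul_comm, ← pow_two]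
  gcongr
  · omega

theorem conj_diagonal_pow {V W : Matrix (Fin n) (Fin n) K} (hVW : V * W = 1) (hWV : W * V = 1)
    (γ : Fin n → K) (m : ℕ) :
    (V * Matrix.diagonal γ * W) ^ m = V * Matrix.diagonal (fun i => γ i ^ m) * W := by
  induction m with
  | zero => simp [hVW]
  | succ m ih =>
    rw [pow_succ, ih, show V * Matrix.diagonal (fun i => γ i ^ m) * W *
      (V * Matrix.diagonal γ * W) = V * Matrix.diagonal (fun i => γ i ^ m) * (W * V) *
        Matrix.diagonal γ * W by simp only [mul_assoc], hWV, mul_one, mul_assoc V,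
      Matrix.diagonal_mul_diagonal]
    simp only [pow_succ]

/-- The constant in `norm_pairing_le`. -/
def pairBound (K : Type*) [NormedField K] (n : ℕ) : ℝ :=
  sumBound K n.factorial ^ 2 * sumBound K n ^ 4

theorem one_le_pairBound (n : ℕ) : 1 ≤ pairBound K n :=
  one_le_mul_of_one_le_of_one_le (one_le_pow₀ (one_le_sumBound _)) (one_le_pow₀ (one_le_sumBound _))

theorem pairBound_eq_one (h : IsNonarchimedean (norm : K → ℝ)) (n : ℕ) : pairBound K n = 1 := by
  simp [pairBound, sumBound_eq_one h]

theorem norm_mul_coord_le (V W M M' : Matrix (Fin n) (Fin n) K) (i j : Fin n) :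
    ‖(W * M * V) j i‖ * ‖(W * M' * V) i j‖ ≤ sumBound K n ^ 4 * (entryNorm M * entryNorm M') *
      ((‖fun p => V p i‖ * ‖W i‖) * (‖fun p => V p j‖ * ‖W j‖)) := by
  refine (mul_le_mul (norm_coord_le V W M i j) (norm_coord_le V W M' j i) (norm_nonneg _)
    (mul_nonneg (pow_nonneg (sumBound_nonneg n) 2) (mul_nonneg (mul_nonneg (norm_nonneg _)
      (entryNorm_nonneg _)) (norm_nonneg _)))).trans_eq (by ring)

/-- The torus-invariant products of coordinates of a point `b = aᵗ x a⁻ᵗ = z a⁻ᵗ y aᵗ`, where `a`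
has the eigenvalues `α i`. -/
theorem norm_pairing_le {V W X Xi Y Yi : Matrix (Fin n) (Fin n) K} (hVW : V * W = 1)
    (hWV : W * V = 1) (hY : Y * Yi = 1) {α β : Fin n → K}
    (hαβ : ∀ i, α i * β i = 1) {z zi : K} (τ : ℕ)
    (h1 : (V * Matrix.diagonal α * W) ^ τ * X * (V * Matrix.diagonal β * W) ^ τ =
      z • ((V * Matrix.diagonal β * W) ^ τ * Y * (V * Matrix.diagonal α * W) ^ τ))
    (h2 : (V * Matrix.diagonal α * W) ^ τ * Xi * (V * Matrix.diagonal β * W) ^ τ =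
      zi • ((V * Matrix.diagonal β * W) ^ τ * Yi * (V * Matrix.diagonal α * W) ^ τ))
    {R : ℝ} (hR : 0 ≤ R) (hXR : ∀ p q r s, ‖X p q‖ * ‖Xi r s‖ ≤ R)
    (hYR : ∀ p q r s, ‖Y p q‖ * ‖Yi r s‖ ≤ R) (i j : Fin n) :
    ‖(W * ((V * Matrix.diagonal α * W) ^ τ * X * (V * Matrix.diagonal β * W) ^ τ) * V) j i *
      (W * ((V * Matrix.diagonal α * W) ^ τ * Xi * (V * Matrix.diagonal β * W) ^ τ) * V) i j‖ ≤
      pairBound K n * R ^ 2 * ((‖fun p => V p i‖ * ‖W i‖) * (‖fun p => V p j‖ * ‖W j‖)) *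
        Real.exp (-2 * τ * |Real.log ‖α i * β j‖|) := by
  have hn : n ≠ 0 := (Fin.pos i).ne'
  have hpow := fun γ : Fin n → K => conj_diagonal_pow hVW hWV γ τ
  -- In the eigenbasis, multiplication by powers of the torus elements on the two sides rescales
  -- each coordinate separately.
  have hent : ∀ (γ δ : Fin n → K) (M : Matrix (Fin n) (Fin n) K) (p q : Fin n),
      (W * ((V * Matrix.diagonal γ * W) ^ τ * M * (V * Matrix.diagonal δ * W) ^ τ) * V) p q =
        (γ p * δ q) ^ τ * (W * M * V) p q := fun γ δ M p q => by
    rw [hpow, hpow, show W * (V * Matrix.diagonal (fun i => γ i ^ τ) * W * M *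
      (V * Matrix.diagonal (fun i => δ i ^ τ) * W)) * V = (W * V) *
        (Matrix.diagonal (fun i => γ i ^ τ) * (W * M * V) *
          Matrix.diagonal (fun i => δ i ^ τ)) * (W * V) by simp only [mul_assoc], hWV, one_mul,
      mul_one, Matrix.mul_diagonal, Matrix.diagonal_mul]
    ring
  have hα : ∀ i, α i ≠ 0 := fun i h => by simpa [h] using hαβ i
  have hβ : ∀ i, β i = (α i)⁻¹ := fun i => eq_inv_of_mul_eq_one_right (hαβ i)
  set ρ := ‖α i * β j‖ with hρ
  have hρ0 : 0 < ρ := norm_pos_iff.2 (mul_ne_zero (hα i) (hβ j ▸ inv_ne_zero (hα j)))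
  have hρ' : ‖α j * β i‖ = ρ⁻¹ := by
    rw [hρ, hβ, hβ, norm_mul, norm_mul, norm_inv, norm_inv, mul_inv, inv_inv, mul_comm]
  have hdetAB : (V * Matrix.diagonal α * W).det * (V * Matrix.diagonal β * W).det = 1 := by
    rw [← Matrix.det_mul, show V * Matrix.diagonal α * W * (V * Matrix.diagonal β * W) =
      V * Matrix.diagonal α * (W * V) * Matrix.diagonal β * W by simp only [mul_assoc], hWV,
      mul_one, mul_assoc V, Matrix.diagonal_mul_diagonal]
    simp [hαβ, hVW]
  have hdet : ∀ {M M' : Matrix (Fin n) (Fin n) K} {w : K},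
      (V * Matrix.diagonal α * W) ^ τ * M * (V * Matrix.diagonal β * W) ^ τ =
      w • ((V * Matrix.diagonal β * W) ^ τ * M' * (V * Matrix.diagonal α * W) ^ τ) →
      M.det = w ^ n * M'.det := fun {M M' w} h => by
    have h3 := congrArg Matrix.det h
    simp only [Matrix.det_mul, Matrix.det_pow, Matrix.det_smul, Fintype.card_fin] at h3 hdetAB
    have h4 := congrArg (· ^ τ) hdetAB
    simp only [mul_pow, one_pow] at h4 h3
    linear_combination h3 - (M.det - w ^ n * M'.det) * h4
  have hz1 : ‖z‖ ≤ sumBound K n.factorial ^ 2 * (entryNorm X * entryNorm Yi) := by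
    refine norm_le_of_pow_det hn ?_
    rw [hdet h1, mul_assoc, ← Matrix.det_mul, hY, Matrix.det_one, mul_one]
  have hz2 : ‖zi‖ ≤ sumBound K n.factorial ^ 2 * (entryNorm Xi * entryNorm Y) := by
    refine norm_le_of_pow_det hn ?_
    rw [hdet h2, mul_assoc, ← Matrix.det_mul, mul_eq_one_comm.1 hY, Matrix.det_one, mul_one]
  have hXX := entryNorm_mul_le hR hXR
  have hYY := entryNorm_mul_le hR hYR
  have hb0 : 0 ≤ pairBound K n * ((‖fun p => V p i‖ * ‖W i‖) * (‖fun p => V p j‖ * ‖W j‖)) :=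
    mul_nonneg (zero_le_one.trans (one_le_pairBound n)) (by positivity)
  -- For `PGL₁` only the products of `X` with `Xi` and of `Y` with `Yi` are bounded, while a mixed
  -- product such as that of `X` with `Yi` is not. The bound for the scalar brings in exactly the
  -- two missing factors.
  have hRR : (entryNorm X * entryNorm Xi) * (entryNorm Y * entryNorm Yi) ≤ R ^ 2 := by
    rw [pow_two]
    exact mul_le_mul hXX hYY (mul_nonneg (entryNorm_nonneg _) (entryNorm_nonneg _)) hR
  have hs4 : 0 ≤ sumBound K n ^ 4 := pow_nonneg (sumBound_nonneg n) 4
  have hmm : 0 ≤ (‖fun p => V p i‖ * ‖W i‖) * (‖fun p => V p j‖ * ‖W j‖) := by positivity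
  have hnX := entryNorm_nonneg X
  have hnXi := entryNorm_nonneg Xi
  have hnY := entryNorm_nonneg Y
  have hnYi := entryNorm_nonneg Yi
  -- According to the sign of `log ρ`, the point is taken in the `X` form and its inverse in the
  -- `Yi` form, or the point in the `Y` form and its inverse in the `Xi` form. Either way both
  -- coordinates contract by the `τ`-th power of the smaller of `ρ` and `ρ⁻¹`.
  rcases le_total 1 ρ with hle | hle
  · have hexp : Real.exp (-2 * τ * |Real.log ρ|) = (ρ⁻¹ ^ τ) * (ρ⁻¹ ^ τ) := by
      rw [abs_of_nonneg (Real.log_nonneg hle), ← pow_add]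
      conv_rhs => rw [← Real.exp_log (inv_pos.2 hρ0), ← Real.exp_nat_mul, Real.log_inv]
      push_cast
      ring_nf
    rw [hent, h2, Matrix.mul_smul, Matrix.smul_mul, Matrix.smul_apply, hent, hexp, smul_eq_mul]
    calc ‖(α j * β i) ^ τ * (W * X * V) j i * (zi * ((β i * α j) ^ τ * (W * Yi * V) i j))‖
        = ‖zi‖ * (‖(W * X * V) j i‖ * ‖(W * Yi * V) i j‖) * ((ρ⁻¹ ^ τ) * (ρ⁻¹ ^ τ)) := by
          rw [mul_comm (β i)]
          simp only [norm_mul (_ ^ τ), norm_mul (_ * _) (_ * _), norm_mul zi, norm_pow, hρ']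
          ring
      _ ≤ (sumBound K n.factorial ^ 2 * (entryNorm Xi * entryNorm Y)) *
          (sumBound K n ^ 4 * (entryNorm X * entryNorm Yi) *
            ((‖fun p => V p i‖ * ‖W i‖) * (‖fun p => V p j‖ * ‖W j‖))) *
          ((ρ⁻¹ ^ τ) * (ρ⁻¹ ^ τ)) := by
          refine mul_le_mul_of_nonneg_right ?_ (by positivity)
          exact mul_le_mul hz2 (norm_mul_coord_le V W X Yi i j) (by positivity)
            ((norm_nonneg _).trans hz2)
      _ = (pairBound K n * ((‖fun p => V p i‖ * ‖W i‖) * (‖fun p => V p j‖ * ‖W j‖))) *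
          ((entryNorm X * entryNorm Xi) * (entryNorm Y * entryNorm Yi)) *
          ((ρ⁻¹ ^ τ) * (ρ⁻¹ ^ τ)) := by
          rw [pairBound]
          ring
      _ ≤ (pairBound K n * ((‖fun p => V p i‖ * ‖W i‖) * (‖fun p => V p j‖ * ‖W j‖))) * R ^ 2 *
          ((ρ⁻¹ ^ τ) * (ρ⁻¹ ^ τ)) := by gcongr
      _ = _ := by ring
  · have hexp : Real.exp (-2 * τ * |Real.log ρ|) = (ρ ^ τ) * (ρ ^ τ) := by
      rw [abs_of_nonpos (Real.log_nonpos hρ0.le hle), ← pow_add]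
      conv_rhs => rw [← Real.exp_log hρ0, ← Real.exp_nat_mul]
      push_cast
      ring_nf
    rw [h1, Matrix.mul_smul, Matrix.smul_mul, Matrix.smul_apply, hent, hent, hexp, smul_eq_mul]
    calc ‖z * ((β j * α i) ^ τ * (W * Y * V) j i) * ((α i * β j) ^ τ * (W * Xi * V) i j)‖
        = ‖z‖ * (‖(W * Y * V) j i‖ * ‖(W * Xi * V) i j‖) * ((ρ ^ τ) * (ρ ^ τ)) := by
          rw [mul_comm (β j)]
          simp only [norm_mul (_ ^ τ), norm_mul (_ * _) (_ * _), norm_mul z, norm_pow, ← hρ]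
          ring
      _ ≤ (sumBound K n.factorial ^ 2 * (entryNorm X * entryNorm Yi)) *
          (sumBound K n ^ 4 * (entryNorm Y * entryNorm Xi) *
            ((‖fun p => V p i‖ * ‖W i‖) * (‖fun p => V p j‖ * ‖W j‖))) *
          ((ρ ^ τ) * (ρ ^ τ)) := by
          refine mul_le_mul_of_nonneg_right ?_ (by positivity)
          exact mul_le_mul hz1 (norm_mul_coord_le V W Y Xi i j) (by positivity)
            ((norm_nonneg _).trans hz1)
      _ = (pairBound K n * ((‖fun p => V p i‖ * ‖W i‖) * (‖fun p => V p j‖ * ‖W j‖))) *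
          ((entryNorm X * entryNorm Xi) * (entryNorm Y * entryNorm Yi)) *
          ((ρ ^ τ) * (ρ ^ τ)) := by
          rw [pairBound]
          ring
      _ ≤ (pairBound K n * ((‖fun p => V p i‖ * ‖W i‖) * (‖fun p => V p j‖ * ‖W j‖))) * R ^ 2 *
          ((ρ ^ τ) * (ρ ^ τ)) := by gcongr
      _ = _ := by ring

/-- Each index occurs `n - 1` times in either position of an off-diagonal pair. -/
theorem prod_offDiag_mul (m : Fin n → ℝ) :
    ∏ p : Fin n × Fin n with p.1 ≠ p.2, (m p.1 * m p.2) = (∏ i, m i) ^ (2 * (n - 1)) := by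
  have h1 : ∀ g : Fin n → Fin n → ℝ, ∏ p : Fin n × Fin n with p.1 ≠ p.2, g p.1 p.2 =
      ∏ i, ∏ j ∈ Finset.univ.erase i, g i j := fun g => by
    rw [Finset.prod_filter, Fintype.prod_prod_type]
    refine Finset.prod_congr rfl fun i _ => ?_
    rw [← Finset.prod_filter]
    refine Finset.prod_congr ?_ fun _ _ => rfl
    ext j
    simp [eq_comm]
  have h2 : ∏ p : Fin n × Fin n with p.1 ≠ p.2, m p.1 = (∏ i, m i) ^ (n - 1) := by
    rw [h1 fun i _ => m i, ← Finset.prod_pow]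
    simp
  have h3 : ∏ p : Fin n × Fin n with p.1 ≠ p.2, m p.2 =
      ∏ p : Fin n × Fin n with p.1 ≠ p.2, m p.1 :=
    Finset.prod_equiv (Equiv.prodComm _ _) (by simp [eq_comm]) (by simp)
  rw [Finset.prod_mul_distrib, h3, h2, ← pow_add, two_mul]

/-- As `e` vanishes on the diagonal, the exponent may be summed over all pairs, which matches the
eigenvalues of the adjoint action. -/
theorem prod_offDiag_le {ψ : Fin n → Fin n → ℝ} {c : ℝ} {m : Fin n → ℝ} {e : Fin n → Fin n → ℝ}
    {t : ℝ} (hψ : ∀ i j, 0 ≤ ψ i j) (he : ∀ i, e i i = 0)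
    (h : ∀ i j, ψ i j ≤ c * (m i * m j) * Real.exp (t * e i j)) :
    ∏ p : Fin n × Fin n with p.1 ≠ p.2, ψ p.1 p.2 ≤
      c ^ (Finset.univ.filter fun p : Fin n × Fin n => p.1 ≠ p.2).card *
        (∏ i, m i) ^ (2 * (n - 1)) * Real.exp (t * ∑ p : Fin n × Fin n, e p.1 p.2) := by
  refine (Finset.prod_le_prod (fun p _ => hψ _ _) fun p _ => h p.1 p.2).trans_eq ?_
  rw [Finset.prod_mul_distrib, Finset.prod_mul_distrib, prod_offDiag_mul, Finset.prod_const,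
    ← Real.exp_sum, ← Finset.mul_sum, Finset.sum_filter_of_ne]
  rintro ⟨i, j⟩ _ hne (h' : i = j)
  exact hne (by rw [h']; exact he j)

end CoordinateBounds

/-! ### Local coordinates -/

section GroupPoints

variable {F : Type*} [Field F] {B : Type*} [Ring B] [Algebra F B] {n : ℕ} {f : Form}
  {k : Type*} [Field k] [Algebra F k]

/-- Lets the two forms be treated together: for `SL₁` the scalar is `1`. -/
theorem Form.exists_smul_of_mk_eq {x y : f.units n F B k}
    (h : (QuotientGroup.mk x : GPts f n F B k) = QuotientGroup.mk y) :
    ∃ r : kˣ, ((x : (k ⊗[F] B)ˣ) : k ⊗[F] B) = (r : k) • ((y : (k ⊗[F] B)ˣ) : k ⊗[F] B) ∧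
      (((x : (k ⊗[F] B)ˣ)⁻¹ : (k ⊗[F] B)ˣ) : k ⊗[F] B) =
        ((r⁻¹ : kˣ) : k) • (((y : (k ⊗[F] B)ˣ)⁻¹ : (k ⊗[F] B)ˣ) : k ⊗[F] B) := by
  rw [eq_comm, QuotientGroup.eq, Subgroup.mem_subgroupOf] at h
  have h1 : ∃ r : kˣ, (((y⁻¹ * x : f.units n F B k)) : (k ⊗[F] B)ˣ) =
      Units.map (algebraMap k (k ⊗[F] B) : k →* k ⊗[F] B) r := by
    cases f with
    | simplyConnected => exact ⟨1, by rw [map_one]; exact h⟩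
    | adjoint =>
      obtain ⟨r, hr⟩ := h
      exact ⟨r, hr.symm⟩
  obtain ⟨r, hr⟩ := h1
  have h2 : (x : (k ⊗[F] B)ˣ) =
      y * Units.map (algebraMap k (k ⊗[F] B) : k →* k ⊗[F] B) r := by
    rw [← hr]
    simp
  refine ⟨r, ?_, ?_⟩
  · rw [h2, Units.val_mul, Units.coe_map, MonoidHom.coe_coe, ← Algebra.commutes, Algebra.smul_def]
  · rw [h2, mul_inv_rev, Units.val_mul, ← map_inv, Units.coe_map, MonoidHom.coe_coe,
      Algebra.smul_def]

theorem GPts.Ad_mk_apply (x : f.units n F B k) (y : k ⊗[F] B) :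
    GPts.Ad (QuotientGroup.mk x : GPts f n F B k) y =
      ((x : (k ⊗[F] B)ˣ) : k ⊗[F] B) * y * (((x : (k ⊗[F] B)ˣ)⁻¹ : (k ⊗[F] B)ˣ) : k ⊗[F] B) :=
  rfl

theorem exists_mk_of_mem_subPts {M : Submonoid (k ⊗[F] B)} {x : GPts f n F B k}
    (hx : x ∈ subPts f n M) : ∃ y : f.units n F B k, QuotientGroup.mk y = x ∧
      ((y : (k ⊗[F] B)ˣ) : k ⊗[F] B) ∈ M ∧
        (((y : (k ⊗[F] B)ˣ)⁻¹ : (k ⊗[F] B)ˣ) : k ⊗[F] B) ∈ M := by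
  obtain ⟨y, hy, rfl⟩ := hx
  rw [SetLike.mem_coe, Subgroup.mem_subgroupOf, Submonoid.mem_units_iff] at hy
  exact ⟨y, rfl, hy.1, hy.2⟩

/-- The conjugate `g⁻¹ E g` of the base change of a subalgebra. -/
def conjAlgebra (E : Subalgebra F B) (g : GPts f n F B k) : Subalgebra k (k ⊗[F] B) :=
  (E.baseChange k).map (GPts.Ad g⁻¹ : _ ≃ₐ[k] _).toAlgHom

end GroupPoints

theorem conj_coord_eq {K : Type*} [Field K] {n : ℕ} {V W : Matrix (Fin n) (Fin n) K}
    (h : W * V = 1) (p q : Fin n → K) (G M G' : Matrix (Fin n) (Fin n) K) :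
    W * (V * Matrix.diagonal p * W * (G * M * G') * (V * Matrix.diagonal q * W)) * V =
      Matrix.diagonal p * (W * G * M * (G' * V)) * Matrix.diagonal q := by
  calc _ = (W * V) * Matrix.diagonal p * (W * G * M * (G' * V)) * Matrix.diagonal q * (W * V) := by
        simp only [mul_assoc]
    _ = _ := by rw [h, one_mul, mul_one]

namespace TorusDiag

variable {F : Type*} [Field F] {B : Type*} [Ring B] [Algebra F B] {n : ℕ}
  {φ : Splitting n F B} {E : Subalgebra F B} (d : TorusDiag φ E)
  {k K : Type*} [Field k] [Algebra F k] [Field K]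
  [Algebra F K] [Algebra k K] [IsScalarTower F k K] (ι : AlgebraicClosure F →ₐ[F] K)

/-- The eigenvectors of the conjugate of the torus algebra by `g`. -/
def locV (g : (k ⊗[F] B)ˣ) : Matrix (Fin n) (Fin n) K :=
  localSplit φ k ι ((g⁻¹ : (k ⊗[F] B)ˣ) : k ⊗[F] B) * d.V.map ι

/-- The dual eigenvectors of the conjugate of the torus algebra by `g`. -/
def locW (g : (k ⊗[F] B)ˣ) : Matrix (Fin n) (Fin n) K := d.W.map ι * localSplit φ k ι g

theorem map_mul_map : d.V.map ι * d.W.map ι = 1 := by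
  rw [← Matrix.map_mul, d.mul_eq_one, Matrix.map_one _ (map_zero ι) (map_one ι)]

theorem map_mul_map' : d.W.map ι * d.V.map ι = 1 := by
  rw [← Matrix.map_mul, d.mul_eq_one', Matrix.map_one _ (map_zero ι) (map_one ι)]

theorem locV_mul_locW (g : (k ⊗[F] B)ˣ) : d.locV ι g * d.locW ι g = 1 := by
  rw [locV, locW, mul_assoc, ← mul_assoc (d.V.map ι), map_mul_map, one_mul, ← map_mul,
    Units.inv_mul, map_one]

theorem locW_mul_locV (g : (k ⊗[F] B)ˣ) : d.locW ι g * d.locV ι g = 1 :=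
  mul_eq_one_comm.1 (d.locV_mul_locW ι g)

theorem exists_diagonal_baseChange {x : k ⊗[F] B} (hx : x ∈ E.baseChange k) :
    ∃ p : Fin n → K, localSplit φ k ι x = d.V.map ι * Matrix.diagonal p * d.W.map ι := by
  obtain ⟨y, rfl⟩ := hx
  induction y with
  | zero => exact ⟨0, by simp⟩
  | add y z hy hz =>
    obtain ⟨p, hp⟩ := hy
    obtain ⟨q, hq⟩ := hz
    refine ⟨p + q, ?_⟩
    rw [map_add, map_add, hp, hq, ← add_mul, ← mul_add, Matrix.diagonal_add]
    rfl
  | tmul c e =>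
    refine ⟨fun i => c • ι (d.χ i e), ?_⟩
    have h1 := congrArg (fun M : Matrix (Fin n) (Fin n) (AlgebraicClosure F) => M.map ι)
      (d.apply_eq e)
    simp only [localSplit_tmul, one_smul, Matrix.map_mul, Matrix.diagonal_map (map_zero ι)] at h1
    change localSplit φ k ι (c ⊗ₜ[F] (e : B)) = _
    have h2 : (Matrix.diagonal fun i => c • ι (d.χ i e)) =
        c • Matrix.diagonal fun i => ι (d.χ i e) := by
      rw [← Matrix.diagonal_smul]
      rfl
    rw [localSplit_tmul, h2, Matrix.mul_smul, Matrix.smul_mul]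
    congr 1

theorem exists_diagonal_conj {f : Form} (g : f.units n F B k) {x : k ⊗[F] B}
    (hx : x ∈ conjAlgebra E (QuotientGroup.mk g : GPts f n F B k)) :
    ∃ p : Fin n → K, localSplit φ k ι x =
      d.locV ι (g : (k ⊗[F] B)ˣ) * Matrix.diagonal p * d.locW ι (g : (k ⊗[F] B)ˣ) := by
  obtain ⟨y, hy, rfl⟩ := hx
  obtain ⟨p, hp⟩ := d.exists_diagonal_baseChange ι hy
  refine ⟨p, ?_⟩
  have h1 : (GPts.Ad (QuotientGroup.mk g : GPts f n F B k)⁻¹ : _ ≃ₐ[k] _).toAlgHom y =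
      (((g : (k ⊗[F] B)ˣ)⁻¹ : (k ⊗[F] B)ˣ) : k ⊗[F] B) * y * ((g : (k ⊗[F] B)ˣ) : k ⊗[F] B) := by
    rw [← QuotientGroup.mk_inv]
    refine (GPts.Ad_mk_apply (g⁻¹) y).trans ?_
    simp
  change localSplit φ k ι ((GPts.Ad (QuotientGroup.mk g : GPts f n F B k)⁻¹ :
    _ ≃ₐ[k] _).toAlgHom y) = _
  rw [h1, map_mul, map_mul, hp, locV, locW]
  simp only [mul_assoc]

/-- The matrix of an element of `k ⊗ B` in the coordinates of the conjugate torus. -/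
def locCoord (g : (k ⊗[F] B)ˣ) (M : Matrix (Fin n) (Fin n) K) : Matrix (Fin n) (Fin n) K :=
  d.locW ι g * M * d.locV ι g

/-- Torus elements on the left and right multiply the `(j, i)` coordinate of the point by `p j` and
`q i`, and the `(i, j)` coordinate of its inverse by their inverses. These factors cancel in the
pairing, and so does the scalar `r`. -/
theorem map_pairing_eq {f : Form} (l : f.units n F B F) (g b : f.units n F B k)
    {t s : GPts f n F B k} (ht : t ∈ subPts f n (E.baseChange k).toSubmonoid)
    (hs : s ∈ subPts f n (E.baseChange k).toSubmonoid)
    (hl : GPts.map f n (Algebra.ofId F k) (QuotientGroup.mk l) =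
      t * (QuotientGroup.mk g * QuotientGroup.mk b * (QuotientGroup.mk g)⁻¹) * s) (i j : Fin n) :
    ι (d.pairing ((l : (F ⊗[F] B)ˣ) : F ⊗[F] B)
        (((l : (F ⊗[F] B)ˣ)⁻¹ : (F ⊗[F] B)ˣ) : F ⊗[F] B) i j) =
      d.locCoord ι (g : (k ⊗[F] B)ˣ) (localSplit φ k ι ((b : (k ⊗[F] B)ˣ) : k ⊗[F] B)) j i *
        d.locCoord ι (g : (k ⊗[F] B)ˣ)
          (localSplit φ k ι (((b : (k ⊗[F] B)ˣ)⁻¹ : (k ⊗[F] B)ˣ) : k ⊗[F] B)) i j := by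
  obtain ⟨t, rfl, ht1, ht2⟩ := exists_mk_of_mem_subPts ht
  obtain ⟨s, rfl, hs1, hs2⟩ := exists_mk_of_mem_subPts hs
  let Φ := localSplit φ k ι
  let l' : f.units n F B k :=
    ⟨Units.map (Algebra.TensorProduct.map (Algebra.ofId F k) (AlgHom.id F B) :
      F ⊗[F] B →* k ⊗[F] B) l, f.map_units_mem n (Algebra.ofId F k) l.2⟩
  have hl' : (QuotientGroup.mk l' : GPts f n F B k) =
      QuotientGroup.mk (t * (g * b * g⁻¹) * s) := hl
  obtain ⟨r, hr1, hr2⟩ := Form.exists_smul_of_mk_eq hl'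
  obtain ⟨p, hp⟩ := d.exists_diagonal_baseChange ι ht1
  obtain ⟨p', hp'⟩ := d.exists_diagonal_baseChange ι ht2
  obtain ⟨q, hq⟩ := d.exists_diagonal_baseChange ι hs1
  obtain ⟨q', hq'⟩ := d.exists_diagonal_baseChange ι hs2
  have hinv : ∀ {x y : k ⊗[F] B} {p p' : Fin n → K}, x * y = 1 →
      Φ x = d.V.map ι * Matrix.diagonal p * d.W.map ι →
      Φ y = d.V.map ι * Matrix.diagonal p' * d.W.map ι → ∀ i, p i * p' i = 1 := by
    intro x y p p' hxy hx hy i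
    have h1 : Matrix.diagonal p * Matrix.diagonal p' = (1 : Matrix (Fin n) (Fin n) K) := by
      calc Matrix.diagonal p * Matrix.diagonal p' = (d.W.map ι * d.V.map ι) * Matrix.diagonal p *
          (d.W.map ι * d.V.map ι) * Matrix.diagonal p' * (d.W.map ι * d.V.map ι) := by
            rw [map_mul_map', one_mul, mul_one, mul_one]
        _ = d.W.map ι * (Φ x * Φ y) * d.V.map ι := by
            rw [hx, hy]
            simp only [mul_assoc]
        _ = 1 := by rw [← map_mul, hxy, map_one, mul_one, map_mul_map']
    have h2 := congrFun (congrFun h1 i) i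
    rwa [Matrix.diagonal_mul_diagonal, Matrix.diagonal_apply_eq, Matrix.one_apply_eq] at h2
  have hpp := hinv (Units.mul_inv _) hp hp'
  have hqq := hinv (Units.mul_inv _) hq hq'
  have hcoord : ∀ x : F ⊗[F] B, (d.coord x).map ι = d.W.map ι *
      Φ (Algebra.TensorProduct.map (Algebra.ofId F k) (AlgHom.id F B) x) * d.V.map ι := by
    intro x
    rw [coord, Matrix.map_mul, Matrix.map_mul, ← localSplit_map φ (k := k) ι]
  have e1 : (d.coord ((l : (F ⊗[F] B)ˣ) : F ⊗[F] B)).map ι =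
      (r : k) • (Matrix.diagonal p * d.locCoord ι (g : (k ⊗[F] B)ˣ) (Φ ((b : (k ⊗[F] B)ˣ) : k ⊗[F] B)) *
        Matrix.diagonal q) := by
    rw [hcoord]
    have h1 : Algebra.TensorProduct.map (Algebra.ofId F k) (AlgHom.id F B)
      ((l : (F ⊗[F] B)ˣ) : F ⊗[F] B) = ((l' : (k ⊗[F] B)ˣ) : k ⊗[F] B) := rfl
    rw [h1, hr1, map_smul, Matrix.mul_smul, Matrix.smul_mul]
    simp only [Subgroup.coe_mul, Subgroup.coe_inv, Units.val_mul, map_mul]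
    rw [show Φ ((t : (k ⊗[F] B)ˣ) : k ⊗[F] B) = _ from hp,
      show Φ ((s : (k ⊗[F] B)ˣ) : k ⊗[F] B) = _ from hq]
    congr 1
    exact conj_coord_eq (d.map_mul_map' ι) _ _ _ _ _
  have e2 : (d.coord (((l : (F ⊗[F] B)ˣ)⁻¹ : (F ⊗[F] B)ˣ) : F ⊗[F] B)).map ι =
      ((r⁻¹ : kˣ) : k) • (Matrix.diagonal q' *
        d.locCoord ι (g : (k ⊗[F] B)ˣ) (Φ (((b : (k ⊗[F] B)ˣ)⁻¹ : (k ⊗[F] B)ˣ) : k ⊗[F] B)) *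
        Matrix.diagonal p') := by
    rw [hcoord]
    have h1 : Algebra.TensorProduct.map (Algebra.ofId F k) (AlgHom.id F B)
      (((l : (F ⊗[F] B)ˣ)⁻¹ : (F ⊗[F] B)ˣ) : F ⊗[F] B) =
        (((l' : (k ⊗[F] B)ˣ)⁻¹ : (k ⊗[F] B)ˣ) : k ⊗[F] B) := rfl
    have h2 : ((t * (g * b * g⁻¹) * s : f.units n F B k) : (k ⊗[F] B)ˣ)⁻¹ =
        (s : (k ⊗[F] B)ˣ)⁻¹ * ((g : (k ⊗[F] B)ˣ) * (b : (k ⊗[F] B)ˣ)⁻¹ * (g : (k ⊗[F] B)ˣ)⁻¹) *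
          (t : (k ⊗[F] B)ˣ)⁻¹ := by
      simp only [Subgroup.coe_mul, Subgroup.coe_inv]
      group
    rw [h1, hr2, h2, map_smul, Matrix.mul_smul, Matrix.smul_mul]
    simp only [Units.val_mul, map_mul]
    rw [show Φ (((t : (k ⊗[F] B)ˣ)⁻¹ : (k ⊗[F] B)ˣ) : k ⊗[F] B) = _ from hp',
      show Φ (((s : (k ⊗[F] B)ˣ)⁻¹ : (k ⊗[F] B)ˣ) : k ⊗[F] B) = _ from hq']
    congr 1
    exact conj_coord_eq (d.map_mul_map' ι) _ _ _ _ _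
  have e1' := congrFun (congrFun e1 j) i
  have e2' := congrFun (congrFun e2 i) j
  rw [Matrix.map_apply, Matrix.smul_apply, Matrix.mul_diagonal, Matrix.diagonal_mul] at e1' e2'
  rw [pairing, map_mul, e1', e2', smul_mul_smul_comm, Units.mul_inv, one_smul]
  linear_combination d.locCoord ι (g : (k ⊗[F] B)ˣ) (Φ ((b : (k ⊗[F] B)ˣ) : k ⊗[F] B)) j i *
        d.locCoord ι (g : (k ⊗[F] B)ˣ) (Φ (((b : (k ⊗[F] B)ˣ)⁻¹ : (k ⊗[F] B)ˣ) : k ⊗[F] B)) i j *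
        (q i * q' i * hpp j + hqq i)

end TorusDiag

/-! ### The bound for the invariant at a place -/

section LocalBound

section

variable {F : Type*} [Field F] {B : Type*} [Ring B] [Algebra F B] [FiniteDimensional F B] {n : ℕ}
  {f : Form} {k K : Type*} [Field k] [Algebra F k] [NormedField K] [Algebra k K]

/-- The sum of `|log ‖x‖|` over the eigenvalues `x` in `K` of the adjoint action of `a`. -/
def logSum (K : Type*) [NormedField K] [Algebra k K] (a : GPts f n F B k) : ℝ :=
  ((((GPts.Ad a : _ ≃ₐ[k] _).toLinearMap.charpoly.map (algebraMap k K)).roots).map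
    fun x => |Real.log ‖x‖|).sum

theorem logSum_nonneg (a : GPts f n F B k) : 0 ≤ logSum K a := by
  refine Multiset.sum_nonneg fun y hy => ?_
  obtain ⟨x, _, rfl⟩ := Multiset.mem_map.1 hy
  exact abs_nonneg _

end

variable {F : Type*} [Field F] {B : Type*} [Ring B] [Algebra F B] {n : ℕ}
  {φ : Splitting n F B} {E : Subalgebra F B} (d : TorusDiag φ E) {f : Form}
  {k K : Type*} [Field k] [Algebra F k] [NormedField K]
  [Algebra F K] [Algebra k K] [IsScalarTower F k K] (ι : AlgebraicClosure F →ₐ[F] K)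

/-- The size of an idempotent of the conjugate torus algebra. -/
def TorusDiag.size (g : (k ⊗[F] B)ˣ) (i : Fin n) : ℝ :=
  ‖fun p => d.locV ι g p i‖ * ‖d.locW ι g i‖

theorem TorusDiag.size_nonneg (g : (k ⊗[F] B)ˣ) (i : Fin n) : 0 ≤ d.size ι g i := by
  unfold size
  positivity

variable [FiniteDimensional F B]

theorem logSum_eq (hB : Module.finrank F B = n ^ 2) (hn : n ≠ 0) (a : f.units n F B k)
    {V W : Matrix (Fin n) (Fin n) K} (hVW : V * W = 1) (hWV : W * V = 1) {α β : Fin n → K}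
    (hα : localSplit φ k ι ((a : (k ⊗[F] B)ˣ) : k ⊗[F] B) = V * Matrix.diagonal α * W)
    (hβ : localSplit φ k ι (((a : (k ⊗[F] B)ˣ)⁻¹ : (k ⊗[F] B)ˣ) : k ⊗[F] B) =
      V * Matrix.diagonal β * W) :
    logSum K (QuotientGroup.mk a : GPts f n F B k) =
      ∑ p : Fin n × Fin n, |Real.log ‖α p.1 * β p.2‖| := by
  let T : Matrix (Fin n) (Fin n) K →ₗ[K] Matrix (Fin n) (Fin n) K :=
    (LinearMap.mulRight K (V * Matrix.diagonal β * W)).comp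
      (LinearMap.mulLeft K (V * Matrix.diagonal α * W))
  have h1 := (isSplit_localSplit φ (k := k) ι hB hn).charpoly_eq
    (GPts.Ad (QuotientGroup.mk a : GPts f n F B k) : _ ≃ₐ[k] _).toLinearMap T fun x => by
      change V * Matrix.diagonal α * W * localSplit φ k ι x * (V * Matrix.diagonal β * W) =
        localSplit φ k ι (GPts.Ad (QuotientGroup.mk a : GPts f n F B k) x)
      rw [GPts.Ad_mk_apply, map_mul, map_mul, hα, hβ]
  have h2 := charpoly_conj_diagonal hVW hWV α β T fun Y => rfl
  have h3 : (∏ p : Fin n × Fin n, (Polynomial.X - Polynomial.C (α p.1 * β p.2))).roots =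
      Finset.univ.val.map fun p : Fin n × Fin n => α p.1 * β p.2 := by
    have := Polynomial.roots_multiset_prod_X_sub_C
      (Finset.univ.val.map fun p : Fin n × Fin n => α p.1 * β p.2)
    rwa [Multiset.map_map] at this
  rw [logSum, ← h1, h2, h3, Multiset.map_map]
  rfl

/-- `norm_pairing_le` multiplied over the off-diagonal pairs: the sizes accumulate to the exponent
`2 * (n - 1)`, and the contraction factors to the sum over all eigenvalues of the adjoint action. -/
theorem TorusDiag.norm_invariant_le (hB : Module.finrank F B = n ^ 2) (hn : n ≠ 0)
    (l : f.units n F B F) (g : f.units n F B k) {b a t s : GPts f n F B k}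
    (ht : t ∈ subPts f n (E.baseChange k).toSubmonoid)
    (hs : s ∈ subPts f n (E.baseChange k).toSubmonoid)
    (hl : GPts.map f n (Algebra.ofId F k) (QuotientGroup.mk l) =
      t * (QuotientGroup.mk g * b * (QuotientGroup.mk g)⁻¹) * s)
    {X : Set (GPts f n F B k)} (τ : ℕ) (hb : b ∈ bowenBall a X (-τ) τ)
    (ha : a ∈ subPts f n (conjAlgebra E (QuotientGroup.mk g : GPts f n F B k)).toSubmonoid)
    {R : ℝ} (hR : 0 ≤ R) (hXR : ∀ x : f.units n F B k, QuotientGroup.mk x ∈ X → ∀ p q r s,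
      ‖localSplit φ k ι ((x : (k ⊗[F] B)ˣ) : k ⊗[F] B) p q‖ *
        ‖localSplit φ k ι (((x : (k ⊗[F] B)ˣ)⁻¹ : (k ⊗[F] B)ˣ) : k ⊗[F] B) r s‖ ≤ R)
    {N : F} (hN : algebraMap F (AlgebraicClosure F) N =
      ∏ p : Fin n × Fin n with p.1 ≠ p.2, d.pairing ((l : (F ⊗[F] B)ˣ) : F ⊗[F] B)
        (((l : (F ⊗[F] B)ˣ)⁻¹ : (F ⊗[F] B)ˣ) : F ⊗[F] B) p.1 p.2) :
    ‖algebraMap F K N‖ ≤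
      (pairBound K n * R ^ 2) ^ (Finset.univ.filter fun p : Fin n × Fin n => p.1 ≠ p.2).card *
        (∏ i, d.size ι (g : (k ⊗[F] B)ˣ) i) ^ (2 * (n - 1)) *
          Real.exp (-2 * τ * logSum K a) := by
  obtain ⟨⟨x, hx, hbx⟩, ⟨y, hy, hby⟩⟩ := hb
  obtain ⟨x, rfl⟩ := QuotientGroup.mk_surjective x
  obtain ⟨y, rfl⟩ := QuotientGroup.mk_surjective y
  obtain ⟨a, rfl, ha1, ha2⟩ := exists_mk_of_mem_subPts ha
  obtain ⟨α, hα⟩ := d.exists_diagonal_conj ι g ha1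
  obtain ⟨β, hβ⟩ := d.exists_diagonal_conj ι g ha2
  have hVW := d.locV_mul_locW ι (g : (k ⊗[F] B)ˣ)
  have hWV := d.locW_mul_locV ι (g : (k ⊗[F] B)ˣ)
  set V := d.locV ι (g : (k ⊗[F] B)ˣ) with hV
  set W := d.locW ι (g : (k ⊗[F] B)ˣ) with hW
  have hαβ : ∀ i, α i * β i = 1 := fun i => by
    have h1 : Matrix.diagonal α * Matrix.diagonal β = (1 : Matrix (Fin n) (Fin n) K) := by
      calc Matrix.diagonal α * Matrix.diagonal β = (W * V) * Matrix.diagonal α *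
          (W * V) * Matrix.diagonal β * (W * V) := by rw [hWV, one_mul, mul_one, mul_one]
        _ = W * ((V * Matrix.diagonal α * W) * (V * Matrix.diagonal β * W)) * V := by
            simp only [mul_assoc]
        _ = 1 := by rw [← hα, ← hβ, ← map_mul, Units.mul_inv, map_one, mul_one, hWV]
    have h2 := congrFun (congrFun h1 i) i
    rwa [Matrix.diagonal_mul_diagonal, Matrix.diagonal_apply_eq, Matrix.one_apply_eq] at h2
  -- The parameters `-τ` and `τ` of the Bowen ball give the two opposite conjugates.
  have hb1 : b = QuotientGroup.mk (a ^ τ * x * (a⁻¹) ^ τ) := by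
    rw [← hbx]
    simp
  have hb2 : b = QuotientGroup.mk ((a⁻¹) ^ τ * y * a ^ τ) := by
    rw [← hby]
    simp
  obtain ⟨r, hr1, hr2⟩ := Form.exists_smul_of_mk_eq (hb1.symm.trans hb2)
  have hx1 : ((a ^ τ * x * (a⁻¹) ^ τ : f.units n F B k) : (k ⊗[F] B)ˣ)⁻¹ =
      (a : (k ⊗[F] B)ˣ) ^ τ * (x : (k ⊗[F] B)ˣ)⁻¹ * ((a : (k ⊗[F] B)ˣ)⁻¹) ^ τ := by
    simp [mul_assoc]
  have hy1 : (((a⁻¹) ^ τ * y * a ^ τ : f.units n F B k) : (k ⊗[F] B)ˣ)⁻¹ =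
      ((a : (k ⊗[F] B)ˣ)⁻¹) ^ τ * (y : (k ⊗[F] B)ˣ)⁻¹ * (a : (k ⊗[F] B)ˣ) ^ τ := by
    simp [mul_assoc]
  have hpair : ∀ i j, ‖ι (d.pairing ((l : (F ⊗[F] B)ˣ) : F ⊗[F] B)
      (((l : (F ⊗[F] B)ˣ)⁻¹ : (F ⊗[F] B)ˣ) : F ⊗[F] B) i j)‖ ≤
      pairBound K n * R ^ 2 * (d.size ι (g : (k ⊗[F] B)ˣ) i * d.size ι (g : (k ⊗[F] B)ˣ) j) *
        Real.exp (-2 * τ * |Real.log ‖α i * β j‖|) := by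
    intro i j
    rw [d.map_pairing_eq ι l g (a ^ τ * x * (a⁻¹) ^ τ) ht hs (hb1 ▸ hl), hx1]
    rw [hx1, hy1] at hr2
    replace hr1 := congrArg (localSplit φ k ι) hr1
    replace hr2 := congrArg (localSplit φ k ι) hr2
    simp only [Subgroup.coe_mul, Subgroup.coe_pow, Subgroup.coe_inv, Units.val_mul,
      Units.val_pow_eq_pow_val, map_mul, map_pow, map_smul, hα, hβ] at hr1 hr2 ⊢
    rw [← algebraMap_smul K] at hr1 hr2
    exact norm_pairing_le hVW hWV (by rw [← map_mul, Units.mul_inv, map_one]) hαβ τ hr1 hr2 hR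
      (hXR x hx) (hXR y hy) i j
  have h1 : ‖algebraMap F K N‖ = ∏ p : Fin n × Fin n with p.1 ≠ p.2,
      ‖ι (d.pairing ((l : (F ⊗[F] B)ˣ) : F ⊗[F] B)
        (((l : (F ⊗[F] B)ˣ)⁻¹ : (F ⊗[F] B)ˣ) : F ⊗[F] B) p.1 p.2)‖ := by
    rw [← ι.commutes, hN, map_prod, norm_prod]
  rw [h1, logSum_eq ι hB hn a hVW hWV hα hβ]
  refine prod_offDiag_le (e := fun i j => |Real.log ‖α i * β j‖|) (fun i j => norm_nonneg _)
    (fun i => ?_) hpair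
  simp [hαβ]

end LocalBound

/-! ### Bounds on pre-compact sets of points -/

section Precompact

variable {F : Type*} [Field F] {B : Type*} [Ring B] [Algebra F B] {n : ℕ} {f : Form}
  {k K : Type*} [NormedField k] [Algebra F k] [NormedField K] [Algebra k K]

/-- On a pre-compact set the adjoint action is bounded. -/
theorem exists_bound_of_isPrecompact (hK : ∀ x : k, ‖algebraMap k K x‖ = ‖x‖)
    (Φ : k ⊗[F] B →ₐ[k] Matrix (Fin n) (Fin n) K) {X : Set (GPts f n F B k)}
    (hX : IsPrecompact X) : ∃ R : ℝ, 0 ≤ R ∧ ∀ x : f.units n F B k, QuotientGroup.mk x ∈ X →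
      ∀ p q r s, ‖Φ ((x : (k ⊗[F] B)ˣ) : k ⊗[F] B) p q‖ *
        ‖Φ (((x : (k ⊗[F] B)ˣ)⁻¹ : (k ⊗[F] B)ˣ) : k ⊗[F] B) r s‖ ≤ R := by
  let _ : TopologicalSpace (k ⊗[F] B) := moduleTopology k (k ⊗[F] B)
  have : IsModuleTopology k (k ⊗[F] B) := ⟨rfl⟩
  have hX' : IsCompact (closure X) := hX
  let _ : NormedSpace k K :=
    { (inferInstance : Module k K) with
      norm_smul_le := fun a b => by rw [Algebra.smul_def, norm_mul, hK] }
  have hcont : ∀ p q, Continuous fun x : k ⊗[F] B => Φ x p q := fun p q =>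
    IsModuleTopology.continuous_of_linearMap
      ((Matrix.entryLinearMap k K p q).comp Φ.toLinearMap)
  let ψ : f.units n F B k → (Fin n × Fin n) × (Fin n × Fin n) → ℝ := fun x p =>
    ‖Φ ((x : (k ⊗[F] B)ˣ) : k ⊗[F] B) p.1.1 p.1.2‖ *
      ‖Φ (((x : (k ⊗[F] B)ˣ)⁻¹ : (k ⊗[F] B)ˣ) : k ⊗[F] B) p.2.1 p.2.2‖
  have hψ : Continuous ψ := by
    refine continuous_pi fun p => Continuous.mul ?_ ?_
    · exact ((hcont _ _).comp (Units.continuous_val.comp continuous_subtype_val)).norm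
    · exact ((hcont _ _).comp (Units.continuous_coe_inv.comp continuous_subtype_val)).norm
  -- An entry of `x` times an entry of `x⁻¹` has a norm unaffected by scalars, hence gives a
  -- continuous function on the quotient, bounded on the compact closure.
  let ψ' : GPts f n F B k → (Fin n × Fin n) × (Fin n × Fin n) → ℝ :=
    Quotient.lift ψ fun x y hxy => by
      obtain ⟨r, h1, h2⟩ := Form.exists_smul_of_mk_eq (Quotient.sound hxy)
      ext p
      have hr : ‖algebraMap k K r‖ * ‖algebraMap k K ((r⁻¹ : kˣ) : k)‖ = 1 := by
        rw [← norm_mul, ← map_mul, Units.mul_inv, map_one, norm_one]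
      simp only [ψ]
      rw [h1, h2, map_smul, map_smul, Matrix.smul_apply, Matrix.smul_apply, Algebra.smul_def,
        Algebra.smul_def, norm_mul, norm_mul, mul_mul_mul_comm, hr, one_mul]
  have hψ' : Continuous ψ' := hψ.quotient_lift _
  obtain ⟨R, hR⟩ := (hX'.image hψ').isBounded.exists_norm_le
  -- If `X` is empty, `R` may be negative.
  refine ⟨max R 0, le_max_right _ _, fun x hx p q r s => ?_⟩
  have h1 := hR (ψ x) ⟨QuotientGroup.mk x, subset_closure hx, rfl⟩
  have h2 := (norm_le_pi_norm (ψ x) ((p, q), (r, s))).trans h1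
  exact ((le_abs_self _).trans h2).trans (le_max_left _ _)

end Precompact

/-! ### Finite places -/

section FinitePlaces

variable {F : Type*} [Field F] [NumberField F]

section

variable (v : HeightOneSpectrum (𝓞 F))

instance : CompleteSpace (Place.finite v).Completion :=
  inferInstanceAs (CompleteSpace (v.adicCompletion F))

instance : IsUltrametricDist (Place.finite v).Completion :=
  inferInstanceAs (IsUltrametricDist (v.adicCompletion F))

theorem mem_adicCompletionIntegers_iff_norm {x : v.adicCompletion F} :
    x ∈ v.adicCompletionIntegers F ↔ ‖x‖ ≤ 1 := by
  rw [HeightOneSpectrum.mem_adicCompletionIntegers, FinitePlace.norm_def, ← NNReal.coe_one,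
    NNReal.coe_le_coe, ← map_one (WithZeroMulInt.toNNReal (HeightOneSpectrum.absNorm_ne_zero v)),
    (WithZeroMulInt.toNNReal_strictMono (HeightOneSpectrum.one_lt_absNorm_nnreal v)).le_iff_le]

theorem mem_localIntegers_iff {x : (Place.finite v).Completion} :
    x ∈ localIntegers v ↔ ‖x‖ ≤ 1 :=
  mem_adicCompletionIntegers_iff_norm v

/-- The normed field structure of the completion at a finite place, with the fact that its norm is
nontrivial. -/
@[reducible] def nontriviallyNormedFieldFinite :
    NontriviallyNormedField (Place.finite v).Completion where
  non_trivial := by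
    obtain ⟨x, hx, hx0⟩ := v.asIdeal.exists_mem_ne_zero_of_ne_bot v.ne_bot
    have h1 : ‖algebraMap F (Place.finite v).Completion (x : F)‖ < 1 :=
      (FinitePlace.norm_lt_one_iff_mem F v x).2 hx
    have h2 : algebraMap F (Place.finite v).Completion (x : F) ≠ 0 := by
      rw [map_ne_zero]
      exact_mod_cast hx0
    refine ⟨(algebraMap F (Place.finite v).Completion (x : F))⁻¹, ?_⟩
    rw [norm_inv]
    exact (one_lt_inv₀ (norm_pos_iff.2 h2)).2 h1

/-- The algebraic closure of the completion at a finite place, with the spectral norm. -/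
instance closureNormedField : NormedField (AlgebraicClosure (Place.finite v).Completion) :=
  let _ := nontriviallyNormedFieldFinite v
  spectralNorm.normedField (Place.finite v).Completion
    (AlgebraicClosure (Place.finite v).Completion)

theorem norm_algebraMap_closure (x : (Place.finite v).Completion) :
    ‖algebraMap (Place.finite v).Completion (AlgebraicClosure (Place.finite v).Completion) x‖ =
      ‖x‖ :=
  spectralNorm_extends x

theorem isNonarchimedean_closure :
    IsNonarchimedean (norm : AlgebraicClosure (Place.finite v).Completion → ℝ) :=
  isNonarchimedean_spectralNorm

theorem closureAbs_finite (x : AlgebraicClosure (Place.finite v).Completion) :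
    (Place.finite v).closureAbs x = ‖x‖ := by
  let _ := nontriviallyNormedFieldFinite v
  exact (spectralNorm.spectralNorm_eq_norm_coeff_zero_rpow _ _ x).symm

end

theorem eventually_norm_eq_one {x : F} (hx : x ≠ 0) :
    ∀ᶠ v : HeightOneSpectrum (𝓞 F) in Filter.cofinite,
      ‖algebraMap F (Place.finite v).Completion x‖ = 1 := by
  have h := FinitePlace.hasFiniteMulSupport hx
  have h2 := h.preimage (f := FinitePlace.mk) fun v _ w _ hvw => FinitePlace.mk_eq_iff.1 hvw
  exact h2

theorem eventually_norm_le_one (x : F) :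
    ∀ᶠ v : HeightOneSpectrum (𝓞 F) in Filter.cofinite,
      ‖algebraMap F (Place.finite v).Completion x‖ ≤ 1 := by
  rcases eq_or_ne x 0 with rfl | hx
  · exact Filter.Eventually.of_forall fun v => by simp
  · filter_upwards [eventually_norm_eq_one hx] with v hv using hv.le

theorem prod_nabs_eq_one {x : F} (hx : x ≠ 0) :
    (∏ w : InfinitePlace F,
      (Place.infinite w).nabs (algebraMap F (Place.infinite w).Completion x)) *
      ∏ᶠ v : HeightOneSpectrum (𝓞 F), ‖algebraMap F (Place.finite v).Completion x‖ = 1 := by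
  rw [← prod_abs_eq_one hx]
  congr 1
  · refine Finset.prod_congr rfl fun w _ => ?_
    change ‖(x : w.Completion)‖ ^ w.mult = _
    rw [InfinitePlace.Completion.norm_coe]
    rfl
  · rw [← finprod_comp_equiv FinitePlace.equivHeightOneSpectrum.symm]
    rfl

/-- If `‖x‖ > 1`, the leading term strictly dominates the others. -/
theorem norm_le_one_of_isRoot {K : Type*} [NormedField K] (hK : IsNonarchimedean (norm : K → ℝ))
    {p : Polynomial K} (hp : p.Monic) (hc : ∀ i, ‖p.coeff i‖ ≤ 1) {x : K} (hx : p.IsRoot x) :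
    ‖x‖ ≤ 1 := by
  by_contra! hlt
  have : IsUltrametricDist K := IsUltrametricDist.isUltrametricDist_of_isNonarchimedean_norm hK
  rw [Polynomial.IsRoot.def, Polynomial.eval_eq_sum_range, Finset.sum_range_succ,
    hp.coeff_natDegree, one_mul] at hx
  have h1 : ‖∑ i ∈ Finset.range p.natDegree, p.coeff i * x ^ i‖ < ‖x ^ p.natDegree‖ := by
    rcases Nat.eq_zero_or_pos p.natDegree with h0 | h0
    · simp [h0]
    · have hle : ‖∑ i ∈ Finset.range p.natDegree, p.coeff i * x ^ i‖ ≤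
          ‖x‖ ^ (p.natDegree - 1) := by
        refine IsUltrametricDist.norm_sum_le_of_forall_le_of_nonneg (by positivity) fun i hi => ?_
        rw [norm_mul, norm_pow]
        refine (mul_le_of_le_one_left (by positivity) (hc i)).trans ?_
        exact pow_le_pow_right₀ hlt.le (by have := Finset.mem_range.1 hi; omega)
      rw [norm_pow]
      exact hle.trans_lt (pow_lt_pow_right₀ hlt (by omega))
  rw [eq_neg_of_add_eq_zero_left hx, norm_neg] at h1
  exact lt_irrefl _ h1

/-- An algebraic number is integral at almost all places. -/
theorem eventually_norm_embedding_le_one (x : AlgebraicClosure F) :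
    ∀ᶠ v : HeightOneSpectrum (𝓞 F) in Filter.cofinite,
      ∀ ι : AlgebraicClosure F →ₐ[F] AlgebraicClosure (Place.finite v).Completion, ‖ι x‖ ≤ 1 := by
  have h1 : ∀ᶠ v : HeightOneSpectrum (𝓞 F) in Filter.cofinite,
      ∀ i ∈ (minpoly F x).support,
        ‖algebraMap F (Place.finite v).Completion ((minpoly F x).coeff i)‖ ≤ 1 :=
    (Filter.eventually_all_finset _).2 fun i _ => eventually_norm_le_one _
  filter_upwards [h1] with v hv ι
  have hint : IsIntegral F x := Algebra.IsIntegral.isIntegral x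
  refine norm_le_one_of_isRoot (isNonarchimedean_closure v)
    (p := (minpoly F x).map (algebraMap F (AlgebraicClosure (Place.finite v).Completion)))
    ((minpoly.monic hint).map _) (fun i => ?_) ?_
  · rw [Polynomial.coeff_map]
    by_cases hi : i ∈ (minpoly F x).support
    · rw [IsScalarTower.algebraMap_apply F (Place.finite v).Completion, norm_algebraMap_closure]
      exact hv i hi
    · rw [Polynomial.notMem_support_iff.1 hi, map_zero, norm_zero]
      exact zero_le_one
  · rw [Polynomial.IsRoot.def, Polynomial.eval_map_algebraMap, Polynomial.aeval_algHom_apply,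
      minpoly.aeval, map_zero]

end FinitePlaces

/-! ### Discriminants at the finite places -/

section Discriminant

variable {F : Type*} [Field F] {B : Type*} [Ring B] [Algebra F B] [FiniteDimensional F B] {n : ℕ}
  {φ : Splitting n F B} {k K : Type*} [Field k] [Algebra F k] [Field K] [CharZero K]
  [Algebra F K] [Algebra k K] [IsScalarTower F k K] (ι : AlgebraicClosure F →ₐ[F] K)

/-- In the common eigenbasis the trace of a product is the dot product of two rows of eigenvalues,
so the trace matrix becomes `P * Pᵀ`. -/
theorem algebraMap_det_traceMatrix (hB : Module.finrank F B = n ^ 2) (hn : n ≠ 0)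
    {V W : Matrix (Fin n) (Fin n) K} (hWV : W * V = 1) {x : Fin n → k ⊗[F] B}
    {P : Matrix (Fin n) (Fin n) K}
    (hP : ∀ i, localSplit φ k ι (x i) = V * Matrix.diagonal (P i) * W) :
    algebraMap k K (traceMatrix k x).det = P.det ^ 2 := by
  have h1 : (algebraMap k K).mapMatrix (traceMatrix k x) = P * P.transpose := by
    ext i j
    rw [RingHom.mapMatrix_apply, Matrix.map_apply, traceMatrix, Matrix.of_apply,
      (isSplit_localSplit φ (k := k) ι hB hn).algebraMap_reducedTrace hn, map_mul, hP, hP,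
      show V * Matrix.diagonal (P i) * W * (V * Matrix.diagonal (P j) * W) =
        V * (Matrix.diagonal (P i) * (W * V) * Matrix.diagonal (P j) * W) by simp only [mul_assoc],
      hWV, Matrix.trace_mul_comm, mul_assoc, hWV, mul_one, mul_one, Matrix.diagonal_mul_diagonal,
      Matrix.trace_diagonal, Matrix.mul_apply]
    rfl
  rw [RingHom.map_det, h1, Matrix.det_mul, Matrix.det_transpose, pow_two]

theorem finrank_conjAlgebra {f : Form} {E : Subalgebra F B} (hE : IsTorusAlgebra n E)
    (g : GPts f n F B k) : Module.finrank k (conjAlgebra E g) = n := by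
  let e : (E.baseChange k) ≃ₐ[k] conjAlgebra E g :=
    Subalgebra.equivMapOfInjective (E.baseChange k) (GPts.Ad g⁻¹ : _ ≃ₐ[k] _).toAlgHom
      (GPts.Ad g⁻¹ : (k ⊗[F] B) ≃ₐ[k] _).injective
  rw [← e.toLinearEquiv.finrank_eq]
  let e' : (k ⊗[F] E) ≃ₐ[k] (E.baseChange k) := AlgEquiv.ofInjective
    (Algebra.TensorProduct.map (AlgHom.id k k) E.val)
    (Module.Flat.lTensor_preserves_injective_linearMap E.val.toLinearMap Subtype.val_injective)
  rw [← e'.toLinearEquiv.finrank_eq, Module.finrank_baseChange, hE.degree]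

end Discriminant

/-! ### Local orders, their bases and their matrices -/

section LocalOrders

variable {F : Type*} [Field F] [NumberField F] {B : Type*} [Ring B] [Algebra F B]
  (v : HeightOneSpectrum (𝓞 F))

instance : IsPrincipalIdealRing (localIntegers v) :=
  inferInstanceAs (IsPrincipalIdealRing (v.adicCompletionIntegers F))

instance : IsFractionRing (localIntegers v) (Place.finite v).Completion :=
  inferInstanceAs (IsFractionRing (v.adicCompletionIntegers F) (v.adicCompletion F))

/-- A finitely generated torsion-free module over a principal ideal domain is free, and its rank is
the dimension of its span. It ensures that `finiteDisc` is not given by its default value. -/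
theorem nonempty_basis_of_isOrderIn {A : Type*} [Ring A] [Algebra (Place.finite v).Completion A]
    [Algebra (localIntegers v) A] [IsScalarTower (localIntegers v) (Place.finite v).Completion A]
    {n : ℕ} {C : Subalgebra (Place.finite v).Completion A}
    (hC : Module.finrank (Place.finite v).Completion C = n) {R : Subalgebra (localIntegers v) A}
    (hR : IsOrderIn C R) : Nonempty (Module.Basis (Fin n) (localIntegers v) R) := by
  have : Module.Finite (localIntegers v) R := Module.Finite.iff_fg.2 hR.fg
  have : Module.IsTorsionFree (localIntegers v) A :=
    Module.IsTorsionFree.trans_faithfulSMul (localIntegers v) (Place.finite v).Completion A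
  have : Module.IsTorsionFree (localIntegers v) R :=
    Subtype.val_injective.moduleIsTorsionFree _ fun _ _ => rfl
  let b := Module.finBasis (localIntegers v) R
  have hli : LinearIndependent (localIntegers v) fun i => (b i : A) :=
    b.linearIndependent.map' R.val.toLinearMap (LinearMap.ker_eq_bot.2 Subtype.val_injective)
  have hli' : LinearIndependent (Place.finite v).Completion fun i => (b i : A) :=
    (LinearIndependent.iff_fractionRing (localIntegers v) _).1 hli
  have hspan : Submodule.span (Place.finite v).Completion (Set.range fun i => (b i : A)) =
      Subalgebra.toSubmodule C := by
    rw [← hR.span]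
    refine le_antisymm (Submodule.span_mono ?_) (Submodule.span_le.2 fun x hx => ?_)
    · rintro _ ⟨i, rfl⟩
      exact (b i).2
    · have h1 : x = ∑ i, b.repr ⟨x, hx⟩ i • (b i : A) := by
        have := congrArg R.val (b.sum_repr ⟨x, hx⟩)
        rw [map_sum] at this
        exact this.symm
      rw [SetLike.mem_coe, h1]
      refine Submodule.sum_mem _ fun i _ => ?_
      rw [← algebraMap_smul (Place.finite v).Completion]
      exact Submodule.smul_mem _ _ (Submodule.subset_span ⟨i, rfl⟩)
  have hm : Module.finrank (localIntegers v) R = n := by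
    have h1 := finrank_span_eq_card hli'
    rw [hspan, Fintype.card_fin] at h1
    exact h1.symm.trans hC
  exact ⟨b.reindex (finCongr hm)⟩

theorem localOrder_eq_span (Ω : Subalgebra (𝓞 F) B) :
    Subalgebra.toSubmodule (localOrder Ω v) = Submodule.span (localIntegers v)
      ((fun b : B => (1 : (Place.finite v).Completion) ⊗ₜ[F] b) '' Ω) := by
  have h : (Submonoid.closure ((fun b : B => (1 : (Place.finite v).Completion) ⊗ₜ[F] b) '' Ω) :
      Set ((Place.finite v).Completion ⊗[F] B)) =
      (fun b : B => (1 : (Place.finite v).Completion) ⊗ₜ[F] b) '' Ω := by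
    let M : Submonoid ((Place.finite v).Completion ⊗[F] B) := Ω.toSubmonoid.map
      (Algebra.TensorProduct.includeRight : B →ₐ[F] (Place.finite v).Completion ⊗[F] B)
    exact congrArg SetLike.coe (Submonoid.closure_eq M)
  rw [localOrder, Algebra.adjoin_eq_span, h]

/-- An element of `B` is an `F`-combination of elements of `Ω`, and its finitely many coefficients
are integral at almost all places. -/
theorem tmul_mem_localOrder {Ω : Subalgebra (𝓞 F) B} (hΩ : IsOrderIn (⊤ : Subalgebra F B) Ω)
    (b : B) : ∀ᶠ v : HeightOneSpectrum (𝓞 F) in Filter.cofinite,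
      (1 : (Place.finite v).Completion) ⊗ₜ[F] b ∈ localOrder Ω v := by
  have hb : b ∈ Submodule.span F (Ω : Set B) := by
    rw [hΩ.span]
    trivial
  induction hb using Submodule.span_induction with
  | mem x hx => exact Filter.Eventually.of_forall fun v => Algebra.subset_adjoin ⟨x, hx, rfl⟩
  | zero =>
    refine Filter.Eventually.of_forall fun v => ?_
    rw [TensorProduct.tmul_zero]
    exact zero_mem _
  | add x y _ _ hx hy =>
    filter_upwards [hx, hy] with v h1 h2
    rw [TensorProduct.tmul_add]
    exact add_mem h1 h2
  | smul c x _ hx =>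
    filter_upwards [hx, eventually_norm_le_one c] with v h1 h2
    have h3 : (1 : (Place.finite v).Completion) ⊗ₜ[F] (c • x) =
        (⟨algebraMap F _ c, (mem_localIntegers_iff v).2 h2⟩ : localIntegers v) •
          ((1 : (Place.finite v).Completion) ⊗ₜ[F] x) := by
      rw [TensorProduct.tmul_smul, TensorProduct.smul_tmul', TensorProduct.smul_tmul']
      congr 1
      rw [Algebra.smul_def]
      rfl
    rw [h3]
    exact Subalgebra.smul_mem _ h1 _

variable {n : ℕ} (φ : Splitting n F B)
  (ι : ∀ v : HeightOneSpectrum (𝓞 F),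
    AlgebraicClosure F →ₐ[F] AlgebraicClosure (Place.finite v).Completion)

/-- The matrices of the elements of the local orders are bounded, and integral at almost all
places. -/
theorem exists_orderBound {Ω : Subalgebra (𝓞 F) B} (hΩ : IsOrderIn (⊤ : Subalgebra F B) Ω) :
    ∃ c : HeightOneSpectrum (𝓞 F) → ℝ, (∀ v, 1 ≤ c v) ∧ (∀ᶠ v in Filter.cofinite, c v = 1) ∧
      ∀ v, ∀ x ∈ localOrder Ω v, ∀ p q,
        ‖localSplit φ (Place.finite v).Completion (ι v) x p q‖ ≤ c v := by
  -- Finitely many generators suffice: the ultrametric inequality extends a bound for them to all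
  -- integral combinations.
  obtain ⟨s, hs⟩ := hΩ.fg
  let y : ∀ v : HeightOneSpectrum (𝓞 F),
      s × Fin n × Fin n → AlgebraicClosure (Place.finite v).Completion :=
    fun v i => ι v (φ (1 ⊗ₜ (i.1 : B)) i.2.1 i.2.2)
  refine ⟨fun v => max 1 ‖y v‖, fun v => le_max_left _ _, ?_, ?_⟩
  · have h1 : ∀ᶠ v : HeightOneSpectrum (𝓞 F) in Filter.cofinite, ∀ i, ‖y v i‖ ≤ 1 := by
      rw [Filter.eventually_all]
      intro i
      filter_upwards [eventually_norm_embedding_le_one (φ (1 ⊗ₜ (i.1 : B)) i.2.1 i.2.2)] with v hv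
      exact hv (ι v)
    filter_upwards [h1] with v hv
    exact max_eq_left ((pi_norm_le_iff_of_nonneg zero_le_one).2 hv)
  · intro v x hx
    have hc0 : 0 ≤ max 1 ‖y v‖ := zero_le_one.trans (le_max_left _ _)
    have hadd : ∀ x y' : (Place.finite v).Completion ⊗[F] B,
        (∀ p q, ‖localSplit φ (Place.finite v).Completion (ι v) x p q‖ ≤ max 1 ‖y v‖) →
        (∀ p q, ‖localSplit φ (Place.finite v).Completion (ι v) y' p q‖ ≤ max 1 ‖y v‖) →
        ∀ p q, ‖localSplit φ (Place.finite v).Completion (ι v) (x + y') p q‖ ≤ max 1 ‖y v‖ := by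
      intro x y' hx hy p q
      rw [map_add, Matrix.add_apply]
      exact (isNonarchimedean_closure v _ _).trans (max_le (hx p q) (hy p q))
    have hsmul : ∀ (c : (Place.finite v).Completion) (x : (Place.finite v).Completion ⊗[F] B),
        ‖c‖ ≤ 1 →
        (∀ p q, ‖localSplit φ (Place.finite v).Completion (ι v) x p q‖ ≤ max 1 ‖y v‖) →
        ∀ p q, ‖localSplit φ (Place.finite v).Completion (ι v) (c • x) p q‖ ≤ max 1 ‖y v‖ := by
      intro c x hc hx p q
      rw [map_smul, Matrix.smul_apply, Algebra.smul_def, norm_mul, norm_algebraMap_closure]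
      exact (mul_le_of_le_one_left (norm_nonneg _) hc).trans (hx p q)
    have hzero : ∀ p q, ‖localSplit φ (Place.finite v).Completion (ι v) 0 p q‖ ≤ max 1 ‖y v‖ := by
      intro p q
      rw [map_zero, Matrix.zero_apply, norm_zero]
      exact hc0
    have hΩ' : ∀ b ∈ Ω, ∀ p q,
        ‖localSplit φ (Place.finite v).Completion (ι v) (1 ⊗ₜ b) p q‖ ≤ max 1 ‖y v‖ := by
      intro b hb
      have hb' : b ∈ Submodule.span (𝓞 F) (s : Set B) := by rw [hs]; exact hb
      clear hb
      induction hb' using Submodule.span_induction with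
      | mem b hb =>
        intro p q
        rw [localSplit_tmul, one_smul, Matrix.map_apply]
        exact (norm_le_pi_norm (y v) (⟨b, hb⟩, p, q)).trans (le_max_right _ _)
      | zero =>
        rw [TensorProduct.tmul_zero]
        exact hzero
      | add b b' _ _ hx hy =>
        rw [TensorProduct.tmul_add]
        exact hadd _ _ hx hy
      | smul c b _ hx =>
        have h3 : (1 : (Place.finite v).Completion) ⊗ₜ[F] (c • b) =
            (algebraMap F (Place.finite v).Completion (c : F)) •
              ((1 : (Place.finite v).Completion) ⊗ₜ[F] b) := by
          rw [← IsScalarTower.algebraMap_smul F c b, TensorProduct.tmul_smul,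
            TensorProduct.smul_tmul', TensorProduct.smul_tmul', Algebra.smul_def]
          rfl
        rw [h3]
        exact hsmul _ _ (FinitePlace.norm_le_one F v c) hx
    have hx' : x ∈ Subalgebra.toSubmodule (localOrder Ω v) := hx
    rw [localOrder_eq_span] at hx'
    clear hx
    induction hx' using Submodule.span_induction with
    | mem x hx =>
      obtain ⟨b, hb, rfl⟩ := hx
      exact hΩ' b hb
    | zero => exact hzero
    | add x y' _ _ hx hy => exact hadd _ _ hx hy
    | smul c x _ hx => exact hsmul _ _ ((mem_localIntegers_iff v).1 c.2) hx

end LocalOrders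

/-! ### Local discriminants and sizes of idempotents -/

section FiniteDisc

variable {F : Type*} [Field F] [NumberField F] {B : Type*} [Ring B] [Algebra F B]
  {n : ℕ} {φ : Splitting n F B} {E : Subalgebra F B} (d : TorusDiag φ E)
  {f : Form} {Ω : Subalgebra (𝓞 F) B} {g : ∀ u : Place F, GPts f n F B u.Completion}
  {v : HeightOneSpectrum (𝓞 F)}
  (ι : AlgebraicClosure F →ₐ[F] AlgebraicClosure (Place.finite v).Completion)

theorem finiteDisc_eq (h : Nonempty (Module.Basis (Fin n) (localIntegers v) (toralOrder Ω E g v))) :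
    finiteDisc Ω E g v = ‖(traceMatrix (Place.finite v).Completion
      fun i => (h.some i : (Place.finite v).Completion ⊗[F] B)).det‖⁻¹ :=
  dif_pos h

theorem norm_sq_eq_norm_traceMatrix [FiniteDimensional F B] (hB : Module.finrank F B = n ^ 2) (hn : n ≠ 0)
    {V W P : Matrix (Fin n) (Fin n) (AlgebraicClosure (Place.finite v).Completion)}
    (hWV : W * V = 1) {x : Fin n → (Place.finite v).Completion ⊗[F] B}
    (hP : ∀ i, localSplit φ (Place.finite v).Completion ι (x i) =
      V * Matrix.diagonal (P i) * W) :
    ‖(traceMatrix (Place.finite v).Completion x).det‖ = ‖P.det‖ ^ 2 := by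
  have : CharZero (AlgebraicClosure (Place.finite v).Completion) :=
    charZero_of_injective_algebraMap (algebraMap F _).injective
  rw [← norm_algebraMap_closure, algebraMap_det_traceMatrix ι hB hn hWV hP, norm_pow]

theorem linearIndependent_basis_coe
    (b : Module.Basis (Fin n) (localIntegers v) (toralOrder Ω E g v)) :
    LinearIndependent (Place.finite v).Completion
      fun i => (b i : (Place.finite v).Completion ⊗[F] B) :=
  (LinearIndependent.iff_fractionRing (localIntegers v) _).1
    (b.linearIndependent.map' (toralOrder Ω E g v).val.toLinearMap
      (LinearMap.ker_eq_bot.2 Subtype.val_injective))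

/-- An integral basis with eigenvalue matrix `P` has discriminant `‖det P‖⁻²`. Since its matrices
are bounded by `c`, the entries of the trace matrix are bounded by `c ^ 2`, which gives the lower
bound; `norm_det_sq_mul_prod_le` gives the bound for the sizes. -/
theorem finiteDisc_bounds [FiniteDimensional F B] (hB : Module.finrank F B = n ^ 2) (hn : n ≠ 0)
    (hE : IsTorusAlgebra n E) {c : ℝ} (hc1 : 1 ≤ c)
    (hc : ∀ x ∈ localOrder Ω v, ∀ p q,
      ‖localSplit φ (Place.finite v).Completion ι x p q‖ ≤ c)
    (g' : f.units n F B (Place.finite v).Completion)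
    (hg : QuotientGroup.mk g' = g (.finite v))
    (hmax : IsOrderIn (localAlgebra E g (.finite v)) (toralOrder Ω E g v)) :
    0 < finiteDisc Ω E g v ∧ 1 ≤ c ^ (2 * n) * finiteDisc Ω E g v ∧
      ∏ i, d.size ι (g' : ((Place.finite v).Completion ⊗[F] B)ˣ) i ≤
        c ^ (2 * n) * finiteDisc Ω E g v := by
  have hK := isNonarchimedean_closure v
  have hne := nonempty_basis_of_isOrderIn v (finrank_conjAlgebra hE (g (.finite v))) hmax
  rw [finiteDisc_eq hne]
  set b := hne.some with hb
  have hx : ∀ i, (b i : (Place.finite v).Completion ⊗[F] B) ∈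
      conjAlgebra E (QuotientGroup.mk g' : GPts f n F B (Place.finite v).Completion) := fun i => by
    rw [hg]
    exact (b i).2.1
  have hxΩ : ∀ i, (b i : (Place.finite v).Completion ⊗[F] B) ∈ localOrder Ω v := fun i =>
    (b i).2.2
  choose P hP using fun i => d.exists_diagonal_conj ι g' (hx i)
  have hdet := norm_sq_eq_norm_traceMatrix ι hB hn (P := Matrix.of P) (d.locW_mul_locV ι _) hP
  have hli := (isSplit_localSplit φ (k := (Place.finite v).Completion) ι hB
    hn).linearIndependent (linearIndependent_basis_coe b)
  simp only [hP] at hli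
  have hP0 : (Matrix.of P).det ≠ 0 := det_ne_zero_of_linearIndependent hli
  have hpos : 0 < ‖(Matrix.of P).det‖ ^ 2 := by positivity
  rw [hdet]
  refine ⟨inv_pos.2 hpos, ?_, ?_⟩
  · rw [← div_eq_mul_inv, one_le_div hpos, ← norm_pow, pow_two, ← Matrix.det_transpose]
    nth_rewrite 1 [Matrix.det_transpose]
    rw [← Matrix.det_mul, pow_mul]
    refine (norm_det_le (r := c ^ 2) (by positivity) fun i j => ?_).trans_eq
      (by rw [sumBound_eq_one hK, one_mul])
    have h1 : (Matrix.of P * (Matrix.of P).transpose) i j =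
        (localSplit φ (Place.finite v).Completion ι (b i) *
          localSplit φ (Place.finite v).Completion ι (b j)).trace := by
      rw [hP, hP, show ∀ V W D D' : Matrix (Fin n) (Fin n)
        (AlgebraicClosure (Place.finite v).Completion), V * D * W * (V * D' * W) =
          V * (D * (W * V) * D' * W) from fun _ _ _ _ => by simp only [mul_assoc],
        d.locW_mul_locV, Matrix.trace_mul_comm, mul_assoc, d.locW_mul_locV, mul_one, mul_one,
        Matrix.diagonal_mul_diagonal, Matrix.trace_diagonal, Matrix.mul_apply]
      rfl
    rw [h1, Matrix.trace]
    refine (norm_sum_le_sumBound (r := c ^ 2) _ _ (by positivity) fun p _ => ?_).trans_eq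
      (by rw [sumBound_eq_one hK, one_mul])
    rw [Matrix.diag_apply]
    refine (norm_mul_apply_le (r := c) (s := c) (by positivity) (by positivity)
      (fun q => hc _ (hxΩ i) p q) fun q => hc _ (hxΩ j) q p).trans_eq ?_
    rw [sumBound_eq_one hK, one_mul, pow_two]
  · have h1 := norm_det_sq_mul_prod_le (d.locV_mul_locW ι (g' :
      ((Place.finite v).Completion ⊗[F] B)ˣ)) (Matrix.of P) (c := c) (by positivity)
      fun i p q => by
        have := hc _ (hxΩ i) p q
        rw [hP] at this
        exact this
    rw [volBound_eq_one hK, one_mul, ← pow_mul, mul_comm n 2] at h1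
    rw [← div_eq_mul_inv, le_div_iff₀ hpos, mul_comm]
    exact h1

/-- The discriminant of the torus algebra is trivial at almost all places. -/
theorem eventually_finiteDisc_eq_one [FiniteDimensional F B] {φ : Splitting n F B}
    (d : TorusDiag φ E) (hB : Module.finrank F B = n ^ 2) (hn : n ≠ 0)
    (hE : IsTorusAlgebra n E) (hΩ : IsOrderIn (⊤ : Subalgebra F B) Ω) (hg : g ∈ adelicPts f n Ω)
    (hmax : IsMaximalType Ω E g) (ι : ∀ v : HeightOneSpectrum (𝓞 F),
      AlgebraicClosure F →ₐ[F] AlgebraicClosure (Place.finite v).Completion) :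
    ∀ᶠ v in Filter.cofinite, finiteDisc Ω E g v = 1 := by
  obtain ⟨c, hc1, hc2, hc3⟩ := exists_orderBound φ ι hΩ
  let e := Module.finBasisOfFinrankEq F E hE.degree
  let δ : F := (traceMatrix F fun i => (1 : F) ⊗ₜ[F] (e i : B)).det
  have hδ : algebraMap F (AlgebraicClosure F) δ = (Matrix.of fun k i => d.χ i (e k)).det ^ 2 :=
    algebraMap_det_traceMatrix (AlgHom.id F (AlgebraicClosure F)) hB hn d.mul_eq_one' fun i =>
      d.apply_eq (e i)
  have hδ0 : δ ≠ 0 := by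
    intro h
    rw [h, map_zero, eq_comm] at hδ
    exact d.det_ne_zero hB hn e (pow_eq_zero_iff two_ne_zero |>.1 hδ)
  have hmem : ∀ᶠ v : HeightOneSpectrum (𝓞 F) in Filter.cofinite, ∀ i,
      (1 : (Place.finite v).Completion) ⊗ₜ[F] (e i : B) ∈ localOrder Ω v :=
    Filter.eventually_all.2 fun i => tmul_mem_localOrder hΩ (e i : B)
  filter_upwards [hc2, hmem, eventually_norm_eq_one hδ0, hg] with v hcv hmemv hδv hgv
  obtain ⟨g', hg', hg1, hg2⟩ := exists_mk_of_mem_subPts hgv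
  have hK := isNonarchimedean_closure v
  obtain ⟨hpos, hge, -⟩ := finiteDisc_bounds d (ι v) hB hn hE (hc1 v) (hc3 v) g' hg' (hmax v).prop
  rw [hcv, one_pow, one_mul] at hge
  refine le_antisymm ?_ hge
  have hne := nonempty_basis_of_isOrderIn v (finrank_conjAlgebra hE (g (.finite v))) (hmax v).prop
  rw [finiteDisc_eq hne]
  set b := hne.some with hb
  -- The conjugates of a fixed `F`-basis of `E` lie in the local order at almost all places, and
  -- their trace determinant `δ` is a local unit. They are integral combinations of the basis `b`,
  -- so `1 = ‖det A‖² ‖det P‖²` with `‖det A‖ ≤ 1`, which bounds the discriminant above by `1`.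
  let x : Fin n → (Place.finite v).Completion ⊗[F] B := fun i =>
    (((g' : ((Place.finite v).Completion ⊗[F] B)ˣ)⁻¹ : ((Place.finite v).Completion ⊗[F] B)ˣ) :
      (Place.finite v).Completion ⊗[F] B) * ((1 : (Place.finite v).Completion) ⊗ₜ[F] (e i : B)) *
      ((g' : ((Place.finite v).Completion ⊗[F] B)ˣ) : (Place.finite v).Completion ⊗[F] B)
  have hxmem : ∀ i, x i ∈ toralOrder Ω E g v := fun i => by
    refine ⟨?_, ?_⟩
    · change x i ∈ conjAlgebra E (g (.finite v))
      refine ⟨1 ⊗ₜ[F] (e i : B), ⟨1 ⊗ₜ[F] e i, by simp⟩, ?_⟩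
      rw [← hg', ← QuotientGroup.mk_inv]
      refine (GPts.Ad_mk_apply g'⁻¹ _).trans ?_
      simp [x]
    · exact mul_mem (mul_mem hg2 (hmemv i)) hg1
  let A : Matrix (Fin n) (Fin n) (localIntegers v) := Matrix.of fun i j => b.repr ⟨x i, hxmem i⟩ j
  have hxA : ∀ i, x i = ∑ j, (A i j : (Place.finite v).Completion) •
      (b j : (Place.finite v).Completion ⊗[F] B) := fun i => by
    have h1 := congrArg (toralOrder Ω E g v).val (b.sum_repr ⟨x i, hxmem i⟩)
    rw [map_sum] at h1
    exact h1.symm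
  have hbx : ∀ i, (b i : (Place.finite v).Completion ⊗[F] B) ∈
      conjAlgebra E (QuotientGroup.mk g' : GPts f n F B (Place.finite v).Completion) := fun i => by
    rw [hg']
    exact (b i).2.1
  choose P hP using fun i => d.exists_diagonal_conj (ι v) g' (hbx i)
  let A' : Matrix (Fin n) (Fin n) (AlgebraicClosure (Place.finite v).Completion) :=
    Matrix.of fun i j => algebraMap (Place.finite v).Completion _ (A i j)
  have hA' : ‖A'.det‖ ≤ 1 := by
    refine (norm_det_le zero_le_one fun i j => ?_).trans_eq
      (by rw [sumBound_eq_one hK, one_pow, one_mul])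
    simp only [A', Matrix.of_apply]
    rw [norm_algebraMap_closure]
    exact (mem_localIntegers_iff v).1 (A i j).2
  have hPx : ∀ i, localSplit φ (Place.finite v).Completion (ι v) (x i) =
      d.locV (ι v) (g' : ((Place.finite v).Completion ⊗[F] B)ˣ) *
        Matrix.diagonal ((A' * Matrix.of P) i) *
          d.locW (ι v) (g' : ((Place.finite v).Completion ⊗[F] B)ˣ) := fun i => by
    have h1 : Matrix.diagonal ((A' * Matrix.of P) i) = ∑ j, A' i j • Matrix.diagonal (P j) := by
      ext p q
      rw [Matrix.sum_apply, Matrix.diagonal_apply]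
      split_ifs with h
      · subst h
        simp [Matrix.mul_apply]
      · simp [h]
    rw [hxA, map_sum, h1, Matrix.mul_sum, Matrix.sum_mul]
    refine Finset.sum_congr rfl fun j _ => ?_
    rw [map_smul, hP, Matrix.mul_smul, Matrix.smul_mul, ← algebraMap_smul
      (AlgebraicClosure (Place.finite v).Completion)]
    rfl
  have hPx' : ∀ i, localSplit φ (Place.finite v).Completion (ι v) (x i) =
      d.locV (ι v) (g' : ((Place.finite v).Completion ⊗[F] B)ˣ) *
        Matrix.diagonal ((Matrix.of fun k i => ι v (d.χ i (e k))) i) *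
          d.locW (ι v) (g' : ((Place.finite v).Completion ⊗[F] B)ˣ) := fun i => by
    have h1 := congrArg (fun M : Matrix (Fin n) (Fin n) (AlgebraicClosure F) => M.map (ι v))
      (d.apply_eq (e i))
    simp only [localSplit_tmul, one_smul, Matrix.map_mul,
      Matrix.diagonal_map (map_zero (ι v))] at h1
    have h2 : localSplit φ (Place.finite v).Completion (ι v) (1 ⊗ₜ[F] (e i : B)) =
        (φ (1 ⊗ₜ (e i : B))).map (ι v) := by rw [localSplit_tmul, one_smul]
    simp only [x]
    rw [map_mul, map_mul, h2, TorusDiag.locV, TorusDiag.locW]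
    have h3 : (φ (1 ⊗ₜ (e i : B))).map (ι v) = d.V.map (ι v) *
      Matrix.diagonal ((Matrix.of fun k i => ι v (d.χ i (e k))) i) * d.W.map (ι v) := h1
    rw [h3]
    simp only [mul_assoc]
  have e1 := norm_sq_eq_norm_traceMatrix (ι v) hB hn
    (d.locW_mul_locV (ι v) (g' : ((Place.finite v).Completion ⊗[F] B)ˣ)) hPx
  have e2 := norm_sq_eq_norm_traceMatrix (ι v) hB hn
    (d.locW_mul_locV (ι v) (g' : ((Place.finite v).Completion ⊗[F] B)ˣ)) hPx'
  have e3 := norm_sq_eq_norm_traceMatrix (ι v) hB hn (P := Matrix.of P)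
    (d.locW_mul_locV (ι v) (g' : ((Place.finite v).Completion ⊗[F] B)ˣ)) hP
  have e4 : ‖(Matrix.of fun k i => ι v (d.χ i (e k))).det‖ ^ 2 = 1 := by
    have h1 : (Matrix.of fun k i => ι v (d.χ i (e k))).det =
        ι v (Matrix.of fun k i => d.χ i (e k)).det := by
      rw [AlgHom.map_det]
      rfl
    rw [h1, ← norm_pow, ← map_pow, ← hδ, AlgHom.commutes,
      IsScalarTower.algebraMap_apply F (Place.finite v).Completion, norm_algebraMap_closure, hδv]
  rw [e3]
  refine inv_le_one_of_one_le₀ ?_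
  have e5 : ‖A'.det‖ ^ 2 * ‖(Matrix.of P).det‖ ^ 2 = 1 := by
    rw [← e4, ← e2, e1, Matrix.det_mul, norm_mul, mul_pow]
  calc 1 = ‖A'.det‖ ^ 2 * ‖(Matrix.of P).det‖ ^ 2 := e5.symm
    _ ≤ 1 * ‖(Matrix.of P).det‖ ^ 2 := by
        gcongr
        exact pow_le_one₀ (norm_nonneg _) hA'
    _ = _ := one_mul _

/-- Some representative of the class is a unit of the order; any other differs by a scalar, which
cancels in the product. -/
theorem bound_of_mem_compactOpen {c : ℝ} (hc : ∀ x ∈ localOrder Ω v, ∀ p q,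
      ‖localSplit φ (Place.finite v).Completion ι x p q‖ ≤ c)
    (x : f.units n F B (Place.finite v).Completion)
    (hx : QuotientGroup.mk x ∈ compactOpen f n Ω v) (p q r s : Fin n) :
    ‖localSplit φ (Place.finite v).Completion ι
      ((x : ((Place.finite v).Completion ⊗[F] B)ˣ) : (Place.finite v).Completion ⊗[F] B) p q‖ *
      ‖localSplit φ (Place.finite v).Completion ι
        (((x : ((Place.finite v).Completion ⊗[F] B)ˣ)⁻¹ : ((Place.finite v).Completion ⊗[F] B)ˣ) :
          (Place.finite v).Completion ⊗[F] B) r s‖ ≤ c ^ 2 := by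
  obtain ⟨y, hy, hy1, hy2⟩ := exists_mk_of_mem_subPts hx
  obtain ⟨t, ht1, ht2⟩ := Form.exists_smul_of_mk_eq hy.symm
  have ht : ‖algebraMap (Place.finite v).Completion
      (AlgebraicClosure (Place.finite v).Completion) t‖ *
      ‖algebraMap (Place.finite v).Completion (AlgebraicClosure (Place.finite v).Completion)
        ((t⁻¹ : (Place.finite v).Completionˣ) : (Place.finite v).Completion)‖ = 1 := by
    rw [← norm_mul, ← map_mul, Units.mul_inv, map_one, norm_one]
  rw [ht1, ht2, map_smul, map_smul, Matrix.smul_apply, Matrix.smul_apply, Algebra.smul_def,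
    Algebra.smul_def, norm_mul, norm_mul, mul_mul_mul_comm, ht, one_mul, pow_two]
  exact mul_le_mul (hc _ hy1 p q) (hc _ hy2 r s) (norm_nonneg _)
    ((norm_nonneg _).trans (hc _ hy1 p q))

end FiniteDisc

/-! ### Infinite places -/

section Gram

variable {M : Type*} [AddCommGroup M] [Module ℂ M] [FiniteDimensional ℂ M] {n : ℕ}
  {K : Type*} [NormedField K] [Algebra ℂ K]

theorem exists_bound_of_core (hK : ∀ z : ℂ, ‖algebraMap ℂ K z‖ = ‖z‖)
    (Q : InnerProductSpace.Core ℂ M) (L : M →ₗ[ℂ] Matrix (Fin n) (Fin n) K) :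
    ∃ c : ℝ, 0 ≤ c ∧ ∀ x, Q.inner x x = 1 → ∀ p q, ‖L x p q‖ ≤ c := by
  let _ : NormedAddCommGroup M := Q.toNormedAddCommGroup
  let _ : InnerProductSpace ℂ M := InnerProductSpace.ofCore Q.toCore
  let _ : NormedSpace ℂ K :=
    { (inferInstance : Module ℂ K) with
      norm_smul_le := fun a b => by rw [Algebra.smul_def, norm_mul, hK] }
  let L' : M →L[ℂ] (Fin n × Fin n → K) := LinearMap.toContinuousLinearMap
    (LinearMap.pi fun p => (Matrix.entryLinearMap ℂ K p.1 p.2).comp L)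
  refine ⟨‖L'‖, L'.opNorm_nonneg, fun x hx p q => ?_⟩
  have h1 : ‖x‖ = 1 := by
    have h2 : inner ℂ x x = (1 : ℂ) := hx
    have h3 : ‖x‖ ^ 2 = 1 := by rw [norm_sq_eq_re_inner (𝕜 := ℂ), h2, RCLike.one_re]
    exact (pow_eq_one_iff_of_nonneg (norm_nonneg _) two_ne_zero).1 h3
  calc ‖L x p q‖ = ‖L' x (p, q)‖ := rfl
    _ ≤ ‖L' x‖ := norm_le_pi_norm _ _
    _ ≤ ‖L'‖ * ‖x‖ := L'.le_opNorm x
    _ = ‖L'‖ := by rw [h1, mul_one]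

/-- A family in a subspace of dimension `n` is expressed in an orthonormal family of that
subspace. -/
theorem exists_orthonormal_of_linearIndependent (Q : InnerProductSpace.Core ℂ M) {y : Fin n → M}
    (hy : LinearIndependent ℂ y) : ∃ (e : Fin n → M) (A : Matrix (Fin n) (Fin n) ℂ),
      (∀ i, e i ∈ Submodule.span ℂ (Set.range y)) ∧ (∀ i, Q.inner (e i) (e i) = 1) ∧
      (∀ i, y i = ∑ k, A i k • e k) ∧
      ‖(Matrix.of fun i j => Q.inner (y i) (y j)).det‖ = ‖A.det‖ ^ 2 := by
  let _ : NormedAddCommGroup M := Q.toNormedAddCommGroup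
  let _ : InnerProductSpace ℂ M := InnerProductSpace.ofCore Q.toCore
  have hfr : Module.finrank ℂ (Submodule.span ℂ (Set.range y)) = n := by
    rw [finrank_span_eq_card hy, Fintype.card_fin]
  let b := (stdOrthonormalBasis ℂ (Submodule.span ℂ (Set.range y))).reindex (finCongr hfr)
  let y' : Fin n → Submodule.span ℂ (Set.range y) := fun i =>
    ⟨y i, Submodule.subset_span ⟨i, rfl⟩⟩
  let A : Matrix (Fin n) (Fin n) ℂ := Matrix.of fun i k => b.repr (y' i) k
  refine ⟨fun i => b i, A, fun i => (b i).2, fun i => ?_, fun i => ?_, ?_⟩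
  · exact (orthonormal_iff_ite.1 b.orthonormal i i).trans (if_pos rfl)
  · have h1 := congrArg (Submodule.subtype _) (b.sum_repr (y' i))
    rw [map_sum] at h1
    exact h1.symm
  · have h1 : (Matrix.of fun i j => Q.inner (y i) (y j)) = A.map (starRingEnd ℂ) * A.transpose := by
      ext i j
      rw [Matrix.mul_apply, Matrix.of_apply]
      change inner ℂ (y' i) (y' j) = _
      rw [← b.sum_inner_mul_inner]
      refine Finset.sum_congr rfl fun k _ => ?_
      change _ = starRingEnd ℂ (b.repr (y' i) k) * b.repr (y' j) k
      rw [b.repr_apply_apply, b.repr_apply_apply, inner_conj_symm]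
    have h2 : (A.map (starRingEnd ℂ)).det = starRingEnd ℂ A.det := by
      rw [RingHom.map_det]
      rfl
    rw [h1, Matrix.det_mul, Matrix.det_transpose, h2, norm_mul, RCLike.norm_conj, pow_two]

/-- An orthonormal family of the span plays the role of an integral basis: its matrices are bounded
and diagonal in the same eigenbasis, so `norm_det_sq_mul_prod_le` applies. The change of basis `A`
then contributes `‖det A‖²`, the Gram determinant. -/
theorem exists_gram_bound (hK : ∀ z : ℂ, ‖algebraMap ℂ K z‖ = ‖z‖)
    (Q : InnerProductSpace.Core ℂ M) (L : M →ₗ[ℂ] Matrix (Fin n) (Fin n) K) :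
    ∃ c : ℝ, 0 ≤ c ∧ ∀ (y : Fin n → M) (V W P : Matrix (Fin n) (Fin n) K),
      LinearIndependent ℂ y → V * W = 1 → W * V = 1 →
      (∀ i, L (y i) = V * Matrix.diagonal (P i) * W) →
        ‖P.det‖ ^ 2 * ∏ i, (‖fun p => V p i‖ * ‖W i‖) ≤
          c * ‖(Matrix.of fun i j => Q.inner (y i) (y j)).det‖ := by
  obtain ⟨c, hc0, hc⟩ := exists_bound_of_core hK Q L
  refine ⟨(volBound K n * c ^ n) ^ 2, by positivity, fun y V W P hy hVW hWV hP => ?_⟩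
  obtain ⟨e, A, he, he1, hye, hdet⟩ := exists_orthonormal_of_linearIndependent Q hy
  have hdiag : ∀ x ∈ Submodule.span ℂ (Set.range y), ∃ r : Fin n → K,
      L x = V * Matrix.diagonal r * W := by
    intro x hx
    induction hx using Submodule.span_induction with
    | mem x hx =>
      obtain ⟨i, rfl⟩ := hx
      exact ⟨P i, hP i⟩
    | zero => exact ⟨0, by simp⟩
    | add x y _ _ hx hy =>
      obtain ⟨r, hr⟩ := hx
      obtain ⟨s, hs⟩ := hy
      exact ⟨r + s, by rw [map_add, hr, hs, ← add_mul, ← mul_add, Matrix.diagonal_add]; rfl⟩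
    | smul z x _ hx =>
      obtain ⟨r, hr⟩ := hx
      exact ⟨z • r, by rw [map_smul, hr, Matrix.diagonal_smul, Matrix.mul_smul, Matrix.smul_mul]⟩
  choose P' hP' using fun i => hdiag (e i) (he i)
  have hPA : P = A.map (algebraMap ℂ K) * Matrix.of P' := by
    have h1 : ∀ i, Matrix.diagonal (P i) =
        Matrix.diagonal ((A.map (algebraMap ℂ K) * Matrix.of P') i) := by
      intro i
      have h2 : V * Matrix.diagonal (P i) * W =
          V * Matrix.diagonal ((A.map (algebraMap ℂ K) * Matrix.of P') i) * W := by
        have h3 : Matrix.diagonal ((A.map (algebraMap ℂ K) * Matrix.of P') i) =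
            ∑ k, A i k • Matrix.diagonal (P' k) := by
          ext p q
          rw [Matrix.sum_apply, Matrix.diagonal_apply]
          split_ifs with h
          · subst h
            simp [Matrix.mul_apply, Algebra.smul_def]
          · simp [h]
        rw [← hP, hye, map_sum, h3, Matrix.mul_sum, Matrix.sum_mul]
        refine Finset.sum_congr rfl fun k _ => ?_
        rw [map_smul, hP', Matrix.mul_smul, Matrix.smul_mul]
      have h4 := congrArg (fun X => W * X * V) h2
      simp only [mul_assoc] at h4
      simpa only [hWV, mul_one, ← mul_assoc, one_mul] using h4
    ext i j
    simpa using congrFun (congrFun (h1 i) j) j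
  have h1 := norm_det_sq_mul_prod_le hVW (Matrix.of P') hc0 fun k p q => by
    have := hc (e k) (he1 k) p q
    rwa [hP'] at this
  have h2 : ‖P.det‖ = ‖A.det‖ * ‖(Matrix.of P').det‖ := by
    rw [hPA, Matrix.det_mul, norm_mul, ← hK, RingHom.map_det]
    rfl
  rw [h2, mul_pow, hdet, mul_assoc, mul_comm]
  gcongr

end Gram

/-! ### Absolute values and entropy at the infinite places -/

section InfinitePlaces

variable {F : Type*} [Field F] [NumberField F]

instance complexAtNormedField (w : InfinitePlace F) : NormedField (ComplexAt w) :=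
  inferInstanceAs (NormedField ℂ)

instance (w : InfinitePlace F) : CharZero (ComplexAt w) :=
  inferInstanceAs (CharZero ℂ)

instance (w : InfinitePlace F) : IsAlgClosed (ComplexAt w) :=
  inferInstanceAs (IsAlgClosed ℂ)

instance (w : InfinitePlace F) : Algebra (Place.infinite w).Completion (ComplexAt w) :=
  (completionToComplex w).toRingHom.toAlgebra

instance (w : InfinitePlace F) : IsScalarTower F (Place.infinite w).Completion (ComplexAt w) :=
  IsScalarTower.of_algebraMap_eq fun x => ((completionToComplex w).commutes x).symm

variable (w : InfinitePlace F)

theorem norm_algebraMap_infinite (x : (Place.infinite w).Completion) :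
    ‖algebraMap (Place.infinite w).Completion (ComplexAt w) x‖ = ‖x‖ :=
  (InfinitePlace.Completion.isometry_extensionEmbedding w).norm_map_of_map_zero (map_zero _) x

theorem norm_algebraMap_complexAt {F : Type*} [Field F] (w : InfinitePlace F) (z : ℂ) : ‖algebraMap ℂ (ComplexAt w) z‖ = ‖z‖ := rfl

theorem closureAbs_of_mem_range
    (j : AlgebraicClosure (Place.infinite w).Completion →ₐ[(Place.infinite w).Completion]
      ComplexAt w) (x : AlgebraicClosure (Place.infinite w).Completion)
    {t : (Place.infinite w).Completion} (ht : algebraMap _ (ComplexAt w) t = j x) :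
    (Place.infinite w).closureAbs x = ‖j x‖ ^ w.mult := by
  have hx : x = algebraMap _ _ t := j.toRingHom.injective (ht.symm.trans (j.commutes t).symm)
  rw [Place.closureAbs, hx, minpoly.eq_X_sub_C (AlgebraicClosure (Place.infinite w).Completion) t,
    AlgHom.commutes, norm_algebraMap_infinite]
  simp [Place.nabs]

/-- The normalized extension of the absolute value to the algebraic closure. -/
theorem closureAbs_infinite
    (j : AlgebraicClosure (Place.infinite w).Completion →ₐ[(Place.infinite w).Completion]
      ComplexAt w) (x : AlgebraicClosure (Place.infinite w).Completion) :
    (Place.infinite w).closureAbs x = ‖j x‖ ^ w.mult := by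
  by_cases hmem : ∃ t, algebraMap (Place.infinite w).Completion (ComplexAt w) t = j x
  · obtain ⟨t, ht⟩ := hmem
    exact closureAbs_of_mem_range w j x ht
  rcases w.isReal_or_isComplex with hw | hw
  -- At a real place a non-real `z` has minimal polynomial `X² - 2 Re(z) X + |z|²`; the degree `2`
  -- in the root taken by `closureAbs` turns the constant term into `|z|`.
  · have hsurj : ∀ r : ℝ, ∃ t : (Place.infinite w).Completion,
        algebraMap (Place.infinite w).Completion (ComplexAt w) t = (r : ℂ) := fun r => by
      obtain ⟨t, ht⟩ := InfinitePlace.Completion.surjective_extensionEmbeddingOfIsReal hw r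
      refine ⟨t, ?_⟩
      rw [← ht]
      exact (InfinitePlace.Completion.extensionEmbeddingOfIsReal_apply hw t).symm
    have hquad : ∀ z : ℂ, z ^ 2 + (-((2 * z.re : ℝ) : ℂ) * z + ((‖z‖ ^ 2 : ℝ) : ℂ)) = 0 := by
      intro z
      rw [← Complex.normSq_eq_norm_sq, Complex.normSq_eq_conj_mul_self, ← Complex.add_conj]
      ring
    let z : ℂ := j x
    obtain ⟨s, hs⟩ := hsurj (2 * z.re)
    obtain ⟨p, hp⟩ := hsurj (‖z‖ ^ 2)
    let q : Polynomial (Place.infinite w).Completion :=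
      Polynomial.X ^ 2 + (Polynomial.C (-s) * Polynomial.X + Polynomial.C p)
    have hqlt : (Polynomial.C (-s) * Polynomial.X + Polynomial.C p).degree < ((2 : ℕ) : WithBot ℕ) :=
      Polynomial.degree_linear_le.trans_lt (by norm_num)
    have hqm : q.Monic := Polynomial.monic_X_pow_add hqlt
    have hqd : q.natDegree = 2 := 
      Polynomial.natDegree_eq_of_degree_eq_some ((Polynomial.degree_add_eq_left_of_degree_lt
        (by rwa [Polynomial.degree_X_pow])).trans (Polynomial.degree_X_pow 2))
    have hint : IsIntegral (Place.infinite w).Completion x := Algebra.IsIntegral.isIntegral x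
    have hq0 : Polynomial.aeval x q = 0 := by
      refine j.toRingHom.injective ?_
      rw [map_zero]
      change j (Polynomial.aeval x q) = 0
      rw [← Polynomial.aeval_algHom_apply]
      simp only [q, map_add, map_mul, map_pow, Polynomial.aeval_X, Polynomial.aeval_C, map_neg]
      rw [hs, hp]
      exact hquad z
    have h2 : 2 ≤ (minpoly (Place.infinite w).Completion x).natDegree := by
      rw [minpoly.two_le_natDegree_iff hint]
      rintro ⟨t, rfl⟩
      exact hmem ⟨t, (j.commutes t).symm⟩
    have hmin : minpoly (Place.infinite w).Completion x = q :=
      (Polynomial.eq_of_monic_of_dvd_of_natDegree_le (minpoly.monic hint) hqm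
        (minpoly.dvd _ _ hq0) (by rw [hqd]; exact h2)).symm
    have hp' : ‖p‖ = ‖j x‖ ^ 2 := by
      rw [← norm_algebraMap_infinite, hp]
      change ‖((‖z‖ ^ 2 : ℝ) : ℂ)‖ = ‖z‖ ^ 2
      rw [Complex.norm_real, norm_pow, norm_norm]
    rw [Place.closureAbs, hmin, hqd, InfinitePlace.mult_isReal ⟨w, hw⟩, pow_one]
    have hc : q.coeff 0 = p := by simp [q]
    rw [hc]
    change (‖p‖ ^ w.mult) ^ _ = _
    rw [InfinitePlace.mult_isReal ⟨w, hw⟩, pow_one, hp', ← Real.rpow_natCast,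
      ← Real.rpow_mul (norm_nonneg _)]
    norm_num
  -- At a complex place the completion maps onto `ℂ`, so this case is empty.
  · exact absurd (InfinitePlace.Completion.surjective_extensionEmbedding_of_isComplex hw (j x)) hmem

variable {B : Type*} [Ring B] [Algebra F B] [FiniteDimensional F B] {f : Form} {n : ℕ}

/-- An embedding of the closure into `ℂ` matches the roots; the normalized absolute value is the
usual one to the power `w.mult`. -/
theorem entropyHaar_infinite (a : GPts f n F B (Place.infinite w).Completion) :
    entropyHaar (Place.infinite w) a = 1 / 2 * (w.mult * logSum (ComplexAt w) a) := by
  let j : AlgebraicClosure (Place.infinite w).Completion →ₐ[(Place.infinite w).Completion]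
    ComplexAt w := IsAlgClosed.lift
  set p := (GPts.Ad a : _ ≃ₐ[(Place.infinite w).Completion] _).toLinearMap.charpoly with hp
  have h1 := (IsAlgClosed.splits (p.map (algebraMap (Place.infinite w).Completion
    (AlgebraicClosure (Place.infinite w).Completion)))).roots_map j.toRingHom
  rw [Polynomial.map_map] at h1
  have h2 : j.toRingHom.comp (algebraMap (Place.infinite w).Completion
      (AlgebraicClosure (Place.infinite w).Completion)) = algebraMap _ (ComplexAt w) :=
    j.comp_algebraMap
  rw [h2] at h1
  rw [entropyHaar, logSum, ← hp, h1, Multiset.map_map, Polynomial.aroots,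
    ← Multiset.sum_map_mul_left (a := (w.mult : ℝ))]
  congr 2
  refine Multiset.map_congr rfl fun x _ => ?_
  rw [closureAbs_infinite w j, Real.log_pow, abs_mul, Nat.abs_cast]
  rfl

theorem entropyHaar_finite (v : HeightOneSpectrum (𝓞 F))
    (a : GPts f n F B (Place.finite v).Completion) :
    entropyHaar (Place.finite v) a =
      1 / 2 * logSum (AlgebraicClosure (Place.finite v).Completion) a := by
  simp only [entropyHaar, logSum, closureAbs_finite, Polynomial.aroots]

end InfinitePlaces

/-! ### The bounds at the places -/

section PlaceBounds

variable {F : Type*} [Field F] [NumberField F] {B : Type*} [Ring B] [Algebra F B] {f : Form}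
  {n : ℕ}

instance (w : InfinitePlace F) [FiniteDimensional F B] :
    FiniteDimensional ℂ (ComplexAt w ⊗[F] B) :=
  have : Module.Finite ℂ (ComplexAt w) := inferInstanceAs (Module.Finite ℂ ℂ)
  Module.Finite.trans (ComplexAt w) _

/-- Connects the complexified algebra, where the inner product lives, with the algebra over the
completion, where the torus lives. -/
theorem localSplit_completionToComplex (φ : Splitting n F B) (w : InfinitePlace F)
    (ι : AlgebraicClosure F →ₐ[F] ComplexAt w) (x : (Place.infinite w).Completion ⊗[F] B) :
    localSplit φ (ComplexAt w) ι
      (Algebra.TensorProduct.map (completionToComplex w) (AlgHom.id F B) x) =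
      localSplit φ (Place.infinite w).Completion ι x := by
  induction x with
  | zero => simp
  | add x y hx hy => rw [map_add, map_add, hx, hy, map_add]
  | tmul c b =>
    rw [Algebra.TensorProduct.map_tmul, localSplit_tmul, localSplit_tmul]
    ext i j
    rw [Matrix.smul_apply, Matrix.smul_apply, Algebra.smul_def, Algebra.smul_def]
    rfl

theorem infiniteDisc_nonneg (Q : HermitianData F B) (E : Subalgebra F B)
    (g : ∀ u : Place F, GPts f n F B u.Completion) (w : InfinitePlace F) :
    0 ≤ infiniteDisc Q E g w := by
  unfold infiniteDisc
  split_ifs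
  · have : ∀ x, 0 ≤ (Place.infinite w).nabs x := fun x => pow_nonneg (norm_nonneg x) _
    exact mul_nonneg (by positivity) (inv_nonneg.2 (this _))
  · exact zero_le_one

variable [FiniteDimensional F B]

/-- The infinite discriminant is the Gram determinant over `‖det P‖²`, to the power `w.mult`. The
constant of `exists_gram_bound` is fixed before `E` and `g`, hence uniform in the torus. -/
theorem exists_prod_size_le_infiniteDisc (φ : Splitting n F B) (hB : Module.finrank F B = n ^ 2)
    (hn : n ≠ 0) (Q : HermitianData F B) (w : InfinitePlace F)
    (ι : AlgebraicClosure F →ₐ[F] ComplexAt w) :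
    ∃ c : ℝ, 0 ≤ c ∧ ∀ (E : Subalgebra F B) (d : TorusDiag φ E), IsTorusAlgebra n E →
      ∀ (g : ∀ u : Place F, GPts f n F B u.Completion)
        (g' : f.units n F B (Place.infinite w).Completion), QuotientGroup.mk g' = g (.infinite w) →
        (∏ i, d.size ι (g' : ((Place.infinite w).Completion ⊗[F] B)ˣ) i) ^ w.mult ≤
          c * infiniteDisc Q E g w := by
  obtain ⟨c, hc0, hc⟩ := exists_gram_bound (norm_algebraMap_complexAt w) (Q w)
    ((localSplit φ (ComplexAt w) ι).toLinearMap.restrictScalars ℂ)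
  refine ⟨c ^ w.mult, by positivity, fun E d hE g g' hg => ?_⟩
  have hne : Nonempty (Module.Basis (Fin n) (Place.infinite w).Completion
      (localAlgebra E g (.infinite w))) := by
    have hfr : Module.finrank (Place.infinite w).Completion (localAlgebra E g (.infinite w)) = n :=
      finrank_conjAlgebra hE (g (.infinite w))
    have : FiniteDimensional (Place.infinite w).Completion (localAlgebra E g (.infinite w)) :=
      Module.finite_of_finrank_pos (by omega)
    exact ⟨Module.finBasisOfFinrankEq _ _ hfr⟩
  rw [infiniteDisc, dif_pos hne]
  set b := hne.some with hb
  let x : Fin n → (Place.infinite w).Completion ⊗[F] B := fun i => b i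
  have hx : ∀ i, x i ∈
      conjAlgebra E (QuotientGroup.mk g' : GPts f n F B (Place.infinite w).Completion) :=
    fun i => by
      rw [hg]
      exact (b i).2
  choose P hP using fun i => d.exists_diagonal_conj ι g' (hx i)
  have hli : LinearIndependent (Place.infinite w).Completion x :=
    b.linearIndependent.map' (localAlgebra E g (.infinite w)).val.toLinearMap
      (LinearMap.ker_eq_bot.2 Subtype.val_injective)
  have hli2 := (isSplit_localSplit φ (k := (Place.infinite w).Completion) ι hB
    hn).linearIndependent hli
  have hdet := algebraMap_det_traceMatrix ι hB hn (P := Matrix.of P)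
    (d.locW_mul_locV ι (g' : ((Place.infinite w).Completion ⊗[F] B)ˣ)) hP
  have hP0 : (Matrix.of P).det ≠ 0 := by
    have h1 := hli2
    simp only [hP] at h1
    exact det_ne_zero_of_linearIndependent h1
  let y : Fin n → ComplexAt w ⊗[F] B := fun i =>
    Algebra.TensorProduct.map (completionToComplex w) (AlgHom.id F B) (x i)
  have hy : LinearIndependent ℂ y := by
    refine LinearIndependent.of_comp
      ((localSplit φ (ComplexAt w) ι).toLinearMap.restrictScalars ℂ) ?_
    refine LinearIndependent.restrict_scalars (K := ComplexAt w) ?_ ?_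
    · exact fun r s hrs => by simpa [Algebra.smul_def] using hrs
    · have h1 : ((localSplit φ (ComplexAt w) ι).toLinearMap.restrictScalars ℂ) ∘ y =
          fun i => localSplit φ (Place.infinite w).Completion ι (x i) :=
        funext fun i => localSplit_completionToComplex φ w ι (x i)
      rw [h1]
      exact hli2
  have h1 := hc y _ _ (Matrix.of P) hy
    (d.locV_mul_locW ι (g' : ((Place.infinite w).Completion ⊗[F] B)ˣ))
    (d.locW_mul_locV ι (g' : ((Place.infinite w).Completion ⊗[F] B)ˣ)) fun i =>
      (localSplit_completionToComplex φ w ι (x i)).trans (hP i)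
  have h2 : ‖(traceMatrix (Place.infinite w).Completion x).det‖ = ‖(Matrix.of P).det‖ ^ 2 := by
    rw [← norm_algebraMap_infinite, hdet, norm_pow]
  have hpos : 0 < ‖(Matrix.of P).det‖ ^ 2 := by positivity
  change _ ≤ c ^ w.mult * (‖(gramMatrix Q w x).det‖ ^ w.mult *
    (‖(traceMatrix (Place.infinite w).Completion x).det‖ ^ w.mult)⁻¹)
  rw [h2, ← inv_pow, ← mul_pow, ← mul_pow]
  refine pow_le_pow_left₀ (Finset.prod_nonneg fun i _ => d.size_nonneg ι _ i) ?_ _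
  rw [← mul_assoc, ← div_eq_mul_inv, le_div_iff₀ hpos, mul_comm]
  exact h1

theorem exists_infinite_bound (φ : Splitting n F B) (hB : Module.finrank F B = n ^ 2)
    (hn : n ≠ 0) (Q : HermitianData F B) (w : InfinitePlace F)
    {X : Set (GPts f n F B (Place.infinite w).Completion)} (hX : IsPrecompact X) :
    ∃ A : ℝ, 0 ≤ A ∧ ∀ (E : Subalgebra F B) (d : TorusDiag φ E), IsTorusAlgebra n E →
      ∀ (g : ∀ u : Place F, GPts f n F B u.Completion) (l : f.units n F B F)
        (b a t s : GPts f n F B (Place.infinite w).Completion),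
        t ∈ subPts f n (E.baseChange (Place.infinite w).Completion).toSubmonoid →
        s ∈ subPts f n (E.baseChange (Place.infinite w).Completion).toSubmonoid →
        GPts.map f n (Algebra.ofId F (Place.infinite w).Completion) (QuotientGroup.mk l) =
          t * (g (.infinite w) * b * (g (.infinite w))⁻¹) * s →
        ∀ τ : ℕ, b ∈ bowenBall a X (-τ) τ →
        a ∈ subPts f n (localAlgebra E g (.infinite w)).toSubmonoid →
        ∀ N : F, (algebraMap F (AlgebraicClosure F) N =
          ∏ p : Fin n × Fin n with p.1 ≠ p.2, d.pairing ((l : (F ⊗[F] B)ˣ) : F ⊗[F] B)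
            (((l : (F ⊗[F] B)ˣ)⁻¹ : (F ⊗[F] B)ˣ) : F ⊗[F] B) p.1 p.2) →
        (Place.infinite w).nabs (algebraMap F _ N) ≤
          A * infiniteDisc Q E g w ^ (2 * (n - 1)) *
            Real.exp (-4 * τ * entropyHaar (.infinite w) a) := by
  let ι : AlgebraicClosure F →ₐ[F] ComplexAt w := IsAlgClosed.lift
  obtain ⟨c, hc0, hc⟩ := exists_prod_size_le_infiniteDisc (f := f) φ hB hn Q w ι
  obtain ⟨R, hR, hXR⟩ := exists_bound_of_isPrecompact (norm_algebraMap_infinite w)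
    (localSplit φ (Place.infinite w).Completion ι) hX
  set m := (Finset.univ.filter fun p : Fin n × Fin n => p.1 ≠ p.2).card with hm
  have hp0 : 0 ≤ pairBound (ComplexAt w) n := zero_le_one.trans (one_le_pairBound _)
  refine ⟨((pairBound (ComplexAt w) n * R ^ 2) ^ m) ^ w.mult * c ^ (2 * (n - 1)), by positivity,
    fun E d hE g l b a t s ht hs hl τ hb ha N hN => ?_⟩
  obtain ⟨g', hg'⟩ := QuotientGroup.mk_surjective (g (.infinite w))
  have h1 := d.norm_invariant_le ι hB hn l g' ht hs (hg'.symm ▸ hl) τ hb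
    (by rw [hg']; exact ha) hR hXR hN
  rw [IsScalarTower.algebraMap_apply F (Place.infinite w).Completion,
    norm_algebraMap_infinite] at h1
  have h2 := hc E d hE g g' hg'
  have hs0 : 0 ≤ ∏ i, d.size ι (g' : ((Place.infinite w).Completion ⊗[F] B)ˣ) i :=
    Finset.prod_nonneg fun i _ => d.size_nonneg ι _ i
  have hD := infiniteDisc_nonneg Q E g w
  change ‖algebraMap F (Place.infinite w).Completion N‖ ^ w.mult ≤ _
  refine (pow_le_pow_left₀ (norm_nonneg _) h1 _).trans ?_
  -- The entropy is half of `w.mult * logSum`, whence the coefficient `4`.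
  have h3 : Real.exp (-2 * τ * logSum (ComplexAt w) a) ^ w.mult =
      Real.exp (-4 * τ * entropyHaar (.infinite w) a) := by
    rw [← Real.exp_nat_mul, entropyHaar_infinite]
    ring_nf
  rw [mul_pow, mul_pow, h3, ← hm, ← pow_mul (∏ i, _), mul_comm (2 * (n - 1)) w.mult,
    pow_mul (∏ i, _)]
  calc _ ≤ ((pairBound (ComplexAt w) n * R ^ 2) ^ m) ^ w.mult *
        (c * infiniteDisc Q E g w) ^ (2 * (n - 1)) *
          Real.exp (-4 * τ * entropyHaar (.infinite w) a) := by gcongr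
    _ = _ := by rw [mul_pow c, ← mul_assoc]

end PlaceBounds

/-! ### Uniform bounds at the finite places -/

section FiniteBounds

variable {F : Type*} [Field F] [NumberField F] {B : Type*} [Ring B] [Algebra F B]
  [FiniteDimensional F B] {f : Form} {n : ℕ} {Ω : Subalgebra (𝓞 F) B}

theorem exists_finite_bound (φ : Splitting n F B) (hB : Module.finrank F B = n ^ 2)
    (hn : n ≠ 0) (hΩ : IsOrderIn (⊤ : Subalgebra F B) Ω)
    (X : ∀ v : HeightOneSpectrum (𝓞 F), Set (GPts f n F B (Place.finite v).Completion))
    (hX : ∀ v, X v = compactOpen f n Ω v ∨ IsPrecompact (X v))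
    (hX' : ∀ᶠ v in Filter.cofinite, X v = compactOpen f n Ω v) :
    ∃ A c : HeightOneSpectrum (𝓞 F) → ℝ, (∀ v, 0 ≤ A v) ∧ (∀ v, 1 ≤ c v) ∧
      (∀ᶠ v in Filter.cofinite, A v = 1) ∧ (∀ᶠ v in Filter.cofinite, c v = 1) ∧
      ∀ (v : HeightOneSpectrum (𝓞 F)) (E : Subalgebra F B) (d : TorusDiag φ E),
      IsTorusAlgebra n E → ∀ (g : ∀ u : Place F, GPts f n F B u.Completion),
      IsOrderIn (localAlgebra E g (.finite v)) (toralOrder Ω E g v) →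
      0 < finiteDisc Ω E g v ∧ 1 ≤ c v * finiteDisc Ω E g v ∧
      ∀ (l : f.units n F B F) (b a t s : GPts f n F B (Place.finite v).Completion),
        t ∈ subPts f n (E.baseChange (Place.finite v).Completion).toSubmonoid →
        s ∈ subPts f n (E.baseChange (Place.finite v).Completion).toSubmonoid →
        GPts.map f n (Algebra.ofId F (Place.finite v).Completion) (QuotientGroup.mk l) =
          t * (g (.finite v) * b * (g (.finite v))⁻¹) * s →
        ∀ τ : ℕ, b ∈ bowenBall a (X v) (-τ) τ →
        a ∈ subPts f n (localAlgebra E g (.finite v)).toSubmonoid →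
        ∀ N : F, (algebraMap F (AlgebraicClosure F) N =
          ∏ p : Fin n × Fin n with p.1 ≠ p.2, d.pairing ((l : (F ⊗[F] B)ˣ) : F ⊗[F] B)
            (((l : (F ⊗[F] B)ˣ)⁻¹ : (F ⊗[F] B)ˣ) : F ⊗[F] B) p.1 p.2) →
        ‖algebraMap F (Place.finite v).Completion N‖ ≤
          A v * finiteDisc Ω E g v ^ (2 * (n - 1)) *
            Real.exp (-4 * τ * entropyHaar (.finite v) a) := by
  classical
  let ι : ∀ v : HeightOneSpectrum (𝓞 F),
    AlgebraicClosure F →ₐ[F] AlgebraicClosure (Place.finite v).Completion :=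
    fun v => IsAlgClosed.lift
  obtain ⟨c, hc1, hc2, hc3⟩ := exists_orderBound φ ι hΩ
  have hc0 : ∀ v, 0 ≤ c v := fun v => zero_le_one.trans (hc1 v)
  -- The value of `R` is prescribed when `X v` is the compact open subgroup, so that the constants
  -- are `1` at almost all places.
  have hR : ∀ v, ∃ R : ℝ, 0 ≤ R ∧ (X v = compactOpen f n Ω v → R = c v ^ 2) ∧
      ∀ x : f.units n F B (Place.finite v).Completion, QuotientGroup.mk x ∈ X v → ∀ p q r s,
        ‖localSplit φ (Place.finite v).Completion (ι v)
          ((x : ((Place.finite v).Completion ⊗[F] B)ˣ) : (Place.finite v).Completion ⊗[F] B) p q‖ *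
        ‖localSplit φ (Place.finite v).Completion (ι v)
          (((x : ((Place.finite v).Completion ⊗[F] B)ˣ)⁻¹ :
            ((Place.finite v).Completion ⊗[F] B)ˣ) :
              (Place.finite v).Completion ⊗[F] B) r s‖ ≤ R := by
    intro v
    by_cases h : X v = compactOpen f n Ω v
    · refine ⟨c v ^ 2, by positivity, fun _ => rfl, fun x hx => ?_⟩
      rw [h] at hx
      exact bound_of_mem_compactOpen (ι v) (hc3 v) x hx
    · obtain ⟨R, hR0, hR⟩ := exists_bound_of_isPrecompact (norm_algebraMap_closure v)
        (localSplit φ (Place.finite v).Completion (ι v)) ((hX v).resolve_left h)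
      exact ⟨R, hR0, fun h' => absurd h' h, hR⟩
  choose R hR0 hR1 hR2 using hR
  set m := (Finset.univ.filter fun p : Fin n × Fin n => p.1 ≠ p.2).card with hm
  refine ⟨fun v => (R v ^ 2) ^ m * (c v ^ (2 * n)) ^ (2 * (n - 1)), fun v => c v ^ (2 * n),
    fun v => by have := hc0 v; positivity, fun v => one_le_pow₀ (hc1 v), ?_, ?_,
    fun v E d hE g hord => ?_⟩
  · filter_upwards [hX', hc2] with v h1 h2
    simp [hR1 v h1, h2]
  · filter_upwards [hc2] with v h2
    simp [h2]
  obtain ⟨g', hg'⟩ := QuotientGroup.mk_surjective (g (.finite v))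
  obtain ⟨hD, hge, hsize⟩ := finiteDisc_bounds d (ι v) hB hn hE (hc1 v) (hc3 v) g' hg' hord
  refine ⟨hD, hge, fun l b a t s ht hs hl τ hb ha N hN => ?_⟩
  have h1 := d.norm_invariant_le (ι v) hB hn l g' ht hs (hg'.symm ▸ hl) τ hb
    (by rw [hg']; exact ha) (hR0 v) (hR2 v) hN
  rw [IsScalarTower.algebraMap_apply F (Place.finite v).Completion, norm_algebraMap_closure,
    pairBound_eq_one (isNonarchimedean_closure v), one_mul, ← hm] at h1
  refine h1.trans ?_
  have hs0 : 0 ≤ ∏ i, d.size (ι v) (g' : ((Place.finite v).Completion ⊗[F] B)ˣ) i :=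
    Finset.prod_nonneg fun i _ => d.size_nonneg (ι v) _ i
  have hR := hR0 v
  have h3 : -2 * τ * logSum (AlgebraicClosure (Place.finite v).Completion) a =
      -4 * τ * entropyHaar (.finite v) a := by
    rw [entropyHaar_finite]
    ring
  rw [h3]
  calc _ ≤ (R v ^ 2) ^ m * (c v ^ (2 * n) * finiteDisc Ω E g v) ^ (2 * (n - 1)) *
          Real.exp (-4 * τ * entropyHaar (.finite v) a) := by gcongr
    _ = _ := by rw [mul_pow (c v ^ (2 * n)), ← mul_assoc]

end FiniteBounds

/-! ### Products over all places -/

section Finprod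

theorem finprod_le_finprod_of_eventually {α : Type*} {p q : α → ℝ} (hp0 : ∀ x, 0 ≤ p x)
    (hp : ∀ᶠ x in Filter.cofinite, p x = 1) (hq : ∀ᶠ x in Filter.cofinite, q x = 1)
    (h : ∀ x, p x ≤ q x) : ∏ᶠ x, p x ≤ ∏ᶠ x, q x := by
  classical
  have hp' : (Function.mulSupport p).Finite := hp
  have hq' : (Function.mulSupport q).Finite := hq
  rw [finprod_eq_prod_of_mulSupport_subset (s := hp'.toFinset ∪ hq'.toFinset) p (by simp),
    finprod_eq_prod_of_mulSupport_subset (s := hp'.toFinset ∪ hq'.toFinset) q (by simp)]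
  exact Finset.prod_le_prod (fun x _ => hp0 x) fun x _ => h x

theorem prod_mul_finprod_ite {α β γ : Type*} [Fintype α] [DecidableEq γ] (i : α → γ) (j : β → γ)
    (hi : i.Injective) (hj : j.Injective) (hij : ∀ x y, i x ≠ j y) (z : γ)
    (hz : z ∈ Set.range i ∪ Set.range j) (r : ℝ) :
    (∏ x, if i x = z then r else 1) * ∏ᶠ y, (if j y = z then r else 1) = r := by
  rcases hz with ⟨x, rfl⟩ | ⟨y, rfl⟩
  · rw [Finset.prod_eq_single x (fun x' _ hx => if_neg fun h => hx (hi h)) (by simp), if_pos rfl]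
    simp [fun y => (hij x y).symm]
  · rw [finprod_eq_single _ y fun y' hy => if_neg fun h => hy (hj h), if_pos rfl]
    simp [hij]

end Finprod

/-! ### From the product formula to the theorem -/

section Conclusion

/-- The logarithm of `H` divided by `2 * (n - 1)`. The factor `R`, which is the ramified
discriminant in the application, is replaced by its lower bound `r` at the cost of a constant. -/
theorem le_log_of_one_le_mul {n : ℕ} (hn : 2 ≤ n) {A D r R h : ℝ} (hA : 0 ≤ A) (hD : 0 ≤ D)
    (hr : 0 < r) (hrR : r ≤ R) (τ : ℕ)
    (H : 1 ≤ A * D ^ (2 * (n - 1)) * Real.exp (-4 * τ * h)) :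
    2 * (h / ((n : ℝ) - 1)) * τ ≤ Real.log (D * R ^ ((n : ℝ) / 2)) +
      (Real.log A / (2 * ((n : ℝ) - 1)) - (n : ℝ) / 2 * Real.log r) := by
  have hA' : 0 < A := hA.lt_of_ne' fun h0 => by
    rw [h0] at H
    norm_num at H
  have hD' : 0 < D := hD.lt_of_ne' fun h0 => by
    rw [h0, zero_pow (by omega)] at H
    norm_num at H
  have hR : 0 < R := hr.trans_le hrR
  have h1 := Real.log_nonneg H
  rw [Real.log_mul (by positivity) (by positivity), Real.log_mul (by positivity) (by positivity),
    Real.log_exp, Real.log_pow] at h1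
  have hn1 : ((2 * (n - 1) : ℕ) : ℝ) = 2 * ((n : ℝ) - 1) := by
    rw [Nat.cast_mul, Nat.cast_sub (by omega)]
    norm_num
  rw [hn1] at h1
  have hn0 : 0 < (n : ℝ) - 1 := by
    have : (2 : ℝ) ≤ n := by exact_mod_cast hn
    linarith
  rw [Real.log_mul (by positivity) (by positivity), Real.log_rpow hR]
  have h2 : (n : ℝ) / 2 * Real.log r ≤ (n : ℝ) / 2 * Real.log R := by
    gcongr
  have h3 : 2 * (h / ((n : ℝ) - 1)) * τ ≤ Real.log D + Real.log A / (2 * ((n : ℝ) - 1)) := by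
    have h4 : 2 * (h / ((n : ℝ) - 1)) * τ = 4 * τ * h / (2 * ((n : ℝ) - 1)) := by
      field_simp
      ring
    rw [h4, div_le_iff₀ (by positivity), add_mul, div_mul_cancel₀ _ (by positivity)]
    linarith
  linarith

variable {F : Type*} [Field F] [NumberField F] {B : Type*} [Ring B] [Algebra F B] {f : Form}
  {n : ℕ} {Ω : Subalgebra (𝓞 F) B}

/-- At a ramified place `(c v)⁻¹` bounds the discriminant from below, and elsewhere it is at most
`1`. The resulting bound does not involve the torus. -/
theorem finprod_inv_le_ramifiedDisc {E : Subalgebra F B}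
    {g : ∀ u : Place F, GPts f n F B u.Completion} {c : HeightOneSpectrum (𝓞 F) → ℝ}
    (hc : ∀ v, 1 ≤ c v) (hc1 : ∀ᶠ v in Filter.cofinite, c v = 1)
    (hD : ∀ v, 1 ≤ c v * finiteDisc Ω E g v)
    (hD1 : ∀ᶠ v in Filter.cofinite, finiteDisc Ω E g v = 1) :
    ∏ᶠ v, (c v)⁻¹ ≤ ramifiedDisc Ω E g := by
  classical
  have hc0 : ∀ v, 0 < c v := fun v => zero_lt_one.trans_le (hc v)
  refine finprod_le_finprod_of_eventually (fun v => (inv_pos.2 (hc0 v)).le) ?_ ?_ fun v => ?_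
  · filter_upwards [hc1] with v hv
    rw [hv, inv_one]
  · filter_upwards [hD1] with v hv
    simp [hv]
  · rw [finprod_eq_if]
    split_ifs
    · exact (inv_le_iff_one_le_mul₀' (hc0 v)).2 (hD v)
    · exact inv_le_one_of_one_le₀ (hc v)

theorem entropyHaar_nonneg [FiniteDimensional F B] (u : Place F) (a : GPts f n F B u.Completion) :
    0 ≤ entropyHaar u a := by
  cases u with
  | infinite w =>
    rw [entropyHaar_infinite]
    have := logSum_nonneg (K := ComplexAt w) a
    positivity
  | finite v =>
    rw [entropyHaar_finite]
    have := logSum_nonneg (K := AlgebraicClosure (Place.finite v).Completion) a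
    positivity

theorem bowenBall_one {G : Type*} [Group G] (X : Set G) (s t : ℤ) : bowenBall 1 X s t = X := by
  simp [bowenBall]

open Classical in
theorem exp_entropyHaar_mulSingle_le [FiniteDimensional F B] (u₀ u : Place F)
    (a : GPts f n F B u₀.Completion) (τ : ℕ) :
    Real.exp (-4 * τ * entropyHaar u
      (Pi.mulSingle (M := fun u : Place F => GPts f n F B u.Completion) u₀ a u)) ≤
      if u = u₀ then Real.exp (-4 * τ * entropyHaar u₀ a) else 1 := by
  split_ifs with h
  · subst h
    rw [Pi.mulSingle_eq_same]
  · rw [Real.exp_le_one_iff]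
    have := entropyHaar_nonneg u
      (Pi.mulSingle (M := fun u : Place F => GPts f n F B u.Completion) u₀ a u)
    have h2 : 0 ≤ 4 * (τ : ℝ) * entropyHaar u
      (Pi.mulSingle (M := fun u : Place F => GPts f n F B u.Completion) u₀ a u) := by positivity
    linarith

open Classical in
theorem mulSingle_mem_subPts {E : Subalgebra F B} {g : ∀ u : Place F, GPts f n F B u.Completion}
    {u₀ : Place F} {a : GPts f n F B u₀.Completion}
    (ha : a ∈ subPts f n (localAlgebra E g u₀).toSubmonoid) (u : Place F) :
    Pi.mulSingle (M := fun u : Place F => GPts f n F B u.Completion) u₀ a u ∈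
      subPts f n (localAlgebra E g u).toSubmonoid := by
  by_cases h : u = u₀
  · subst h
    rwa [Pi.mulSingle_eq_same]
  · rw [Pi.mulSingle_eq_of_ne h]
    exact one_mem _

end Conclusion

end Toral

end

theorem mainTheorem2 {F : Type*} [Field F] [NumberField F]
    {B : Type*} [Ring B] [Algebra F B] [Algebra.IsCentral F B] [IsSimpleRing B]
    [FiniteDimensional F B] (n : ℕ) (hn : 2 ≤ n) (hB : Module.finrank F B = n ^ 2)
    (f : Form)
    (Ω : Subalgebra (𝓞 F) B) (hΩ : IsOrderIn (⊤ : Subalgebra F B) Ω)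
    (Q : HermitianData F B)
    (hQ : ∀ (w : InfinitePlace F) (x : ComplexAt w ⊗[F] B),
      reducedTrace n (ComplexAt w) x = 0 → (Q w).inner 1 x = 0)
    (S : Finset (Place F)) (hS : ∀ w : InfinitePlace F, Place.infinite w ∈ S)
    (u₀ : Place F) (hu₀ : u₀ ∈ S)
    (C : Subalgebra u₀.Completion (u₀.Completion ⊗[F] B)) (hC : IsTorusAlgebra n C)
    (X : ∀ u : Place F, Set (GPts f n F B u.Completion))
    (hX : ∀ u ∈ S, IsPrecompact (X u))
    (hXK : ∀ v : HeightOneSpectrum (𝓞 F), Place.finite v ∈ S → Place.finite v ≠ u₀ →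
      X (.finite v) ⊆ compactOpen f n Ω v) :
    ∃ κ : ℝ, ∀ a ∈ subPts f n C.toSubmonoid,
      ∀ E : Subalgebra F B, IsTorusAlgebra n E →
      ∀ g ∈ adelicPts f n Ω,
        localAlgebra E g u₀ = C →
        IsMaximalType Ω E g →
        HasTwoTransitiveGalois E →
      ∀ τ : ℕ,
        2 * (entropyHaar u₀ a / ((n : ℝ) - 1)) * τ >
          Real.log (globalDisc Ω Q E g * ramifiedDisc Ω E g ^ ((n : ℝ) / 2)) + κ →
      ∀ l : GPts f n F B F,
        diagonal f n l ∈ (torusAdelicPts f n Ω E : Set (∀ u : Place F, GPts f n F B u.Completion)) *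
            ({g} * bowenTube Ω S u₀ a X τ * {g⁻¹}) * torusAdelicPts f n Ω E →
        l ∈ subPts f n (E.baseChange F).toSubmonoid := by
  classical
  have hn0 : n ≠ 0 := by omega
  obtain ⟨φ⟩ := nonempty_splitting hB
  choose A₁ hA₁ hbound₁ using fun w : InfinitePlace F =>
    exists_infinite_bound (f := f) φ hB hn0 Q w (hX _ (hS w))
  -- The local factors of the tube at all finite places at once; they are pre-compact or equal to
  -- the compact open subgroups, the latter at almost all places.
  let Y : ∀ v : HeightOneSpectrum (𝓞 F), Set (GPts f n F B (Place.finite v).Completion) :=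
    fun v => if Place.finite v ∈ S then X (.finite v) else compactOpen f n Ω v
  have hY : ∀ v, Y v = compactOpen f n Ω v ∨ IsPrecompact (Y v) := fun v => by
    by_cases h : Place.finite v ∈ S
    · right
      simp only [Y, if_pos h]
      exact hX _ h
    · exact Or.inl (if_neg h)
  have hY' : ∀ᶠ v in Filter.cofinite, Y v = compactOpen f n Ω v := by
    have hfin : ((Place.finite : HeightOneSpectrum (𝓞 F) → Place F) ⁻¹' (S : Set (Place F))).Finite :=
      S.finite_toSet.preimage fun v _ v' _ h => Place.finite.inj h
    filter_upwards [hfin.compl_mem_cofinite] with v hv using if_neg hv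
  obtain ⟨A₂, c, hA₂, hc, hA₂1, hc1, hbound₂⟩ := exists_finite_bound φ hB hn0 hΩ Y hY hY'
  -- The first term collects the local constants and the second the lower bound for the ramified
  -- discriminant; all of them were chosen before `a`, `E`, `g` and `τ`.
  refine ⟨Real.log ((∏ w, A₁ w) * ∏ᶠ v, A₂ v) / (2 * ((n : ℝ) - 1)) -
    (n : ℝ) / 2 * Real.log (∏ᶠ v, (c v)⁻¹), fun a ha E hE g hg hgC hmax hGal τ hτ l hl => ?_⟩
  by_contra hlT
  refine hτ.not_ge ?_
  obtain ⟨d⟩ := nonempty_torusDiag φ hE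
  obtain ⟨l, rfl⟩ := QuotientGroup.mk_surjective l
  have hlE : ¬(((l : (F ⊗[F] B)ˣ) : F ⊗[F] B) ∈ E.baseChange F ∧
      (((l : (F ⊗[F] B)ˣ)⁻¹ : (F ⊗[F] B)ˣ) : F ⊗[F] B) ∈ E.baseChange F) := fun h =>
    hlT ⟨l, Subgroup.mem_subgroupOf.2 ((Submonoid.mem_units_iff _ _).2 h), rfl⟩
  obtain ⟨N, hN0, hN⟩ := d.exists_invariant hB hn0 hE hGal (l : (F ⊗[F] B)ˣ) hlE
  obtain ⟨_, ⟨t, ht, _, ⟨_, ⟨g₁, hg₁, b, hb, rfl⟩, g₂, hg₂, rfl⟩, rfl⟩, s, hs, hl⟩ := hl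
  rw [Set.mem_singleton_iff.1 hg₁, Set.mem_singleton_iff.1 hg₂] at hl
  have hlu : ∀ u : Place F, GPts.map f n (Algebra.ofId F u.Completion) (QuotientGroup.mk l) =
      t u * (g u * b u * (g u)⁻¹) * s u := fun u => (congrFun hl u).symm
  have htu : ∀ u : Place F, t u ∈ subPts f n (E.baseChange u.Completion).toSubmonoid :=
    fun u => ht.2 u trivial
  have hsu : ∀ u : Place F, s u ∈ subPts f n (E.baseChange u.Completion).toSubmonoid :=
    fun u => hs.2 u trivial
  rw [← hgC] at ha
  -- The contraction factor is placed at `u₀` alone, as `a` acts trivially at the other places.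
  let e : Place F → ℝ := fun u =>
    if u = u₀ then Real.exp (-4 * τ * entropyHaar u₀ a) else 1
  have he : (∏ w : InfinitePlace F, e (.infinite w)) *
      ∏ᶠ v : HeightOneSpectrum (𝓞 F), e (.finite v) = Real.exp (-4 * τ * entropyHaar u₀ a) :=
    prod_mul_finprod_ite Place.infinite Place.finite (fun _ _ => Place.infinite.inj)
      (fun _ _ => Place.finite.inj) (fun _ _ h => by cases h) u₀
      (by cases u₀ with
        | infinite w => exact Or.inl ⟨w, rfl⟩
        | finite v => exact Or.inr ⟨v, rfl⟩) _
  have he1 : ∀ᶠ v : HeightOneSpectrum (𝓞 F) in Filter.cofinite, e (.finite v) = 1 := by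
    have hfin : ((Place.finite : HeightOneSpectrum (𝓞 F) → Place F) ⁻¹' {u₀}).Finite :=
      (Set.finite_singleton u₀).preimage fun v _ v' _ h => Place.finite.inj h
    filter_upwards [hfin.compl_mem_cofinite] with v hv using if_neg hv
  have hD₁ := infiniteDisc_nonneg Q E g
  have hD₂ : ∀ v, 0 < finiteDisc Ω E g v := fun v => (hbound₂ v E d hE g (hmax v).prop).1
  have hDev : ∀ᶠ v in Filter.cofinite, finiteDisc Ω E g v = 1 :=
    eventually_finiteDisc_eq_one d hB hn0 hE hΩ hg hmax fun v => IsAlgClosed.lift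
  have h₁ : ∀ w : InfinitePlace F, (Place.infinite w).nabs (algebraMap F _ N) ≤
      A₁ w * infiniteDisc Q E g w ^ (2 * (n - 1)) * e (.infinite w) := fun w => by
    refine (hbound₁ w E d hE g l (b _) _ (t _) (s _) (htu _) (hsu _) (hlu _) τ (hb.1 _ (hS w))
      (mulSingle_mem_subPts ha _) N hN).trans ?_
    have := hA₁ w
    have := hD₁ w
    gcongr
    exact exp_entropyHaar_mulSingle_le u₀ (.infinite w) a τ
  have h₂ : ∀ v : HeightOneSpectrum (𝓞 F), ‖algebraMap F (Place.finite v).Completion N‖ ≤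
      A₂ v * finiteDisc Ω E g v ^ (2 * (n - 1)) * e (.finite v) := fun v => by
    have hbv : b (.finite v) ∈ bowenBall
        (Pi.mulSingle (M := fun u : Place F => GPts f n F B u.Completion) u₀ a (.finite v))
        (Y v) (-τ) τ := by
      by_cases h : Place.finite v ∈ S
      · simp only [Y, if_pos h]
        exact hb.1 _ h
      -- As `u₀ ∈ S`, outside `S` the acting element is `1` and its Bowen ball is the whole
      -- subgroup.
      · rw [Pi.mulSingle_eq_of_ne (show Place.finite v ≠ u₀ from fun h' => h (h'.symm ▸ hu₀)), bowenBall_one]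
        simp only [Y, if_neg h]
        exact hb.2 v h
    refine ((hbound₂ v E d hE g (hmax v).prop).2.2 l (b _) _ (t _) (s _) (htu _) (hsu _) (hlu _) τ
      hbv (mulSingle_mem_subPts ha _) N hN).trans ?_
    have := hA₂ v
    have := hD₂ v
    gcongr
    exact exp_entropyHaar_mulSingle_le u₀ (.finite v) a τ
  have hfp : ∏ᶠ v : HeightOneSpectrum (𝓞 F), ‖algebraMap F (Place.finite v).Completion N‖ ≤
      (∏ᶠ v, A₂ v) * (∏ᶠ v, finiteDisc Ω E g v) ^ (2 * (n - 1)) * ∏ᶠ v, e (.finite v) := by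
    have hs1 : Function.HasFiniteMulSupport fun v => finiteDisc Ω E g v := hDev
    have hs2 : ∀ᶠ v in Filter.cofinite, finiteDisc Ω E g v ^ (2 * (n - 1)) = 1 := by
      filter_upwards [hDev] with v hv
      rw [hv, one_pow]
    have hs3 : ∀ᶠ v in Filter.cofinite, A₂ v * finiteDisc Ω E g v ^ (2 * (n - 1)) = 1 := by
      filter_upwards [hs2, hA₂1] with v h1 h2
      rw [h1, h2, one_mul]
    rw [finprod_pow hs1, ← finprod_mul_distrib hA₂1 hs2, ← finprod_mul_distrib hs3 he1]
    refine finprod_le_finprod_of_eventually (fun v => norm_nonneg _) (eventually_norm_eq_one hN0)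
      ?_ h₂
    filter_upwards [hs3, he1] with v h1 h2
    rw [h1, h2, one_mul]
  have hip : ∏ w : InfinitePlace F, (Place.infinite w).nabs
      (algebraMap F (Place.infinite w).Completion N) ≤
      (∏ w, A₁ w) * (∏ w, infiniteDisc Q E g w) ^ (2 * (n - 1)) * ∏ w, e (.infinite w) := by
    rw [← Finset.prod_pow, ← Finset.prod_mul_distrib, ← Finset.prod_mul_distrib]
    exact Finset.prod_le_prod (fun w _ => pow_nonneg (norm_nonneg _) _) fun w _ => h₁ w
  have hfin0 : 0 ≤ ∏ᶠ v : HeightOneSpectrum (𝓞 F), ‖algebraMap F (Place.finite v).Completion N‖ :=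
    finprod_nonneg fun v => norm_nonneg _
  have he0 : ∀ u, 0 ≤ e u := fun u => by
    simp only [e]
    split_ifs <;> positivity
  have hA0 : 0 ≤ ∏ w, A₁ w := Finset.prod_nonneg fun w _ => hA₁ w
  have hDp0 : 0 ≤ ∏ w, infiniteDisc Q E g w := Finset.prod_nonneg fun w _ => hD₁ w
  have hep0 : 0 ≤ ∏ w : InfinitePlace F, e (.infinite w) := Finset.prod_nonneg fun w _ => he0 _
  refine le_log_of_one_le_mul hn (mul_nonneg hA0 (finprod_nonneg hA₂))
    (mul_nonneg hDp0 (finprod_nonneg fun v => (hD₂ v).le))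
    (finprod_induction (0 < ·) zero_lt_one (fun _ _ => mul_pos)
      fun v => inv_pos.2 (zero_lt_one.trans_le (hc v)))
    (finprod_inv_le_ramifiedDisc hc hc1
      (fun v => (hbound₂ v E d hE g (hmax v).prop).2.1) hDev) τ ?_
  -- The product formula replaces `1` by the product of the absolute values of `N`, to which the
  -- local bounds apply.
  rw [← prod_nabs_eq_one hN0, ← he]
  refine (mul_le_mul hip hfp hfin0 (by positivity)).trans_eq ?_
  rw [mul_pow]
  ring
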